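/- Let $\Omega\subseteq\mathbb R^4$ be a connected open set with coordinates $(x,y,f,g)$, let $w_1,w_2$ be smooth real functions on $\Omega\times\mathbb R^2$, and consider, for functions $f(x,y),g(x,y)$, the system $$f_{xx}-f_{yy}+2g_{xy}=4w_1(x,y,f,g,h,l),\qquad g_{xx}-g_{yy}-2f_{xy}=4w_2(x,y,f,g,h,l),\tag{5}$$ where $2h=f_x+g_y$, $2l=g_x-f_y$, together with the Cauchy–Riemann equations $f_x=g_y$, $f_y=-g_x$. Suppose that smooth vector fields $\mathbf X_1,\mathbf Y_1,\mathbf X_2,\mathbf Y_2$ on $\Omega$, with $\mathbf X_2,\mathbf Y_2$ not both identically zero, are Lie point symmetries of this system (their second prolongations annihilate all its equations at every 2-jet over $\Omega$ that satisfies the system and the first derivatives of the Cauchy–Riemann equations), that $$\mathbf X_1=\rho_1\mathbf X_2-\rho_2\mathbf Y_2,\qquad \mathbf Y_1=\rho_1\mathbf Y_2+\rho_2\mathbf X_2 \tag{12}$$ for nonconstant smooth functions $\rho_1,\rho_2:\Omega\to\mathbb R$, and that $$[\mathbf X_1,\mathbf X_2]-[\mathbf Y_1,\mathbf Y_2]=0,\qquad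 [\mathbf X_1,\mathbf Y_2]+[\mathbf Y_1,\mathbf X_2]=0. \tag{13}$$ Then the set of points of $\Omega$ at which $\mathbf X_1\neq0$ and $(d\rho_1,d\rho_2)\neq 0$ is dense in $\Omega$, and for each point of this set there is a point transformation $(x,y,f,g)\mapsto(X,Y,F,G)$, i.e. a smooth diffeomorphism from an open neighbourhood of the point in $\Omega$ onto an open subset of $\mathbb R^4$, which brings the four symmetries to the canonical form $$\mathbf X_1=\frac{\partial}{\partial F},\quad \mathbf Y_1=-\frac{\partial}{\partial G},\quad \mathbf X_2=X\frac{\partial}{\partial F}+Y\frac{\partial}{\partial G},\quad \mathbf Y_2=Y\frac{\partial}{\partial F}-X\frac{\partial}{\partial G}, \tag{14}$$ and which reduces the system to the linear form $$F_{XX}-F_{YY}+2G_{XY}=4W_1(X,Y),\qquad G_{XX}-G_{YY}-2F_{XY}=4W_2(X,Y), \tag{15}$$ together with $F_X=G_Y$, $F_Y=-G_X$, where $W_1,W_2$ are smooth functions of $(X,Y)$ on the projection of the image of the transformation. Here "reduces" means: whenever the transformation maps the graph of a $C^2$ map $(f,g)$ over an open set of the $(x,y)$-plane onto the graph of a $C^2$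 map $(F,G)$ over an open set of the $(X,Y)$-plane, $(f,g)$ solves the original system if and only if $(F,G)$ solves the linear one; and, more precisely, at each point the 2-jet of $(f,g)$ satisfies the original system and the first derivatives of its Cauchy–Riemann equations if and only if the 2-jet of $(F,G)$ at the corresponding point satisfies the linear system and the first derivatives of its Cauchy–Riemann equations. -/

import Mathlib

open scoped ContDiff

noncomputable section

namespace ComplexLinearization

/-- The real plane: either the independent variables `(x, y)` or the dependent ones `(f, g)`. -/
abbrev Plane : Type := ℝ × ℝ

/-- The space of independent and dependent variables `((x, y), (f, g))`. -/
abbrev PointSpace : Type := Plane × Plane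

/-- Second-order jets of maps `(x, y) ↦ u = (f, g)`:
`(((x, y), (f, g)), (u_x, u_y), (u_xx, u_xy, u_yy))`. -/
abbrev Jet : Type := PointSpace × (Plane × Plane) × (Plane × Plane × Plane)

namespace Jet

/-- The underlying point `((x, y), (f, g))`. -/
abbrev pt (J : Jet) : PointSpace := J.1
/-- `u_x = (f_x, g_x)` -/
abbrev ux (J : Jet) : Plane := J.2.1.1
/-- `u_y = (f_y, g_y)` -/
abbrev uy (J : Jet) : Plane := J.2.1.2
/-- `u_xx = (f_xx, g_xx)` -/
abbrev uxx (J : Jet) : Plane := J.2.2.1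
/-- `u_xy = (f_xy, g_xy)` -/
abbrev uxy (J : Jet) : Plane := J.2.2.2.1
/-- `u_yy = (f_yy, g_yy)` -/
abbrev uyy (J : Jet) : Plane := J.2.2.2.2

/-- `h = (f_x + g_y) / 2` -/
def h (J : Jet) : ℝ := (J.ux.1 + J.uy.2) / 2
/-- `l = (g_x - f_y) / 2` -/
def l (J : Jet) : ℝ := (J.ux.2 - J.uy.1) / 2

end Jet

/-- The two second-order equations, as functions on the jet space to be equated to zero:
`f_xx - f_yy + 2 g_xy - 4 w₁(x, y, f, g, h, l)` and
`g_xx - g_yy - 2 f_xy - 4 w₂(x, y, f, g, h, l)`. -/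
def secondOrder (w₁ w₂ : PointSpace × (ℝ × ℝ) → ℝ) (J : Jet) : ℝ × ℝ :=
  (J.uxx.1 - J.uyy.1 + 2 * J.uxy.2 - 4 * w₁ (J.pt, (J.h, J.l)),
   J.uxx.2 - J.uyy.2 - 2 * J.uxy.1 - 4 * w₂ (J.pt, (J.h, J.l)))

/-- The Cauchy-Riemann equations `f_x = g_y`, `f_y = - g_x`. -/
def cauchyRiemann (J : Jet) : ℝ × ℝ :=
  (J.ux.1 - J.uy.2, J.uy.1 + J.ux.2)

/-- The `x`-derivative of the Cauchy-Riemann equations. -/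
def cauchyRiemannX (J : Jet) : ℝ × ℝ :=
  (J.uxx.1 - J.uxy.2, J.uxy.1 + J.uxx.2)

/-- The `y`-derivative of the Cauchy-Riemann equations. -/
def cauchyRiemannY (J : Jet) : ℝ × ℝ :=
  (J.uxy.1 - J.uyy.2, J.uyy.1 + J.uxy.2)

/-- The jet lies on the variety of the system: the second-order equations, the Cauchy-Riemann
equations and the first derivatives of the latter hold at it. -/
def OnSystem (w₁ w₂ : PointSpace × (ℝ × ℝ) → ℝ) (J : Jet) : Prop :=
  secondOrder w₁ w₂ J = 0 ∧ cauchyRiemann J = 0 ∧ cauchyRiemannX J = 0 ∧ cauchyRiemannY J = 0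

/-- The second-order jet at `p` of a map `u = (f, g)` of `(x, y)`. -/
def jetOf (u : Plane → Plane) (p : Plane) : Jet :=
  ((p, u p),
   (fderiv ℝ u p (1, 0), fderiv ℝ u p (0, 1)),
   (fderiv ℝ (fun p' => fderiv ℝ u p' (1, 0)) p (1, 0),
    fderiv ℝ (fun p' => fderiv ℝ u p' (1, 0)) p (0, 1),
    fderiv ℝ (fun p' => fderiv ℝ u p' (0, 1)) p (0, 1)))

/-- `u = (f, g)` is a (twice continuously differentiable) solution on `V` of the two
second-order equations together with the Cauchy-Riemann equations. -/
def IsSolution (w₁ w₂ : PointSpace × (ℝ × ℝ) → ℝ) (V : Set Plane) (u : Plane → Plane) : Prop :=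
  ContDiffOn ℝ 2 u V ∧
    ∀ p ∈ V, secondOrder w₁ w₂ (jetOf u p) = 0 ∧ cauchyRiemann (jetOf u p) = 0

section Prolongation

/-- Total derivative `D_x` of a (vector-valued) function of `((x, y), (f, g))`. -/
def totalX (c : PointSpace → PointSpace) (J : Jet) : PointSpace :=
  fderiv ℝ c J.pt ((1, 0), J.ux)

/-- Total derivative `D_y`. -/
def totalY (c : PointSpace → PointSpace) (J : Jet) : PointSpace :=
  fderiv ℝ c J.pt ((0, 1), J.uy)

/-- Second total derivative `D_x D_x`. -/
def totalXX (c : PointSpace → PointSpace) (J : Jet) : PointSpace :=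
  fderiv ℝ (fderiv ℝ c) J.pt ((1, 0), J.ux) ((1, 0), J.ux) + fderiv ℝ c J.pt (0, J.uxx)

/-- Second total derivative `D_x D_y`. -/
def totalXY (c : PointSpace → PointSpace) (J : Jet) : PointSpace :=
  fderiv ℝ (fderiv ℝ c) J.pt ((1, 0), J.ux) ((0, 1), J.uy) + fderiv ℝ c J.pt (0, J.uxy)

/-- Second total derivative `D_y D_y`. -/
def totalYY (c : PointSpace → PointSpace) (J : Jet) : PointSpace :=
  fderiv ℝ (fderiv ℝ c) J.pt ((0, 1), J.uy) ((0, 1), J.uy) + fderiv ℝ c J.pt (0, J.uyy)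

/-- `η-part - ξ¹-part · a - ξ²-part · b` of a vector `((ξ¹, ξ²), η)`. -/
def charPart (v : PointSpace) (a b : Plane) : Plane :=
  v.2 - v.1.1 • a - v.1.2 • b

/-- The second prolongation of the vector field
`X = ξ¹ ∂_x + ξ² ∂_y + η¹ ∂_f + η² ∂_g`, written `X = ((ξ¹, ξ²), (η¹, η²))`, with coefficients
`η_i = D_i η - u_k D_i ξ^k` and
`η_ij = D_i D_j η - u_k D_i D_j ξ^k - u_ik D_j ξ^k - u_jk D_i ξ^k`. -/
def prolong (X : PointSpace → PointSpace) (J : Jet) : Jet :=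
  (X J.pt,
   (charPart (totalX X J) J.ux J.uy, charPart (totalY X J) J.ux J.uy),
   (charPart (totalXX X J) J.ux J.uy
      - (2 * (totalX X J).1.1) • J.uxx - (2 * (totalX X J).1.2) • J.uxy,
    charPart (totalXY X J) J.ux J.uy
      - (totalY X J).1.1 • J.uxx - (totalY X J).1.2 • J.uxy
      - (totalX X J).1.1 • J.uxy - (totalX X J).1.2 • J.uyy,
    charPart (totalYY X J) J.ux J.uy
      - (2 * (totalY X J).1.1) • J.uxy - (2 * (totalY X J).1.2) • J.uyy))

end Prolongation

/-- Lie's infinitesimal criterion: the smooth vector field `X` on `Ω` is a point symmetry of the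
system if its second prolongation annihilates all equations on the variety of the system. -/
def IsSymmetry (Ω : Set PointSpace) (w₁ w₂ : PointSpace × (ℝ × ℝ) → ℝ)
    (X : PointSpace → PointSpace) : Prop :=
  ContDiffOn ℝ ∞ X Ω ∧
    ∀ J : Jet, J.pt ∈ Ω → OnSystem w₁ w₂ J →
      fderiv ℝ (secondOrder w₁ w₂) J (prolong X J) = 0 ∧
      fderiv ℝ cauchyRiemann J (prolong X J) = 0

/-- The function `ρ` is not constant on `Ω`. -/
def NonconstantOn (ρ : PointSpace → ℝ) (Ω : Set PointSpace) : Prop :=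
  ¬ ∃ c : ℝ, ∀ q ∈ Ω, ρ q = c

/-- The points near which the canonical form can be attained: the vector field `X₁` and the
differential of `(ρ₁, ρ₂)` do not vanish. -/
def regularSet (Ω : Set PointSpace) (X₁ : PointSpace → PointSpace) (ρ₁ ρ₂ : PointSpace → ℝ) :
    Set PointSpace :=
  {q | q ∈ Ω ∧ X₁ q ≠ 0 ∧ (fderiv ℝ ρ₁ q ≠ 0 ∨ fderiv ℝ ρ₂ q ≠ 0)}

/-- A point transformation `((x, y), (f, g)) ↦ ((X, Y), (F, G))`: a diffeomorphism between open
sets of the space of independent and dependent variables. -/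
def IsPointTransformation (Φ : OpenPartialHomeomorph PointSpace PointSpace) : Prop :=
  ContDiffOn ℝ ∞ Φ Φ.source ∧ ContDiffOn ℝ ∞ Φ.symm Φ.target

/-- The transformation `Φ` carries the vector field `A` to the vector field `B`. -/
def Carries (Φ : OpenPartialHomeomorph PointSpace PointSpace)
    (A B : PointSpace → PointSpace) : Prop :=
  ∀ q ∈ Φ.source, fderiv ℝ Φ q (A q) = B (Φ q)

/-- The graph of `u` over `V`. -/
def graphOver (u : Plane → Plane) (V : Set Plane) : Set PointSpace :=
  (fun p => (p, u p)) '' V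

/-- The transformation `Φ` carries the twice continuously differentiable map `u = (f, g)` of
`(x, y) ∈ V` to the twice continuously differentiable map `U = (F, G)` of `(X, Y) ∈ V'`. -/
def CarriesMap (Φ : OpenPartialHomeomorph PointSpace PointSpace)
    (V : Set Plane) (u : Plane → Plane) (V' : Set Plane) (U : Plane → Plane) : Prop :=
  IsOpen V ∧ IsOpen V' ∧ ContDiffOn ℝ 2 u V ∧ ContDiffOn ℝ 2 U V' ∧
    graphOver u V ⊆ Φ.source ∧ Φ '' graphOver u V = graphOver U V'

/-- `Φ` reduces the system with right-hand sides `w₁, w₂` to the one with right-hand sides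
`w₁', w₂'`: a 2-jet of a map lies on the first system if and only if the corresponding
2-jet of the transformed map lies on the second one, and a map is a solution of the first system
if and only if the transformed map is a solution of the second one. -/
def Reduces (Φ : OpenPartialHomeomorph PointSpace PointSpace)
    (w₁ w₂ w₁' w₂' : PointSpace × (ℝ × ℝ) → ℝ) : Prop :=
  ∀ (V : Set Plane) (u : Plane → Plane) (V' : Set Plane) (U : Plane → Plane),
    CarriesMap Φ V u V' U →
      (∀ p ∈ V, OnSystem w₁ w₂ (jetOf u p) ↔ OnSystem w₁' w₂' (jetOf U (Φ (p, u p)).1)) ∧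
      (IsSolution w₁ w₂ V u ↔ IsSolution w₁' w₂' V' U)

end ComplexLinearization

end

/-! Put z = x + iy and u = f + ig. On the Cauchy–Riemann equations and their first derivatives, h +
il = u_z and the two second-order equations collapse to one complex equation u_zz = w(z, u, u_z)
with w = w₁ + i w₂ (`onSystem_iff`). Nothing makes w holomorphic, so w is always differentiated over
ℝ.

Invariance of the Cauchy–Riemann equations forces each symmetry to be a holomorphic vector field on
Ω ⊆ ℂ² (`IsSymmetry.contDiffOn_complex`); what remains is the complex determining equation
(`IsSymmetry.isHolSymmetry`). For s = ±1 the relations between the fields give Y₁ + siX₁ = (ρ₁ −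
siρ₂)(Y₂ + siX₂). If neither Y₂ + iX₂ nor Y₂ − iX₂ vanished identically, both quotients ρ₁ ∓ iρ₂
would be holomorphic, hence so would the real function ρ₁, which would then be constant. So Y₂ =
−siX₂ for one sign s (`exists_smul_I`), whence Y₁ = −siX₁ and X₁ = σX₂ with σ = ρ₁ + siρ₂
holomorphic. By the identity theorem X₁ and dσ are nonzero on a dense set. The first bracket
relation becomes 2[X₁, X₂] = 0, that is, X₂σ = 0 wherever X₂ ≠ 0.

Near a regular point take Z = 1/σ as new independent variable and straighten X₁ to ∂_U, so that X₂ =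
Z∂_U (`exists_straightening`). These fields change U by an affine function of Z, so they leave U_ZZ
invariant (`fderiv_newSecond_holProlong`). The new right-hand side is therefore annihilated by the
prolongations of X₁, X₂ and of their multiples by −si, hence by whole complex lines; these span the
directions of U and U_Z, and only the dependence on Z survives (`exists_linearizing_coordinates`).

Equivalence of the two systems is checked one jet at a time: a holomorphic change of coordinates
carries complex-linear 2-jets to complex-linear 2-jets, even of maps that are not holomorphic nearby
(`Transforms.equation_iff`). For s = 1 the real form of these coordinates is canonical; for s = −1
complex conjugation of both variables makes it so. -/

noncomputable section

namespace ComplexLinearization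

open Set Filter Topology MeasureTheory

/-! ### Holomorphic maps of several variables: smoothness, identity theorem, parametric integrals.
-/

section ComplexAnalysis

variable {E F : Type*} [NormedAddCommGroup E] [NormedSpace ℂ E]
  [NormedAddCommGroup F] [NormedSpace ℂ F]

theorem complex_smul_eq [NormedSpace ℝ E] [IsScalarTower ℝ ℂ E] (c : ℂ) (x : E) :
    c • x = c.re • x + c.im • (Complex.I • x) := by
  rw [← smul_assoc, ← smul_one_smul ℂ c.re x, ← add_smul]
  congr 1
  apply Complex.ext <;> simp

/-- A real linear map commuting with multiplication by `I` is complex linear. -/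
def complexify [NormedSpace ℝ E] [IsScalarTower ℝ ℂ E] [NormedSpace ℝ F] [IsScalarTower ℝ ℂ F]
    (L : E →L[ℝ] F) (hL : ∀ v, L (Complex.I • v) = Complex.I • L v) : E →L[ℂ] F where
  toFun := L
  map_add' := L.map_add
  map_smul' c v := by
    simp only [RingHom.id_apply]
    rw [complex_smul_eq c v, complex_smul_eq c (L v)]
    simp [hL]
  cont := L.continuous

theorem differentiableAt_complex_of_real [NormedSpace ℝ E] [IsScalarTower ℝ ℂ E]
    [NormedSpace ℝ F] [IsScalarTower ℝ ℂ F] {f : E → F} {q : E} (hf : DifferentiableAt ℝ f q)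
    (hI : ∀ v, fderiv ℝ f q (Complex.I • v) = Complex.I • fderiv ℝ f q v) :
    DifferentiableAt ℂ f q :=
  (hasFDerivAt_of_restrictScalars (f' := complexify _ hI) ℝ hf.hasFDerivAt
    (by ext; rfl)).differentiableAt

theorem fderiv_real_eq [NormedSpace ℝ E] [IsScalarTower ℝ ℂ E]
    [NormedSpace ℝ F] [IsScalarTower ℝ ℂ F] {f : E → F} {q : E} (hf : DifferentiableAt ℂ f q)
    (v : E) : fderiv ℝ f q v = fderiv ℂ f q v := by
  rw [hf.fderiv_restrictScalars ℝ]; rfl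

/-- A real-smooth map with complex linear differentials is complex-smooth. -/
theorem contDiffOn_complex_of_real [NormedSpace ℝ E] [IsScalarTower ℝ ℂ E]
    [NormedSpace ℝ F] [IsScalarTower ℝ ℂ F] [FiniteDimensional ℂ E]
    {S : Set E} (hS : IsOpen S) {f : E → F} (hf : ContDiffOn ℝ ∞ f S)
    (hI : ∀ q ∈ S, ∀ v, fderiv ℝ f q (Complex.I • v) = Complex.I • fderiv ℝ f q v) :
    ContDiffOn ℂ ∞ f S := by
  rw [contDiffOn_infty]
  intro n
  induction n generalizing f with
  | zero => simpa using hf.continuousOn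
  | succ n ih =>
    have hd : ∀ q ∈ S, DifferentiableAt ℝ f q := fun q hq =>
      (hf.contDiffAt (hS.mem_nhds hq)).differentiableAt (by simp)
    have hdC : ∀ q ∈ S, DifferentiableAt ℂ f q := fun q hq =>
      differentiableAt_complex_of_real (hd q hq) (hI q hq)
    rw [show ((n + 1 : ℕ) : WithTop ℕ∞) = (n : WithTop ℕ∞) + 1 by simp,
      contDiffOn_succ_iff_fderiv_of_isOpen hS]
    refine ⟨fun q hq => (hdC q hq).differentiableWithinAt, by simp, ?_⟩
    rw [contDiffOn_clm_apply]
    intro v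
    have hf' : ContDiffOn ℝ ∞ (fderiv ℝ f) S :=
      (contDiffOn_infty_iff_fderiv_of_isOpen hS |>.1 hf).2
    have hv : ContDiffOn ℝ ∞ (fun q => fderiv ℝ f q v) S := hf'.clm_apply contDiffOn_const
    refine (ih (f := fun q => fderiv ℝ f q v) hv ?_).congr fun q hq =>
      (fderiv_real_eq (hdC q hq) v).symm
    intro q hq w
    have hd' : DifferentiableAt ℝ (fderiv ℝ f) q :=
      (hf'.contDiffAt (hS.mem_nhds hq)).differentiableAt (by simp)
    have key : ∀ v w, fderiv ℝ (fun q => fderiv ℝ f q v) q w = fderiv ℝ (fderiv ℝ f) q w v := by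
      intro v w
      rw [fderiv_clm_apply hd' (by fun_prop)]
      simp
    -- The map Df(·)v inherits complex-linear differentials, which drives the induction: D²f(Iw, v)
    -- = D²f(v, Iw) is the derivative along v of Df(Iw) = I • Df(w).
    have sym : IsSymmSndFDerivAt ℝ f q :=
      (hf.contDiffAt (hS.mem_nhds hq)).isSymmSndFDerivAt (by simpa using ENat.LEInfty.out)
    rw [key, key, sym.eq, sym.eq w v, ← key, ← key]
    have : (fun q => fderiv ℝ f q (Complex.I • w)) =ᶠ[𝓝 q]
        fun q => Complex.I • fderiv ℝ f q w := by
      filter_upwards [hS.mem_nhds hq] with q' hq' using hI q' hq' w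
    rw [this.fderiv_eq, fderiv_fun_const_smul (hd'.clm_apply (by fun_prop))]
    rfl

/-- Identity theorem. -/
theorem eqOn_zero_of_eventuallyEq_zero [CompleteSpace F] {S : Set E} (hS : IsOpen S)
    (hSc : IsPreconnected S) {f : E → F} (hf : DifferentiableOn ℂ f S) {c : E} (hc : c ∈ S)
    (h0 : f =ᶠ[𝓝 c] 0) : ∀ q ∈ S, f q = 0 := by
  -- Inside a ball, a and b lie on a complex line that meets the ball in a convex set; the
  -- one-variable identity theorem applies there.
  have key : ∀ q r, Metric.ball q r ⊆ S → ∀ a ∈ Metric.ball q r, f =ᶠ[𝓝 a] 0 →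
      ∀ b ∈ Metric.ball q r, f b = 0 := by
    intro q r hB a ha ha0 b hb
    set γ : ℂ → E := fun t => a + t • (b - a) with hγ
    have hγd : Differentiable ℂ γ := by fun_prop
    have hγc : Continuous γ := hγd.continuous
    set T : Set ℂ := γ ⁻¹' Metric.ball q r
    have hTo : IsOpen T := Metric.isOpen_ball.preimage hγc
    have hTc : Convex ℝ T := by
      let _ : NormedSpace ℝ E := NormedSpace.restrictScalars ℝ ℂ E
      intro s hs t ht α β hα hβ hαβ
      have : γ (α • s + β • t) = α • γ s + β • γ t := by
        have hβ' : (β : ℂ) = 1 - α := by rw [eq_sub_iff_add_eq']; exact_mod_cast hαβ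
        change _ = (α : ℂ) • γ s + (β : ℂ) • γ t
        simp only [hγ, Complex.real_smul, hβ']
        module
      rw [mem_preimage, this]
      exact convex_ball q r hs ht hα hβ hαβ
    have hd : DifferentiableOn ℂ (f ∘ γ) T :=
      (hf.mono hB).comp hγd.differentiableOn (mapsTo_preimage _ _)
    have h0T : (0 : ℂ) ∈ T := by simpa [T, hγ] using ha
    have h1T : (1 : ℂ) ∈ T := by simpa [T, hγ] using hb
    have hev : (f ∘ γ) =ᶠ[𝓝 0] 0 := by
      have : Tendsto γ (𝓝 0) (𝓝 a) := by simpa [hγ] using hγc.tendsto 0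
      exact this.eventually ha0
    have := (hd.analyticOnNhd hTo).eqOn_zero_of_preconnected_of_eventuallyEq_zero
      hTc.isPreconnected h0T hev h1T
    simpa [hγ] using this
  -- The set of points near which f vanishes is open and, by `key`, contains its limit points in S.
  have hsub : S ⊆ {q | f =ᶠ[𝓝 q] 0} := by
    refine hSc.subset_of_closure_inter_subset (isOpen_setOfPred_eventually_nhds) ⟨c, hc, h0⟩ ?_
    rintro q ⟨hq, hqS⟩
    obtain ⟨r, hr, hB⟩ := Metric.isOpen_iff.1 hS q hqS
    obtain ⟨a, ha, hd⟩ := Metric.mem_closure_iff.1 hq r hr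
    have := key q r hB a (by simpa [dist_comm] using hd) ha
    filter_upwards [Metric.ball_mem_nhds q hr] with b hb using this b hb
  exact fun q hq => (hsub hq).self_of_nhds

/-- The zeros of a holomorphic map that is not identically zero have dense complement. -/
theorem dense_ne_zero [CompleteSpace F] {S : Set E} (hS : IsOpen S)
    (hSc : IsPreconnected S) {f : E → F} (hf : DifferentiableOn ℂ f S)
    (hne : ∃ q ∈ S, f q ≠ 0) : ∀ q ∈ S, ∃ᶠ q' in 𝓝 q, f q' ≠ 0 := by
  intro q hq h
  obtain ⟨c, hc, hne⟩ := hne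
  exact hne (eqOn_zero_of_eventuallyEq_zero hS hSc hf hq
    (by filter_upwards [h] with x hx using not_not.1 hx) c hc)

/-- Differentiation under the integral sign; the dominating constant bounds the derivative on the
compact product of [0, 1] with a closed ball around q. -/
theorem hasFDerivAt_parametric_integral [FiniteDimensional ℂ E] [CompleteSpace F]
    {g : ℂ × E → F} {T : Set (ℂ × E)} (hT : IsOpen T) (hg : ContDiffOn ℂ 1 g T) {B : Set E}
    (hB : IsOpen B) (hBT : ∀ s ∈ Icc (0 : ℝ) 1, ∀ q ∈ B, ((s : ℂ), q) ∈ T) {q : E} (hq : q ∈ B) :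
    HasFDerivAt (fun q => ∫ s in (0 : ℝ)..1, g (s, q))
      (∫ s in (0 : ℝ)..1, (fderiv ℂ g (s, q)).comp (ContinuousLinearMap.inr ℂ ℂ E)) q := by
  have : ProperSpace E := FiniteDimensional.proper ℂ E
  obtain ⟨ε, hε, hεB⟩ := Metric.nhds_basis_closedBall.mem_iff.1 (hB.mem_nhds hq)
  have hg' : ContinuousOn (fderiv ℂ g) T := hg.continuousOn_fderiv_of_isOpen hT le_rfl
  have hpath : ∀ q : E, Continuous fun s : ℝ => ((s : ℂ), q) := fun q => by fun_prop
  have hcont : ∀ q' ∈ B, ContinuousOn (fun s : ℝ => g ((s : ℂ), q')) (uIcc 0 1) := by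
    intro q' hq'
    refine hg.continuousOn.comp (hpath q').continuousOn fun s hs => hBT s ?_ q' hq'
    simpa using hs
  have hcont' : ∀ q' ∈ B, ContinuousOn
      (fun s : ℝ => (fderiv ℂ g ((s : ℂ), q')).comp (ContinuousLinearMap.inr ℂ ℂ E))
      (uIcc 0 1) := by
    intro q' hq'
    refine ContinuousOn.clm_comp ?_ continuousOn_const
    refine hg'.comp (hpath q').continuousOn fun s hs => hBT s ?_ q' hq'
    simpa using hs
  have hK : IsCompact (((fun s : ℝ => (s : ℂ)) '' Icc 0 1) ×ˢ Metric.closedBall q ε) :=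
    (isCompact_Icc.image Complex.continuous_ofReal).prod (isCompact_closedBall q ε)
  obtain ⟨C, hC⟩ := hK.exists_bound_of_continuousOn
    (f := fun x => (fderiv ℂ g x).comp (ContinuousLinearMap.inr ℂ ℂ E))
    (ContinuousOn.clm_comp (hg'.mono (by
      rintro ⟨_, q'⟩ ⟨⟨s, hs, rfl⟩, hq'⟩
      exact hBT s hs q' (hεB hq'))) continuousOn_const)
  refine intervalIntegral.hasFDerivAt_integral_of_dominated_of_fderiv_le
    (F := fun q' s => g ((s : ℂ), q'))
    (F' := fun q' s => (fderiv ℂ g ((s : ℂ), q')).comp (ContinuousLinearMap.inr ℂ ℂ E))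
    (bound := fun _ => C) (s := Metric.ball q ε) (Metric.ball_mem_nhds q hε) ?_ ?_ ?_ ?_ ?_ ?_
  · filter_upwards [hB.mem_nhds hq] with q' hq'
    exact ((hcont q' hq').mono uIoc_subset_uIcc).aestronglyMeasurable measurableSet_uIoc
  · exact (hcont q hq).intervalIntegrable
  · exact ((hcont' q hq).mono uIoc_subset_uIcc).aestronglyMeasurable measurableSet_uIoc
  · refine Eventually.of_forall fun s hs q' hq' => hC (s, q') ⟨⟨s, ?_, rfl⟩, ?_⟩
    · have := uIoc_subset_uIcc hs
      simpa using this
    · exact Metric.ball_subset_closedBall hq'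
  · exact intervalIntegrable_const
  · refine Eventually.of_forall fun s hs q' hq' => ?_
    have hs' : s ∈ Icc (0 : ℝ) 1 := by
      have := uIoc_subset_uIcc hs
      simpa using this
    have hm := hBT s hs' q' (hεB (Metric.ball_subset_closedBall hq'))
    have hd := ((hg.contDiffAt (hT.mem_nhds hm)).differentiableAt (by simp)).hasFDerivAt
    exact hd.comp q' (hasFDerivAt_prodMk_right _ _)

/-- The derivative of the integral in a fixed direction is an integral of the same kind, so the
order of smoothness can be raised by induction over all integrands g. -/
theorem contDiffOn_parametric_integral [FiniteDimensional ℂ E] [CompleteSpace F]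
    {g : ℂ × E → F} {T : Set (ℂ × E)} (hT : IsOpen T) (hg : ContDiffOn ℂ ∞ g T) {B : Set E}
    (hB : IsOpen B) (hBT : ∀ s ∈ Icc (0 : ℝ) 1, ∀ q ∈ B, ((s : ℂ), q) ∈ T) :
    ContDiffOn ℂ ∞ (fun q => ∫ s in (0 : ℝ)..1, g (s, q)) B := by
  have hder : ∀ {g : ℂ × E → F}, ContDiffOn ℂ ∞ g T → ∀ q ∈ B, HasFDerivAt
      (fun q => ∫ s in (0 : ℝ)..1, g (s, q))
      (∫ s in (0 : ℝ)..1, (fderiv ℂ g (s, q)).comp (ContinuousLinearMap.inr ℂ ℂ E)) q :=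
    fun hg q hq => hasFDerivAt_parametric_integral hT (hg.of_le (by simp)) hB hBT hq
  rw [contDiffOn_infty]
  intro n
  induction n generalizing g with
  | zero =>
    have : ContinuousOn (fun q => ∫ s in (0 : ℝ)..1, g (s, q)) B :=
      fun q hq => (hder hg q hq).continuousAt.continuousWithinAt
    simpa using this
  | succ n ih =>
    rw [show ((n + 1 : ℕ) : WithTop ℕ∞) = (n : WithTop ℕ∞) + 1 by simp,
      contDiffOn_succ_iff_fderiv_of_isOpen hB]
    refine ⟨fun q hq => (hder hg q hq).differentiableAt.differentiableWithinAt, by simp, ?_⟩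
    rw [contDiffOn_clm_apply]
    intro v
    have hg' : ContDiffOn ℂ ∞ (fderiv ℂ g) T :=
      (contDiffOn_infty_iff_fderiv_of_isOpen hT |>.1 hg).2
    refine (ih (g := fun x => fderiv ℂ g x (0, v)) (hg'.clm_apply contDiffOn_const)).congr ?_
    intro q hq
    rw [(hder hg q hq).fderiv, ContinuousLinearMap.intervalIntegral_apply]
    · simp
    · refine ContinuousOn.intervalIntegrable ?_
      refine ContinuousOn.clm_comp ?_ continuousOn_const
      refine hg'.continuousOn.comp (f := fun s : ℝ => ((s : ℂ), q))
        (by fun_prop) fun s hs => hBT s ?_ q hq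
      simpa using hs

end ComplexAnalysis

/-! ### Primitives, the inverse function theorem and straightening of a vector field. -/

/-- A holomorphic function on a bidisc has a holomorphic primitive in the second variable. -/
theorem exists_primitive_snd {G : ℂ × ℂ → ℂ} {c : ℂ × ℂ} {r : ℝ}
    (hG : ContDiffOn ℂ ∞ G (Metric.ball c r)) :
    ∃ H : ℂ × ℂ → ℂ, ContDiffOn ℂ ∞ H (Metric.ball c r) ∧
      ∀ q ∈ Metric.ball c r, fderiv ℂ H q (0, 1) = G q := by
  -- The primitive integrates G(z, ·) over the segment from c.2 to u, reparametrised by [0, 1]: (u −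
  -- c.2) ∫₀¹ G(z, c.2 + s(u − c.2)) ds. Balls of the product norm are bidiscs, so the segment stays
  -- inside.
  set γ : ℂ × (ℂ × ℂ) → ℂ × ℂ := fun x => (x.2.1, c.2 + x.1 * (x.2.2 - c.2)) with hγ
  have hγs : ContDiff ℂ ∞ γ := by fun_prop
  set T : Set (ℂ × (ℂ × ℂ)) := γ ⁻¹' Metric.ball c r
  have hT : IsOpen T := Metric.isOpen_ball.preimage hγs.continuous
  have hBT : ∀ s ∈ Icc (0 : ℝ) 1, ∀ q ∈ Metric.ball c r, ((s : ℂ), q) ∈ T := by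
    intro s hs q hq
    simp only [T, mem_preimage, hγ, Metric.mem_ball, Prod.dist_eq, max_lt_iff] at hq ⊢
    refine ⟨hq.1, lt_of_le_of_lt ?_ hq.2⟩
    simp only [dist_eq_norm, add_sub_cancel_left, norm_mul, Complex.norm_real, Real.norm_eq_abs,
      abs_of_nonneg hs.1]
    exact mul_le_of_le_one_left (norm_nonneg _) hs.2
  have hg : ContDiffOn ℂ ∞ (G ∘ γ) T := hG.comp hγs.contDiffOn (mapsTo_preimage _ _)
  set K : ℂ × ℂ → ℂ := fun q => ∫ s in (0 : ℝ)..1, (G ∘ γ) (s, q) with hK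
  have hKs : ContDiffOn ℂ ∞ K (Metric.ball c r) :=
    contDiffOn_parametric_integral hT hg Metric.isOpen_ball hBT
  refine ⟨fun q => (q.2 - c.2) * K q, ContDiffOn.mul (by fun_prop) hKs, ?_⟩
  intro q hq
  have hGd : ∀ q' ∈ Metric.ball c r, DifferentiableAt ℂ G q' := fun q' hq' =>
    (hG.contDiffAt (Metric.isOpen_ball.mem_nhds hq')).differentiableAt (by simp)
  have hG' : ContinuousOn (fderiv ℂ G) (Metric.ball c r) :=
    hG.continuousOn_fderiv_of_isOpen Metric.isOpen_ball (by simp)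
  have hpath : Continuous fun s : ℝ => γ ((s : ℂ), q) := by
    exact hγs.continuous.comp (by fun_prop)
  have hmaps : MapsTo (fun s : ℝ => γ ((s : ℂ), q)) (uIcc 0 1) (Metric.ball c r) := by
    intro s hs
    exact hBT s (by simpa using hs) q hq
  have hcG : ContinuousOn (fun s : ℝ => G (γ (s, q))) (uIcc 0 1) :=
    hG.continuousOn.comp hpath.continuousOn hmaps
  have hcG' : ContinuousOn (fun s : ℝ => (s : ℂ) * fderiv ℂ G (γ (s, q)) (0, 1)) (uIcc 0 1) :=
    (Complex.continuous_ofReal.continuousOn).mul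
      ((hG'.comp hpath.continuousOn hmaps).clm_apply continuousOn_const)
  have hKder := hasFDerivAt_parametric_integral hT (hg.of_le (by simp)) Metric.isOpen_ball hBT hq
  have hγd : ∀ s : ℂ, HasFDerivAt γ (fderiv ℂ γ (s, q)) (s, q) := fun s =>
    (hγs.differentiable (by simp) _).hasFDerivAt
  have hγv : ∀ s : ℂ, fderiv ℂ γ (s, q) (0, (0, 1)) = s • ((0, 1) : ℂ × ℂ) := by
    intro s
    have h1 : HasDerivAt (fun t : ℂ => γ (s, (q.1, q.2 + t))) ((0 : ℂ), s) 0 := by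
      apply HasDerivAt.prodMk (hasDerivAt_const _ _)
      have := ((((hasDerivAt_id (0 : ℂ)).const_add q.2).sub_const c.2).const_mul s).const_add c.2
      simpa using this
    have h2 : HasDerivAt (fun t : ℂ => ((s, (q.1, q.2 + t)) : ℂ × (ℂ × ℂ))) (0, (0, 1)) 0 :=
      (hasDerivAt_const _ _).prodMk ((hasDerivAt_const _ _).prodMk
        ((hasDerivAt_id (0 : ℂ)).const_add q.2))
    have h3 := HasFDerivAt.comp_hasDerivAt (x := (0 : ℂ)) (l := γ) (l' := fderiv ℂ γ (s, q))
      (f := fun t : ℂ => ((s, (q.1, q.2 + t)) : ℂ × (ℂ × ℂ))) (by simpa using hγd s) h2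
    rw [h3.unique h1]; simp
  have hKv : fderiv ℂ K q (0, 1) = ∫ s in (0 : ℝ)..1, (s : ℂ) * fderiv ℂ G (γ (s, q)) (0, 1) := by
    rw [hKder.fderiv, ContinuousLinearMap.intervalIntegral_apply]
    · refine intervalIntegral.integral_congr fun s hs => ?_
      simp only [ContinuousLinearMap.comp_apply, ContinuousLinearMap.inr_apply]
      rw [((hGd _ (hmaps hs)).hasFDerivAt.comp _ (hγd s)).fderiv]
      simp only [ContinuousLinearMap.comp_apply]
      rw [hγv, map_smul, smul_eq_mul]
    · refine ContinuousOn.intervalIntegrable (ContinuousOn.clm_comp ?_ continuousOn_const)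
      refine ContinuousOn.comp (t := T) (hg.continuousOn_fderiv_of_isOpen hT (by simp))
        (f := fun s : ℝ => ((s : ℂ), q)) (by fun_prop) hmaps
  -- The integrand is the s-derivative of s · G(γ(s, q)); it is also what the product rule yields
  -- for the derivative of (u − c.2) K.
  have hftc : ∫ s in (0 : ℝ)..1, (G (γ (s, q)) +
      (q.2 - c.2) * ((s : ℂ) * fderiv ℂ G (γ (s, q)) (0, 1))) = G q := by
    have := intervalIntegral.integral_eq_sub_of_hasDerivAt (a := 0) (b := 1)
      (f := fun s : ℝ => (s : ℂ) * G (γ (s, q)))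
      (f' := fun s : ℝ => G (γ (s, q)) +
        (q.2 - c.2) * ((s : ℂ) * fderiv ℂ G (γ (s, q)) (0, 1))) ?_ ?_
    · rw [this]
      simp [hγ]
    · intro s hs
      have h1 : HasDerivAt (fun s : ℝ => γ ((s : ℂ), q)) ((q.2 - c.2) • ((0, 1) : ℂ × ℂ)) s := by
        have h0 : HasDerivAt (fun s : ℝ => (s : ℂ)) 1 s := (hasDerivAt_id s).ofReal_comp
        have := (hasDerivAt_const s q.1).prodMk ((h0.mul_const (q.2 - c.2)).const_add c.2)
        simpa [hγ] using this
      have h2 := ((hGd _ (hmaps hs)).hasFDerivAt.restrictScalars ℝ).comp_hasDerivAt s h1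
      have h3 := ((hasDerivAt_id s).ofReal_comp).mul h2
      refine h3.congr_deriv ?_
      rw [ContinuousLinearMap.coe_restrictScalars', map_smul]
      simp only [Function.comp_apply, Complex.ofReal_one, id_eq, smul_eq_mul]
      ring
    · exact (hcG.add (continuousOn_const.mul hcG')).intervalIntegrable
  have hKd : DifferentiableAt ℂ K q := hKder.differentiableAt
  rw [fderiv_fun_mul (by fun_prop) hKd]
  have hlin : fderiv ℂ (fun q : ℂ × ℂ => q.2 - c.2) q (0, 1) = 1 := by
    rw [fderiv_sub_const, fderiv_snd]; simp
  simp only [add_apply, smul_apply, smul_eq_mul, hlin]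
  rw [hKv, ← hftc, intervalIntegral.integral_add (hcG.intervalIntegrable)
    (f := fun s : ℝ => G (γ (s, q)))
    (g := fun s : ℝ => (q.2 - c.2) * ((s : ℂ) * fderiv ℂ G (γ (s, q)) (0, 1)))
    (continuousOn_const.mul hcG').intervalIntegrable, intervalIntegral.integral_const_mul]
  simp [hK, add_comm]

/-- Holomorphic inverse function theorem, with a ball as target. -/
theorem exists_openPartialHomeomorph {f : ℂ × ℂ → ℂ × ℂ} {S : Set (ℂ × ℂ)} (hS : IsOpen S)
    (hf : ContDiffOn ℂ ∞ f S) {q : ℂ × ℂ} (hq : q ∈ S)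
    (hinj : ∀ v, fderiv ℂ f q v = 0 → v = 0) :
    ∃ (Φ : OpenPartialHomeomorph (ℂ × ℂ) (ℂ × ℂ)) (r : ℝ), 0 < r ∧ q ∈ Φ.source ∧
      Φ.source ⊆ S ∧ Φ.target = Metric.ball (f q) r ∧ (∀ x, Φ x = f x) ∧
      ContDiffOn ℂ ∞ Φ Φ.source ∧ ContDiffOn ℂ ∞ Φ.symm Φ.target := by
  have hfa : ∀ x ∈ S, ContDiffAt ℂ ∞ f x := fun x hx => hf.contDiffAt (hS.mem_nhds hx)
  have hcont : ContinuousOn (fderiv ℂ f) S := hf.continuousOn_fderiv_of_isOpen hS (by simp)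
  let A : (ℂ × ℂ) ≃L[ℂ] (ℂ × ℂ) := (LinearEquiv.ofInjectiveEndo (fderiv ℂ f q : ℂ × ℂ →ₗ[ℂ] ℂ × ℂ)
    (by rw [← LinearMap.ker_eq_bot, LinearMap.ker_eq_bot']; exact hinj)).toContinuousLinearEquiv
  have hA : (A : ℂ × ℂ →L[ℂ] ℂ × ℂ) = fderiv ℂ f q := by ext <;> rfl
  have hA' : HasFDerivAt f (A : ℂ × ℂ →L[ℂ] ℂ × ℂ) q := by
    rw [hA]; exact ((hfa q hq).differentiableAt (by simp)).hasFDerivAt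
  set Φ₀ := (hfa q hq).toOpenPartialHomeomorph f hA' (by simp)
  have hΦ₀ : ∀ x, Φ₀ x = f x := fun x => rfl
  have hq₀ : q ∈ Φ₀.source := (hfa q hq).mem_toOpenPartialHomeomorph_source hA' (by simp)
  -- The points where the derivative is still invertible: smoothness of the inverse is needed at
  -- every point of the target, not just at the image of q.
  set S' : Set (ℂ × ℂ) := S ∩ fderiv ℂ f ⁻¹'
    range ((↑) : ((ℂ × ℂ) ≃L[ℂ] (ℂ × ℂ)) → (ℂ × ℂ →L[ℂ] ℂ × ℂ))
  have hS' : IsOpen S' := hcont.isOpen_inter_preimage hS ContinuousLinearEquiv.isOpen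
  have hqS' : q ∈ S' := ⟨hq, A, hA⟩
  have hO : IsOpen (Φ₀.target ∩ Φ₀.symm ⁻¹' S') := Φ₀.symm.isOpen_inter_preimage hS'
  have hqO : f q ∈ Φ₀.target ∩ Φ₀.symm ⁻¹' S' :=
    ⟨Φ₀.map_source hq₀, by
      rw [mem_preimage, ← hΦ₀, Φ₀.left_inv hq₀]; exact hqS'⟩
  obtain ⟨r, hr, hball⟩ := Metric.isOpen_iff.1 hO _ hqO
  -- Restricting the inverse, rather than the map, makes the target exactly a ball.
  set Φ := (Φ₀.symm.restrOpen (Metric.ball (f q) r) Metric.isOpen_ball).symm with hΦ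
  have hsrc : ∀ x, x ∈ Φ.source ↔ x ∈ Φ₀.source ∧ f x ∈ Metric.ball (f q) r := by
    intro x
    simp [hΦ, OpenPartialHomeomorph.restrOpen, hΦ₀]
  have htgt : Φ.target = Metric.ball (f q) r := by
    have : Φ.target = Φ₀.target ∩ Metric.ball (f q) r := rfl
    rw [this]; exact inter_eq_right.2 fun x hx => (hball hx).1
  have hsub : Φ.source ⊆ S' := by
    intro x hx
    obtain ⟨h1, h2⟩ := (hsrc x).1 hx
    have := (hball h2).2
    rwa [mem_preimage, ← hΦ₀, Φ₀.left_inv h1] at this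
  have hΦf : ∀ x, Φ x = f x := fun x => rfl
  refine ⟨Φ, r, hr, (hsrc q).2 ⟨hq₀, Metric.mem_ball_self hr⟩, fun x hx => (hsub hx).1, htgt,
    hΦf, hf.mono fun x hx => (hsub hx).1, ?_⟩
  intro y hy
  have hx := hsub (Φ.map_target hy)
  obtain ⟨B, hB⟩ := hx.2
  refine (Φ.contDiffAt_symm hy (f₀' := B) ?_ (hfa _ hx.1)).contDiffWithinAt
  rw [hB]
  exact ((hfa _ hx.1).differentiableAt (by simp)).hasFDerivAt

/-- The kernel of a nonzero functional on ℂ² is a line, because the determinant of two kernel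
vectors vanishes. -/
theorem exists_smul_of_clm_apply_eq_zero {L : ℂ × ℂ →L[ℂ] ℂ} (hL : L ≠ 0) {v w : ℂ × ℂ}
    (hv : v ≠ 0) (hLv : L v = 0) (hLw : L w = 0) : ∃ c : ℂ, w = c • v := by
  have hLe : ∀ x : ℂ × ℂ, L x = x.1 * L (1, 0) + x.2 * L (0, 1) := by
    intro x
    have : x = x.1 • ((1, 0) : ℂ × ℂ) + x.2 • ((0, 1) : ℂ × ℂ) := by ext <;> simp
    conv_lhs => rw [this, map_add, map_smul, map_smul]
    rfl
  rw [hLe] at hLv hLw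
  set a := L (1, 0)
  set b := L (0, 1)
  have hab : a ≠ 0 ∨ b ≠ 0 := by
    by_contra! h
    exact hL (ContinuousLinearMap.ext fun x => by simp [hLe, h])
  have hdet : v.1 * w.2 = v.2 * w.1 := by
    rcases hab with h | h
    · apply mul_left_cancel₀ h; linear_combination w.2 * hLv - v.2 * hLw
    · apply mul_left_cancel₀ h; linear_combination v.1 * hLw - w.1 * hLv
  by_cases h1 : v.1 = 0
  · have h2 : v.2 ≠ 0 := fun h2 => hv (Prod.ext h1 h2)
    refine ⟨w.2 / v.2, Prod.ext ?_ ?_⟩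
    · simp only [Prod.smul_fst, smul_eq_mul]; field_simp; linear_combination -hdet
    · simp only [Prod.smul_snd, smul_eq_mul]; field_simp
  · refine ⟨w.1 / v.1, Prod.ext ?_ ?_⟩
    · simp only [Prod.smul_fst, smul_eq_mul]; field_simp
    · simp only [Prod.smul_snd, smul_eq_mul]; field_simp; linear_combination hdet

/-- Holomorphic straightening of a vector field with a known first integral `Z`. -/
theorem exists_straightening {S : Set (ℂ × ℂ)} (hS : IsOpen S) {X : ℂ × ℂ → ℂ × ℂ}
    {Z : ℂ × ℂ → ℂ} (hX : ContDiffOn ℂ ∞ X S) (hZ : ContDiffOn ℂ ∞ Z S) {q : ℂ × ℂ} (hq : q ∈ S)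
    (hXq : X q ≠ 0) (hZq : fderiv ℂ Z q ≠ 0) (hXZ : ∀ x ∈ S, fderiv ℂ Z x (X x) = 0) :
    ∃ (Φ : OpenPartialHomeomorph (ℂ × ℂ) (ℂ × ℂ)) (r : ℝ), 0 < r ∧ q ∈ Φ.source ∧
      Φ.source ⊆ S ∧ Φ.target = Metric.ball (Φ q) r ∧
      ContDiffOn ℂ ∞ Φ Φ.source ∧ ContDiffOn ℂ ∞ Φ.symm Φ.target ∧
      (∀ x, (Φ x).1 = Z x) ∧ ∀ x ∈ Φ.source, fderiv ℂ Φ x (X x) = (0, 1) := by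
  have hXa : ∀ x ∈ S, ContDiffAt ℂ ∞ X x := fun x hx => hX.contDiffAt (hS.mem_nhds hx)
  have hZa : ∀ x ∈ S, ContDiffAt ℂ ∞ Z x := fun x hx => hZ.contDiffAt (hS.mem_nhds hx)
  have hZd : ∀ x ∈ S, DifferentiableAt ℂ Z x := fun x hx => (hZa x hx).differentiableAt (by simp)
  -- A linear function transversal to X. In the local coordinates (Z, ℓ) the field is ℓ(X) ∂_ℓ, so a
  -- primitive H of 1/ℓ(X) in the second coordinate is increased by X at unit rate.
  obtain ⟨ℓ, hℓ⟩ : ∃ ℓ : ℂ × ℂ →L[ℂ] ℂ, ℓ (X q) ≠ 0 := by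
    by_cases h1 : (X q).1 = 0
    · exact ⟨ContinuousLinearMap.snd ℂ ℂ ℂ, fun h2 => hXq (Prod.ext h1 h2)⟩
    · exact ⟨ContinuousLinearMap.fst ℂ ℂ ℂ, h1⟩
  set S₁ : Set (ℂ × ℂ) := S ∩ (fun x => ℓ (X x)) ⁻¹' {0}ᶜ
  have hS₁ : IsOpen S₁ :=
    (ℓ.continuous.comp_continuousOn hX.continuousOn).isOpen_inter_preimage hS isOpen_compl_singleton
  have hqS₁ : q ∈ S₁ := ⟨hq, hℓ⟩
  have hfd : ∀ x ∈ S, HasFDerivAt (fun x => (Z x, ℓ x)) ((fderiv ℂ Z x).prod ℓ) x := fun x hx =>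
    (hZd x hx).hasFDerivAt.prodMk ℓ.hasFDerivAt
  obtain ⟨Ψ, r₁, hr₁, hqΨ, hΨS, hΨt, hΨf, hΨs, hΨs'⟩ :=
    exists_openPartialHomeomorph (f := fun x => (Z x, ℓ x)) hS₁
      ((hZ.mono inter_subset_left).prodMk ℓ.contDiff.contDiffOn) hqS₁ (by
        intro v hv
        rw [(hfd q hq).fderiv] at hv
        have h1 : fderiv ℂ Z q v = 0 := congrArg Prod.fst hv
        have h2 : ℓ v = 0 := congrArg Prod.snd hv
        obtain ⟨c, rfl⟩ := exists_smul_of_clm_apply_eq_zero hZq hXq (hXZ q hq) h1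
        rw [map_smul, smul_eq_mul] at h2
        rcases mul_eq_zero.1 h2 with h | h
        · simp [h]
        · exact absurd h hℓ)
  have hΨe : (Ψ : ℂ × ℂ → ℂ × ℂ) = fun x => (Z x, ℓ x) := funext hΨf
  obtain ⟨H, hH, hH'⟩ := exists_primitive_snd (G := fun y => (ℓ (X (Ψ.symm y)))⁻¹)
    (c := (Z q, ℓ q)) (r := r₁) (by
      rw [← hΨt]
      refine ContDiffOn.inv ?_ fun y hy => (hΨS (Ψ.map_target hy)).2
      exact ℓ.contDiff.comp_contDiffOn
        (hX.comp hΨs' fun y hy => (hΨS (Ψ.map_target hy)).1))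
  have hHd : ∀ y ∈ Metric.ball (Z q, ℓ q) r₁, DifferentiableAt ℂ H y := fun y hy =>
    (hH.contDiffAt (Metric.isOpen_ball.mem_nhds hy)).differentiableAt (by simp)
  have hmaps : MapsTo Ψ Ψ.source (Metric.ball (Z q, ℓ q) r₁) := fun x hx => by
    rw [← hΨt]; exact Ψ.map_source hx
  have hU : ContDiffOn ℂ ∞ (H ∘ Ψ) Ψ.source := hH.comp hΨs hmaps
  have hUd : ∀ x ∈ Ψ.source, DifferentiableAt ℂ (H ∘ Ψ) x := fun x hx =>
    (hU.contDiffAt (Ψ.open_source.mem_nhds hx)).differentiableAt (by simp)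
  have hUX : ∀ x ∈ Ψ.source, fderiv ℂ (H ∘ Ψ) x (X x) = 1 := by
    intro x hx
    have hxS := hΨS hx
    have hΨd : HasFDerivAt Ψ ((fderiv ℂ Z x).prod ℓ) x := by rw [hΨe]; exact hfd x hxS.1
    rw [((hHd _ (hmaps hx)).hasFDerivAt.comp x hΨd).fderiv]
    have : ((fderiv ℂ Z x).prod ℓ) (X x) = ℓ (X x) • ((0, 1) : ℂ × ℂ) := by
      simp [hXZ x hxS.1]
    rw [ContinuousLinearMap.comp_apply, this, map_smul, hH' _ (hmaps hx), Ψ.left_inv hx]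
    exact mul_inv_cancel₀ hxS.2
  have hfd' : ∀ x ∈ Ψ.source, HasFDerivAt (fun x => (Z x, (H ∘ Ψ) x))
      ((fderiv ℂ Z x).prod (fderiv ℂ (H ∘ Ψ) x)) x := fun x hx =>
    (hZd x (hΨS hx).1).hasFDerivAt.prodMk (hUd x hx).hasFDerivAt
  obtain ⟨Φ, r, hr, hqΦ, hΦS, hΦt, hΦf, hΦs, hΦs'⟩ :=
    exists_openPartialHomeomorph (f := fun x => (Z x, (H ∘ Ψ) x)) Ψ.open_source
      ((hZ.mono fun x hx => (hΨS hx).1).prodMk hU) hqΨ (by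
        intro v hv
        rw [(hfd' q hqΨ).fderiv] at hv
        have h1 : fderiv ℂ Z q v = 0 := congrArg Prod.fst hv
        have h2 : fderiv ℂ (H ∘ Ψ) q v = 0 := congrArg Prod.snd hv
        obtain ⟨c, rfl⟩ := exists_smul_of_clm_apply_eq_zero hZq hXq (hXZ q hq) h1
        rw [map_smul, hUX q hqΨ] at h2
        have : c = 0 := by simpa using h2
        simp [this])
  refine ⟨Φ, r, hr, hqΦ, fun x hx => (hΨS (hΦS hx)).1, by rw [hΦt, hΦf], hΦs, hΦs',
    fun x => by rw [hΦf], fun x hx => ?_⟩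
  have hΦe : (Φ : ℂ × ℂ → ℂ × ℂ) = fun x => (Z x, (H ∘ Ψ) x) := funext hΦf
  rw [hΦe, (hfd' x (hΦS hx)).fderiv]
  simp only [ContinuousLinearMap.prod_apply, hUX x (hΦS hx), hXZ x (hΨS (hΦS hx)).1]

/-! ### Prolongation calculus on holomorphic 2-jets. -/

section HolomorphicJets

/-- Second-order jets `((z, u), (u_z, u_zz))` of holomorphic functions `z ↦ u`. -/
abbrev HolJet : Type := (ℂ × ℂ) × (ℂ × ℂ)

variable {G : Type*} [NormedAddCommGroup G] [NormedSpace ℂ G]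

/-- Total derivative of `F` along a holomorphic jet. -/
def total (F : ℂ × ℂ → G) (x : HolJet) : G := fderiv ℂ F x.1 (1, x.2.1)

/-- Second total derivative of `F` along a holomorphic jet. -/
def total₂ (F : ℂ × ℂ → G) (x : HolJet) : G :=
  fderiv ℂ (fderiv ℂ F) x.1 (1, x.2.1) (1, x.2.1) + fderiv ℂ F x.1 (0, x.2.2)

/-- First-order prolongation coefficient. -/
def prolongOne (X : ℂ × ℂ → ℂ × ℂ) (x : HolJet) : ℂ :=
  (total X x).2 - x.2.1 * (total X x).1

/-- Second-order prolongation coefficient. -/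
def prolongTwo (X : ℂ × ℂ → ℂ × ℂ) (x : HolJet) : ℂ :=
  (total₂ X x).2 - x.2.1 * (total₂ X x).1 - 2 * x.2.2 * (total X x).1

/-- The second prolongation of a holomorphic vector field. -/
def holProlong (X : ℂ × ℂ → ℂ × ℂ) (x : HolJet) : HolJet :=
  (X x.1, (prolongOne X x, prolongTwo X x))

theorem hasFDerivAt_fderiv {F : ℂ × ℂ → G} {q : ℂ × ℂ} (hF : ContDiffAt ℂ ∞ F q) :
    HasFDerivAt (fderiv ℂ F) (fderiv ℂ (fderiv ℂ F) q) q :=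
  ((hF.fderiv_right (m := ∞) (by simp)).differentiableAt (by simp)).hasFDerivAt

theorem hasFDerivAt_total {F : ℂ × ℂ → G} {x : HolJet} (hF : ContDiffAt ℂ ∞ F x.1) :
    DifferentiableAt ℂ (total F) x ∧ ∀ v, fderiv ℂ (total F) x v =
      fderiv ℂ (fderiv ℂ F) x.1 v.1 (1, x.2.1) + fderiv ℂ F x.1 (0, v.2.1) := by
  have h1 : HasFDerivAt (fun x : HolJet => fderiv ℂ F x.1) _ x :=
    (hasFDerivAt_fderiv hF).comp x (hasFDerivAt_fst)
  have h2 : HasFDerivAt (fun x : HolJet => ((1, x.2.1) : ℂ × ℂ)) _ x :=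
    (hasFDerivAt_const (1 : ℂ) x).prodMk (hasFDerivAt_snd (𝕜 := ℂ) (p := x)).fst
  have h := h1.clm_apply h2
  refine ⟨h.differentiableAt, fun v => ?_⟩
  have : fderiv ℂ (total F) x = _ := h.fderiv
  rw [this]
  simp [add_comm]

theorem hasFDerivAt_total₂ {F : ℂ × ℂ → G} {x : HolJet} (hF : ContDiffAt ℂ ∞ F x.1) :
    DifferentiableAt ℂ (total₂ F) x ∧ ∀ v, fderiv ℂ (total₂ F) x v =
      fderiv ℂ (fderiv ℂ (fderiv ℂ F)) x.1 v.1 (1, x.2.1) (1, x.2.1)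
        + 2 • fderiv ℂ (fderiv ℂ F) x.1 (1, x.2.1) (0, v.2.1)
        + fderiv ℂ (fderiv ℂ F) x.1 v.1 (0, x.2.2) + fderiv ℂ F x.1 (0, v.2.2) := by
  have hF' : ContDiffAt ℂ ∞ (fderiv ℂ F) x.1 := hF.fderiv_right (by simp)
  have sym : IsSymmSndFDerivAt ℂ F x.1 :=
    hF.isSymmSndFDerivAt (by simpa using ENat.LEInfty.out)
  have h0 : HasFDerivAt (fun x : HolJet => fderiv ℂ (fderiv ℂ F) x.1) _ x :=
    (hasFDerivAt_fderiv hF').comp x (hasFDerivAt_fst)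
  have h1 : HasFDerivAt (fun x : HolJet => fderiv ℂ F x.1) _ x :=
    (hasFDerivAt_fderiv hF).comp x (hasFDerivAt_fst)
  have h2 : HasFDerivAt (fun x : HolJet => ((1, x.2.1) : ℂ × ℂ)) _ x :=
    (hasFDerivAt_const (1 : ℂ) x).prodMk (hasFDerivAt_snd (𝕜 := ℂ) (p := x)).fst
  have h3 : HasFDerivAt (fun x : HolJet => ((0, x.2.2) : ℂ × ℂ)) _ x :=
    (hasFDerivAt_const (0 : ℂ) x).prodMk (hasFDerivAt_snd (𝕜 := ℂ) (p := x)).snd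
  have h := ((h0.clm_apply h2).clm_apply h2).add (h1.clm_apply h3)
  refine ⟨h.differentiableAt, fun v => ?_⟩
  have : fderiv ℂ (total₂ F) x = _ := h.fderiv
  rw [this]
  simp only [add_apply, ContinuousLinearMap.comp_apply, ContinuousLinearMap.flip_apply,
    ContinuousLinearMap.prod_apply, ContinuousLinearMap.coe_fst', ContinuousLinearMap.coe_snd',
    zero_apply]
  rw [sym.eq (0, v.2.1) (1, x.2.1)]
  module

/-- The derivative of `F` along the vector field `X`. -/
def along (X : ℂ × ℂ → ℂ × ℂ) (F : ℂ × ℂ → G) (q : ℂ × ℂ) : G := fderiv ℂ F q (X q)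

theorem fderiv_along {X : ℂ × ℂ → ℂ × ℂ} {F : ℂ × ℂ → G} {q : ℂ × ℂ}
    (hX : DifferentiableAt ℂ X q) (hF : ContDiffAt ℂ ∞ F q) (v : ℂ × ℂ) :
    fderiv ℂ (along X F) q v =
      fderiv ℂ (fderiv ℂ F) q v (X q) + fderiv ℂ F q (fderiv ℂ X q v) := by
  have : fderiv ℂ (along X F) q = _ :=
    ((hasFDerivAt_fderiv hF).clm_apply hX.hasFDerivAt).fderiv
  rw [this]
  simp [add_comm]

theorem fderiv_fderiv_along {X : ℂ × ℂ → ℂ × ℂ} {F : ℂ × ℂ → G} {S : Set (ℂ × ℂ)}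
    (hS : IsOpen S) (hX : ContDiffOn ℂ ∞ X S) (hF : ContDiffOn ℂ ∞ F S) {q : ℂ × ℂ} (hq : q ∈ S)
    (v : ℂ × ℂ) :
    fderiv ℂ (fderiv ℂ (along X F)) q v v =
      fderiv ℂ (fderiv ℂ (fderiv ℂ F)) q (X q) v v
        + 2 • fderiv ℂ (fderiv ℂ F) q v (fderiv ℂ X q v)
        + fderiv ℂ F q (fderiv ℂ (fderiv ℂ X) q v v) := by
  have hXa : ∀ x ∈ S, ContDiffAt ℂ ∞ X x := fun x hx => hX.contDiffAt (hS.mem_nhds hx)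
  have hFa : ∀ x ∈ S, ContDiffAt ℂ ∞ F x := fun x hx => hF.contDiffAt (hS.mem_nhds hx)
  have hF' : ContDiffAt ℂ ∞ (fderiv ℂ F) q := (hFa q hq).fderiv_right (by simp)
  have hle : minSmoothness ℂ 2 ≤ (∞ : WithTop ℕ∞) := by simpa using ENat.LEInfty.out
  have hal : ContDiffAt ℂ ∞ (along X F) q := hF'.clm_apply (hXa q hq)
  have hev : (fun x => fderiv ℂ (along X F) x v) =ᶠ[𝓝 q]
      fun x => fderiv ℂ (fderiv ℂ F) x v (X x) + fderiv ℂ F x (fderiv ℂ X x v) := by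
    filter_upwards [hS.mem_nhds hq] with x hx using
      fderiv_along ((hXa x hx).differentiableAt (by simp)) (hFa x hx) v
  have h0 : fderiv ℂ (fun x => fderiv ℂ (along X F) x v) q v =
      fderiv ℂ (fderiv ℂ (along X F)) q v v := by
    rw [((hasFDerivAt_fderiv hal).clm_apply (hasFDerivAt_const v q)).fderiv]
    simp
  have hXd : HasFDerivAt X (fderiv ℂ X q) q :=
    ((hXa q hq).differentiableAt (by simp)).hasFDerivAt
  have h1 : HasFDerivAt
      (fun x => fderiv ℂ (fderiv ℂ F) x v (X x) + fderiv ℂ F x (fderiv ℂ X x v)) _ q :=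
    (((hasFDerivAt_fderiv hF').clm_apply (hasFDerivAt_const v q)).clm_apply hXd).add
    ((hasFDerivAt_fderiv (hFa q hq)).clm_apply
      ((hasFDerivAt_fderiv (hXa q hq)).clm_apply (hasFDerivAt_const v q)))
  rw [← h0, hev.fderiv_eq, h1.fderiv]
  -- Symmetry in all three slots: the symmetry of D²F holds near q and may be differentiated, and
  -- D²(DF) is symmetric too.
  have sym₃ : fderiv ℂ (fderiv ℂ (fderiv ℂ F)) q v v (X q) =
      fderiv ℂ (fderiv ℂ (fderiv ℂ F)) q (X q) v v := by
    have e : ∀ a b, fderiv ℂ (fun x => fderiv ℂ (fderiv ℂ F) x a b) q v =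
        fderiv ℂ (fderiv ℂ (fderiv ℂ F)) q v a b := by
      intro a b
      rw [(((hasFDerivAt_fderiv hF').clm_apply (hasFDerivAt_const a q)).clm_apply
        (hasFDerivAt_const b q)).fderiv]
      simp
    have hswap : (fun x => fderiv ℂ (fderiv ℂ F) x v (X q)) =ᶠ[𝓝 q]
        fun x => fderiv ℂ (fderiv ℂ F) x (X q) v := by
      filter_upwards [hS.mem_nhds hq] with x hx using
        ((hFa x hx).isSymmSndFDerivAt hle).eq v (X q)
    rw [← e, hswap.fderiv_eq, e, (hF'.isSymmSndFDerivAt hle).eq v (X q)]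
  simp only [add_apply, ContinuousLinearMap.comp_apply, ContinuousLinearMap.flip_apply, zero_apply,
    map_zero, zero_add, sym₃]
  module

/-- The commutation rule pr X ∘ D = D ∘ X − (Dξ) D, with ξ the first component of X. Splitting DX
along (1, p) and the fibre direction leaves exactly the prolongation coefficient in the fibre. -/
theorem fderiv_total_holProlong {X : ℂ × ℂ → ℂ × ℂ} {F : ℂ × ℂ → G} {x : HolJet}
    (hX : ContDiffAt ℂ ∞ X x.1) (hF : ContDiffAt ℂ ∞ F x.1) :
    fderiv ℂ (total F) x (holProlong X x) =
      total (along X F) x - (total X x).1 • total F x := by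
  rw [(hasFDerivAt_total hF).2]
  simp only [total, holProlong, prolongOne]
  rw [fderiv_along (hX.differentiableAt (by simp)) hF]
  have sym : IsSymmSndFDerivAt ℂ F x.1 :=
    hF.isSymmSndFDerivAt (by simpa using ENat.LEInfty.out)
  set a := fderiv ℂ X x.1 (1, x.2.1)
  have ha : a = a.1 • ((1, x.2.1) : ℂ × ℂ) + (0, a.2 - x.2.1 * a.1) := by
    ext <;> simp; ring
  have : fderiv ℂ F x.1 a = a.1 • fderiv ℂ F x.1 (1, x.2.1)
      + fderiv ℂ F x.1 (0, a.2 - x.2.1 * a.1) := by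
    rw [← map_smul, ← map_add, ← ha]
  rw [this, sym.eq (X x.1)]
  module

/-- Second-order form of the same rule: pr X ∘ D² = D² ∘ X − 2(Dξ) D² − (D²ξ) D. -/
theorem fderiv_total₂_holProlong {X : ℂ × ℂ → ℂ × ℂ} {F : ℂ × ℂ → G} {S : Set (ℂ × ℂ)}
    (hS : IsOpen S) (hX : ContDiffOn ℂ ∞ X S) (hF : ContDiffOn ℂ ∞ F S) {x : HolJet}
    (hx : x.1 ∈ S) :
    fderiv ℂ (total₂ F) x (holProlong X x) =
      total₂ (along X F) x - (2 * (total X x).1) • total₂ F x - (total₂ X x).1 • total F x := by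
  have hXa : ContDiffAt ℂ ∞ X x.1 := hX.contDiffAt (hS.mem_nhds hx)
  have hFa : ContDiffAt ℂ ∞ F x.1 := hF.contDiffAt (hS.mem_nhds hx)
  rw [(hasFDerivAt_total₂ hFa).2]
  have sym : IsSymmSndFDerivAt ℂ F x.1 :=
    hFa.isSymmSndFDerivAt (by simpa using ENat.LEInfty.out)
  have hal : total₂ (along X F) x = fderiv ℂ (fderiv ℂ (fderiv ℂ F)) x.1 (X x.1) (1, x.2.1)
        (1, x.2.1) + 2 • fderiv ℂ (fderiv ℂ F) x.1 (1, x.2.1) (total X x)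
        + fderiv ℂ (fderiv ℂ F) x.1 (X x.1) (0, x.2.2) + fderiv ℂ F x.1 (total₂ X x) := by
    simp only [total₂, total]
    rw [fderiv_fderiv_along hS hX hF hx, fderiv_along (hXa.differentiableAt (by simp)) hFa,
      sym.eq (X x.1), map_add]
    module
  rw [hal]
  set a := total X x with ha'
  set b := total₂ X x with hb'
  have ha : a = a.1 • ((1, x.2.1) : ℂ × ℂ) + (0, prolongOne X x) := by
    simp only [prolongOne, ← ha']
    ext <;> simp; ring
  have hb : b = b.1 • ((1, x.2.1) : ℂ × ℂ) + (0, prolongTwo X x)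
      + (2 * a.1) • ((0, x.2.2) : ℂ × ℂ) := by
    simp only [prolongTwo, ← ha', ← hb']
    ext <;> simp; ring
  have h1 : fderiv ℂ (fderiv ℂ F) x.1 (1, x.2.1) a =
      a.1 • fderiv ℂ (fderiv ℂ F) x.1 (1, x.2.1) (1, x.2.1)
      + fderiv ℂ (fderiv ℂ F) x.1 (1, x.2.1) (0, prolongOne X x) := by
    rw [← map_smul, ← map_add, ← ha]
  have h2 : fderiv ℂ F x.1 b = b.1 • fderiv ℂ F x.1 (1, x.2.1)
      + fderiv ℂ F x.1 (0, prolongTwo X x) + (2 * a.1) • fderiv ℂ F x.1 (0, x.2.2) := by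
    rw [← map_smul, ← map_smul, ← map_add, ← map_add, ← hb]
  rw [h1, h2]
  simp only [holProlong, total₂, total]
  module

/-- The second derivative, in the coordinates `Φ = (Z, U)`, of the function with the given jet. -/
def newSecond (Φ : ℂ × ℂ → ℂ × ℂ) (x : HolJet) : ℂ :=
  ((total₂ Φ x).2 * (total Φ x).1 - (total Φ x).2 * (total₂ Φ x).1) / (total Φ x).1 ^ 3

theorem differentiableAt_newSecond {Φ : ℂ × ℂ → ℂ × ℂ} {x : HolJet}
    (hΦ : ContDiffAt ℂ ∞ Φ x.1) (h0 : (total Φ x).1 ≠ 0) :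
    DifferentiableAt ℂ (newSecond Φ) x := by
  have h1 := (hasFDerivAt_total hΦ).1
  have h2 := (hasFDerivAt_total₂ hΦ).1
  unfold newSecond
  have hn : DifferentiableAt ℂ (fun x => (total₂ Φ x).2 * (total Φ x).1
      - (total Φ x).2 * (total₂ Φ x).1) x :=
    (h2.snd.fun_mul h1.fst).fun_sub (h1.snd.fun_mul h2.fst)
  have hd : DifferentiableAt ℂ (fun x => (total Φ x).1 ^ 3) x := h1.fst.fun_pow 3
  simp only [div_eq_mul_inv]
  exact hn.fun_mul (hd.fun_inv (by simpa using h0))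

/-- `newSecond` is invariant under vector fields that are affine in the new coordinates:
`X Z = 0`, `X U = c + d Z`. -/
theorem fderiv_newSecond_holProlong {X Φ : ℂ × ℂ → ℂ × ℂ} {S : Set (ℂ × ℂ)}
    (hS : IsOpen S) (hX : ContDiffOn ℂ ∞ X S) (hΦ : ContDiffOn ℂ ∞ Φ S) {x : HolJet}
    (hx : x.1 ∈ S) (h0 : (total Φ x).1 ≠ 0) {c d : ℂ}
    (hXΦ : ∀ q ∈ S, fderiv ℂ Φ q (X q) = (0, c + d * (Φ q).1)) :
    fderiv ℂ (newSecond Φ) x (holProlong X x) = 0 := by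
  have hXa : ContDiffAt ℂ ∞ X x.1 := hX.contDiffAt (hS.mem_nhds hx)
  have hΦa : ContDiffAt ℂ ∞ Φ x.1 := hΦ.contDiffAt (hS.mem_nhds hx)
  set A : ℂ × ℂ →L[ℂ] ℂ × ℂ :=
    (0 : ℂ × ℂ →L[ℂ] ℂ).prod (d • ContinuousLinearMap.fst ℂ ℂ ℂ) with hA
  have hfd : ∀ q ∈ S, fderiv ℂ (along X Φ) q = A.comp (fderiv ℂ Φ q) := by
    intro q hq
    have hev : along X Φ =ᶠ[𝓝 q] fun q => (0, c) + A (Φ q) := by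
      filter_upwards [hS.mem_nhds hq] with y hy
      simp [along, hXΦ y hy, hA]
    have hd : HasFDerivAt Φ (fderiv ℂ Φ q) q :=
      ((hΦ.contDiffAt (hS.mem_nhds hq)).differentiableAt (by simp)).hasFDerivAt
    rw [hev.fderiv_eq]
    exact ((A.hasFDerivAt.comp q hd).const_add _).fderiv
  have ht : total (along X Φ) x = (0, d * (total Φ x).1) := by
    simp only [total, hfd _ hx]; simp [hA]
  have ht₂ : total₂ (along X Φ) x = (0, d * (total₂ Φ x).1) := by
    have hev : fderiv ℂ (along X Φ) =ᶠ[𝓝 x.1] fun q => A.comp (fderiv ℂ Φ q) := by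
      filter_upwards [hS.mem_nhds hx] with y hy using hfd y hy
    have := (((hasFDerivAt_const A x.1).clm_comp (hasFDerivAt_fderiv hΦa)).congr_of_eventuallyEq
      hev).fderiv
    simp only [total₂, hfd _ hx, this]
    simp [hA, mul_add]
  -- Differentiate U_ZZ = (D²U · DZ − DU · D²Z)/(DZ)³ along a line in jet space in the direction of
  -- pr X. Numerator and denominator both scale by −3Dξ; the terms with d and with D²ξ cancel.
  have hline : HasDerivAt (fun t : ℂ => x + t • holProlong X x) (holProlong X x) 0 := by
    simpa using ((hasDerivAt_id (0 : ℂ)).smul_const (holProlong X x)).const_add x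
  have hx0 : x + (0 : ℂ) • holProlong X x = x := by simp
  have d1 := HasFDerivAt.comp_hasDerivAt (0 : ℂ) (l := total Φ)
    (f := fun t : ℂ => x + t • holProlong X x)
    (by rw [hx0]; exact (hasFDerivAt_total hΦa).1.hasFDerivAt) hline
  have d2 := HasFDerivAt.comp_hasDerivAt (0 : ℂ) (l := total₂ Φ)
    (f := fun t : ℂ => x + t • holProlong X x)
    (by rw [hx0]; exact (hasFDerivAt_total₂ hΦa).1.hasFDerivAt) hline
  have dR := HasFDerivAt.comp_hasDerivAt (0 : ℂ) (l := newSecond Φ)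
    (f := fun t : ℂ => x + t • holProlong X x)
    (by rw [hx0]; exact (differentiableAt_newSecond hΦa h0).hasFDerivAt) hline
  rw [fderiv_total_holProlong hXa hΦa, ht] at d1
  rw [fderiv_total₂_holProlong hS hX hΦ hx, ht₂] at d2
  have f1 := (ContinuousLinearMap.fst ℂ ℂ ℂ).hasFDerivAt.comp_hasDerivAt 0 d1
  have s1 := (ContinuousLinearMap.snd ℂ ℂ ℂ).hasFDerivAt.comp_hasDerivAt 0 d1
  have f2 := (ContinuousLinearMap.fst ℂ ℂ ℂ).hasFDerivAt.comp_hasDerivAt 0 d2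
  have s2 := (ContinuousLinearMap.snd ℂ ℂ ℂ).hasFDerivAt.comp_hasDerivAt 0 d2
  have dR' := ((s2.mul f1).sub (s1.mul f2)).div (f1.pow 3) (by simpa [hx0] using h0)
  have := dR.unique dR'
  rw [this]
  simp only [Function.comp_apply, Pi.mul_apply, Pi.sub_apply, Pi.pow_apply, hx0,
    ContinuousLinearMap.coe_fst', ContinuousLinearMap.coe_snd', Prod.fst_sub,
    Prod.snd_sub, Prod.smul_fst, Prod.smul_snd, smul_eq_mul]
  rw [div_eq_zero_iff]
  left
  push_cast
  ring

end HolomorphicJets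

/-! ### The transformed right-hand side and the linearizing coordinates. -/

/-- Lie's criterion for the holomorphic vector field `X` on `S` and the equation
`u_zz = w(z, u, u_z)`, whose right-hand side need not be holomorphic. -/
def IsHolSymmetry (S : Set (ℂ × ℂ)) (w : (ℂ × ℂ) × ℂ → ℂ) (X : ℂ × ℂ → ℂ × ℂ) : Prop :=
  ContDiffOn ℂ ∞ X S ∧ ∀ q ∈ S, ∀ p : ℂ,
    fderiv ℝ w (q, p) (X q, prolongOne X (q, (p, 0))) = prolongTwo X (q, (p, w (q, p)))

/-- The right-hand side of the equation in the coordinates `Φ`. -/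
def newRhs (Φ : ℂ × ℂ → ℂ × ℂ) (w : (ℂ × ℂ) × ℂ → ℂ) (y : (ℂ × ℂ) × ℂ) : ℂ :=
  newSecond Φ (y.1, (y.2, w y))

theorem contDiffOn_total {G : Type*} [NormedAddCommGroup G] [NormedSpace ℂ G] {F : ℂ × ℂ → G}
    {S : Set (ℂ × ℂ)} (hS : IsOpen S) (hF : ContDiffOn ℂ ∞ F S) :
    ContDiffOn ℂ ∞ (total F) (Prod.fst ⁻¹' S) := by
  have hF' : ContDiffOn ℂ ∞ (fderiv ℂ F) S := (contDiffOn_infty_iff_fderiv_of_isOpen hS |>.1 hF).2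
  exact (hF'.comp contDiffOn_fst (mapsTo_preimage _ _)).clm_apply (by fun_prop)

theorem contDiffOn_total₂ {G : Type*} [NormedAddCommGroup G] [NormedSpace ℂ G] {F : ℂ × ℂ → G}
    {S : Set (ℂ × ℂ)} (hS : IsOpen S) (hF : ContDiffOn ℂ ∞ F S) :
    ContDiffOn ℂ ∞ (total₂ F) (Prod.fst ⁻¹' S) := by
  have hF' : ContDiffOn ℂ ∞ (fderiv ℂ F) S := (contDiffOn_infty_iff_fderiv_of_isOpen hS |>.1 hF).2
  have hF'' : ContDiffOn ℂ ∞ (fderiv ℂ (fderiv ℂ F)) S :=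
    (contDiffOn_infty_iff_fderiv_of_isOpen hS |>.1 hF').2
  exact (((hF''.comp contDiffOn_fst (mapsTo_preimage _ _)).clm_apply (by fun_prop)).clm_apply
    (by fun_prop)).add ((hF'.comp contDiffOn_fst (mapsTo_preimage _ _)).clm_apply (by fun_prop))

/-- The first jets over `S` that are transversal to the fibres of the first component of `Φ`. -/
def transversal (Φ : ℂ × ℂ → ℂ × ℂ) (S : Set (ℂ × ℂ)) : Set ((ℂ × ℂ) × ℂ) :=
  {y | y.1 ∈ S ∧ (total Φ (y.1, (y.2, 0))).1 ≠ 0}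

theorem isOpen_transversal {Φ : ℂ × ℂ → ℂ × ℂ} {S : Set (ℂ × ℂ)} (hS : IsOpen S)
    (hΦ : ContDiffOn ℂ ∞ Φ S) : IsOpen (transversal Φ S) := by
  have h : ContinuousOn (fun y : (ℂ × ℂ) × ℂ => (total Φ (y.1, (y.2, 0))).1) (Prod.fst ⁻¹' S) :=
    continuous_fst.comp_continuousOn ((contDiffOn_total hS hΦ).continuousOn.comp
      (f := fun y : (ℂ × ℂ) × ℂ => ((y.1, (y.2, 0)) : HolJet)) (by fun_prop)
      fun y hy => hy)
  exact h.isOpen_inter_preimage (hS.preimage continuous_fst) isOpen_compl_singleton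

theorem contDiffOn_newSecond {Φ : ℂ × ℂ → ℂ × ℂ} {S : Set (ℂ × ℂ)} (hS : IsOpen S)
    (hΦ : ContDiffOn ℂ ∞ Φ S) :
    ContDiffOn ℂ ∞ (newSecond Φ) {x | x.1 ∈ S ∧ (total Φ x).1 ≠ 0} := by
  have h1 := (contDiffOn_total hS hΦ).mono
    (s := Prod.fst ⁻¹' S) (t := {x | x.1 ∈ S ∧ (total Φ x).1 ≠ 0}) fun x hx => hx.1
  have h2 := (contDiffOn_total₂ hS hΦ).mono
    (s := Prod.fst ⁻¹' S) (t := {x | x.1 ∈ S ∧ (total Φ x).1 ≠ 0}) fun x hx => hx.1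
  exact ((h2.snd.mul h1.fst).sub (h1.snd.mul h2.fst)).div (h1.fst.pow 3)
    fun x hx => pow_ne_zero 3 hx.2

theorem contDiffOn_newRhs {Φ : ℂ × ℂ → ℂ × ℂ} {S : Set (ℂ × ℂ)} (hS : IsOpen S)
    (hΦ : ContDiffOn ℂ ∞ Φ S) {w : (ℂ × ℂ) × ℂ → ℂ} (hw : ContDiffOn ℝ ∞ w (S ×ˢ univ)) :
    ContDiffOn ℝ ∞ (newRhs Φ w) (transversal Φ S) := by
  refine ((contDiffOn_newSecond hS hΦ).restrict_scalars ℝ).comp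
    (f := fun y : (ℂ × ℂ) × ℂ => ((y.1, (y.2, w y)) : HolJet)) ?_ fun y hy => hy
  exact contDiffOn_fst.prodMk (contDiffOn_snd.prodMk (hw.mono fun y hy => ⟨hy.1, mem_univ _⟩))

/-- For a symmetry the prolonged field is tangent to the hypersurface u_zz = w, so the derivative of
the restriction of `newSecond` to it is the derivative along the full prolongation, which is zero.
-/
theorem fderiv_newRhs {X Φ : ℂ × ℂ → ℂ × ℂ} {S : Set (ℂ × ℂ)} (hS : IsOpen S)
    (hΦ : ContDiffOn ℂ ∞ Φ S) {w : (ℂ × ℂ) × ℂ → ℂ} (hw : ContDiffOn ℝ ∞ w (S ×ˢ univ))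
    (hX : IsHolSymmetry S w X) {c d : ℂ}
    (hXΦ : ∀ q ∈ S, fderiv ℂ Φ q (X q) = (0, c + d * (Φ q).1)) {q : ℂ × ℂ} {p : ℂ}
    (hy : (q, p) ∈ transversal Φ S) :
    fderiv ℝ (newRhs Φ w) (q, p) (X q, prolongOne X (q, (p, 0))) = 0 := by
  have hwd : DifferentiableAt ℝ w (q, p) :=
    (hw.contDiffAt ((hS.prod isOpen_univ).mem_nhds ⟨hy.1, mem_univ _⟩)).differentiableAt (by simp)
  have hR : DifferentiableAt ℂ (newSecond Φ) (q, (p, w (q, p))) :=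
    differentiableAt_newSecond (hΦ.contDiffAt (hS.mem_nhds hy.1)) hy.2
  have hι : HasFDerivAt (fun y : (ℂ × ℂ) × ℂ => ((y.1, (y.2, w y)) : HolJet))
      ((ContinuousLinearMap.fst ℝ (ℂ × ℂ) ℂ).prod
        ((ContinuousLinearMap.snd ℝ (ℂ × ℂ) ℂ).prod (fderiv ℝ w (q, p)))) (q, p) :=
    hasFDerivAt_fst.prodMk (hasFDerivAt_snd.prodMk hwd.hasFDerivAt)
  have h : fderiv ℝ (newRhs Φ w) (q, p) = _ :=
    ((hR.hasFDerivAt.restrictScalars ℝ).comp (q, p) hι).fderiv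
  rw [h]
  simp only [ContinuousLinearMap.comp_apply, ContinuousLinearMap.prod_apply,
    ContinuousLinearMap.coe_restrictScalars', ContinuousLinearMap.coe_fst',
    ContinuousLinearMap.coe_snd', hX.2 q hy.1 p]
  exact fderiv_newSecond_holProlong (x := (q, (p, w (q, p)))) hS hX.1 hΦ hy.1 hy.2 hXΦ

/-- The extra term is Df times the characteristic of X. For constant f it drops out; for f = Z it is
what separates the prolongations of X₁ and X₂. -/
theorem prolongOne_smul {f : ℂ × ℂ → ℂ} {X Y : ℂ × ℂ → ℂ × ℂ} {S : Set (ℂ × ℂ)} (hS : IsOpen S)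
    (hf : ContDiffOn ℂ ∞ f S) (hX : ContDiffOn ℂ ∞ X S) (hY : ∀ q ∈ S, Y q = f q • X q)
    {q : ℂ × ℂ} (hq : q ∈ S) (p r : ℂ) :
    prolongOne Y (q, (p, r)) = f q * prolongOne X (q, (p, r))
      + total f (q, (p, r)) * ((X q).2 - p * (X q).1) := by
  have hev : Y =ᶠ[𝓝 q] fun q => f q • X q := by
    filter_upwards [hS.mem_nhds hq] with x hx using hY x hx
  have hfd := (hf.contDiffAt (hS.mem_nhds hq)).differentiableAt (by simp)
  have hXd := (hX.contDiffAt (hS.mem_nhds hq)).differentiableAt (by simp)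
  simp only [prolongOne, total, hev.fderiv_eq, fderiv_fun_smul hfd hXd]
  simp
  ring

/-- For nonreal ε, the vectors v and ε • v span the complex line of v over ℝ. This is how the fields
Y₁, Y₂ make up for w not being holomorphic. -/
theorem clm_eq_zero_of_smul {E F : Type*} [NormedAddCommGroup E] [NormedSpace ℂ E]
    [NormedSpace ℝ E] [IsScalarTower ℝ ℂ E] [NormedAddCommGroup F] [NormedSpace ℝ F]
    (L : E →L[ℝ] F) {ε : ℂ} (hε : ε.im ≠ 0) {v : E} (h1 : L v = 0) (h2 : L (ε • v) = 0) (c : ℂ) :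
    L (c • v) = 0 := by
  have h3 : L (Complex.I • v) = 0 := by
    rw [complex_smul_eq, map_add, map_smul, map_smul, h1, smul_zero, zero_add] at h2
    exact (smul_eq_zero.1 h2).resolve_left hε
  rw [complex_smul_eq, map_add, map_smul, map_smul, h1, h3]
  simp

/-- The coordinates `Φ = (Z, U)` in which `X₁ = ∂_U`, `X₂ = Z ∂_U`, and the right-hand side depends
only on `Z`. -/
theorem exists_linearizing_coordinates {S : Set (ℂ × ℂ)} (hS : IsOpen S) {w : (ℂ × ℂ) × ℂ → ℂ}
    (hw : ContDiffOn ℝ ∞ w (S ×ˢ univ)) {X₁ Y₁ X₂ Y₂ : ℂ × ℂ → ℂ × ℂ}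
    (hX₁ : IsHolSymmetry S w X₁) (hY₁ : IsHolSymmetry S w Y₁)
    (hX₂ : IsHolSymmetry S w X₂) (hY₂ : IsHolSymmetry S w Y₂)
    {ε : ℂ} (hε : ε.im ≠ 0)
    (hXY₁ : ∀ q ∈ S, Y₁ q = ε • X₁ q) (hXY₂ : ∀ q ∈ S, Y₂ q = ε • X₂ q)
    {Z : ℂ × ℂ → ℂ} (hZ : ContDiffOn ℂ ∞ Z S) (hX : ∀ q ∈ S, X₂ q = Z q • X₁ q)
    (hXZ : ∀ q ∈ S, fderiv ℂ Z q (X₁ q) = 0) {q₀ : ℂ × ℂ} (hq₀ : q₀ ∈ S) (hX₁q : X₁ q₀ ≠ 0)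
    (hZq : fderiv ℂ Z q₀ ≠ 0) :
    ∃ Φ : OpenPartialHomeomorph (ℂ × ℂ) (ℂ × ℂ), q₀ ∈ Φ.source ∧ Φ.source ⊆ S ∧
      ContDiffOn ℂ ∞ Φ Φ.source ∧ ContDiffOn ℂ ∞ Φ.symm Φ.target ∧
      (∀ q, (Φ q).1 = Z q) ∧ (∀ q ∈ Φ.source, fderiv ℂ Φ q (X₁ q) = (0, 1)) ∧
      ∃ W : ℂ → ℂ, ContDiffOn ℝ ∞ W (Prod.fst '' Φ.target) ∧
        ∀ q p, (q, p) ∈ transversal Φ Φ.source → newRhs Φ w (q, p) = W (Φ q).1 := by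
  have hZ' : ContinuousOn (fderiv ℂ Z) S := hZ.continuousOn_fderiv_of_isOpen hS (by simp)
  -- A slope along which Z has nonzero derivative; passing to `S₁` keeps it admissible throughout
  -- the source. The function W is read off at this slope and at the value of U at q₀.
  obtain ⟨p₀, hp₀⟩ : ∃ p : ℂ, fderiv ℂ Z q₀ (1, p) ≠ 0 := by
    by_contra! h
    apply hZq
    have h0 := h 0
    have h1 : fderiv ℂ Z q₀ (0, 1) = 0 := by
      have : ((0, 1) : ℂ × ℂ) = (1, 1) - (1, 0) := by simp
      rw [this, map_sub, h, h, sub_zero]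
    ext <;> simpa
  set S₁ : Set (ℂ × ℂ) := S ∩ (fun q => fderiv ℂ Z q (1, p₀)) ⁻¹' {0}ᶜ
  have hS₁ : IsOpen S₁ :=
    (hZ'.clm_apply continuousOn_const).isOpen_inter_preimage hS isOpen_compl_singleton
  have hS₁S : S₁ ⊆ S := inter_subset_left
  obtain ⟨Φ, r, hr, hqΦ, hΦS, hΦt, hΦs, hΦs', hΦZ, hΦX⟩ := exists_straightening hS₁
    (hX₁.1.mono hS₁S) (hZ.mono hS₁S) ⟨hq₀, hp₀⟩ hX₁q hZq (fun x hx => hXZ x (hS₁S hx))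
  have hsrc : Φ.source ⊆ S := hΦS.trans hS₁S
  have hΦo := Φ.open_source
  have hΦd : ∀ q ∈ Φ.source, DifferentiableAt ℂ Φ q := fun q hq =>
    (hΦs.contDiffAt (hΦo.mem_nhds hq)).differentiableAt (by simp)
  have hΦ1 : ∀ q ∈ Φ.source, ∀ v, (fderiv ℂ Φ q v).1 = fderiv ℂ Z q v := by
    intro q hq v
    have h1 : HasFDerivAt (fun q => (Φ q).1) _ q := (hΦd q hq).hasFDerivAt.fst
    have h2 : (fun q => (Φ q).1) = Z := funext hΦZ
    rw [h2] at h1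
    rw [h1.fderiv]; rfl
  have hsub : ∀ {X}, IsHolSymmetry S w X → IsHolSymmetry Φ.source w X := fun h =>
    ⟨h.1.mono hsrc, fun q hq => h.2 q (hsrc hq)⟩
  have hw' : ContDiffOn ℝ ∞ w (Φ.source ×ˢ univ) := hw.mono (prod_mono hsrc Subset.rfl)
  have hN : ContDiffOn ℝ ∞ (newRhs Φ w) (transversal Φ Φ.source) := contDiffOn_newRhs hΦo hΦs hw'
  have hTo : IsOpen (transversal Φ Φ.source) := isOpen_transversal hΦo hΦs
  have hNd : ∀ y ∈ transversal Φ Φ.source, DifferentiableAt ℝ (newRhs Φ w) y := fun y hy =>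
    (hN.contDiffAt (hTo.mem_nhds hy)).differentiableAt (by simp)
  -- The real differential of the new right-hand side vanishes in the direction of the slope and
  -- along X₁, over all complex multiples.
  have hlin : ∀ q p, (q, p) ∈ transversal Φ Φ.source →
      (∀ c : ℂ, fderiv ℝ (newRhs Φ w) (q, p) (0, c) = 0) ∧
      ∀ c : ℂ, fderiv ℝ (newRhs Φ w) (q, p) (c • X₁ q, 0) = 0 := by
    intro q p hy
    have hqs : q ∈ Φ.source := hy.1
    have hq : q ∈ S := hsrc hqs
    set L := fderiv ℝ (newRhs Φ w) (q, p)
    have e1 : L (X₁ q, prolongOne X₁ (q, (p, 0))) = 0 :=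
      fderiv_newRhs hΦo hΦs hw' (hsub hX₁) (c := 1) (d := 0)
        (fun x hx => by rw [hΦX x hx]; simp) hy
    have e2 : L (Y₁ q, prolongOne Y₁ (q, (p, 0))) = 0 :=
      fderiv_newRhs hΦo hΦs hw' (hsub hY₁) (c := ε) (d := 0)
        (fun x hx => by rw [hXY₁ x (hsrc hx), map_smul, hΦX x hx]; simp) hy
    have e3 : L (X₂ q, prolongOne X₂ (q, (p, 0))) = 0 :=
      fderiv_newRhs hΦo hΦs hw' (hsub hX₂) (c := 0) (d := 1)
        (fun x hx => by rw [hX x (hsrc hx), map_smul, hΦX x hx, hΦZ]; simp) hy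
    have e4 : L (Y₂ q, prolongOne Y₂ (q, (p, 0))) = 0 :=
      fderiv_newRhs hΦo hΦs hw' (hsub hY₂) (c := 0) (d := ε)
        (fun x hx => by
          rw [hXY₂ x (hsrc hx), hX x (hsrc hx), map_smul, map_smul, hΦX x hx, hΦZ]; simp) hy
    have hconst : total (fun _ : ℂ × ℂ => ε) (q, (p, 0)) = 0 := by simp [total]
    rw [hXY₁ q hq, prolongOne_smul hS contDiffOn_const hX₁.1 hXY₁ hq, hconst, zero_mul,
      add_zero, ← smul_eq_mul, ← Prod.smul_mk] at e2
    rw [hXY₂ q hq, prolongOne_smul hS contDiffOn_const hX₂.1 hXY₂ hq, hconst, zero_mul,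
      add_zero, ← smul_eq_mul, ← Prod.smul_mk] at e4
    have k1 := clm_eq_zero_of_smul L hε e1 e2
    have k2 := clm_eq_zero_of_smul L hε e3 e4
    -- The prolongation of X₂ exceeds Z times that of X₁ by (0, κ). If the characteristic of X₁
    -- vanished, X₁ would be a multiple of (1, p), where DZ ≠ 0; then X₁Z = 0 would give X₁ = 0.
    set κ : ℂ := total Z (q, (p, 0)) * ((X₁ q).2 - p * (X₁ q).1) with hκ
    have hDZ : fderiv ℂ Z q (1, p) ≠ 0 := by
      rw [← hΦ1 q hqs]; exact hy.2
    have hκ0 : κ ≠ 0 := by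
      refine mul_ne_zero hDZ fun h => ?_
      have hXe : X₁ q = (X₁ q).1 • ((1, p) : ℂ × ℂ) := by
        ext
        · simp
        · simp only [Prod.smul_snd, smul_eq_mul]; linear_combination h
      have h1 := hXZ q hq
      rw [hXe, map_smul, smul_eq_mul] at h1
      have h2 : (X₁ q).1 = 0 := (mul_eq_zero.1 h1).resolve_right hDZ
      have h3 := hΦX q hqs
      rw [hXe, h2, zero_smul, map_zero] at h3
      exact one_ne_zero (congrArg Prod.snd h3).symm
    have hv : (X₂ q, prolongOne X₂ (q, (p, 0))) =
        Z q • (X₁ q, prolongOne X₁ (q, (p, 0))) + ((0, κ) : (ℂ × ℂ) × ℂ) := by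
      rw [hX q hq, prolongOne_smul hS hZ hX₁.1 hX hq, hκ]
      simp
    have h0 : ∀ c : ℂ, L (0, c) = 0 := by
      intro c
      have : ((0, c) : (ℂ × ℂ) × ℂ) = (c / κ) • (X₂ q, prolongOne X₂ (q, (p, 0)))
          - (c / κ * Z q) • (X₁ q, prolongOne X₁ (q, (p, 0))) := by
        rw [hv, smul_add, mul_smul, add_sub_cancel_left]
        simp [hκ0]
      rw [this, map_sub, k1, k2, sub_zero]
    refine ⟨h0, fun c => ?_⟩
    have : ((c • X₁ q, 0) : (ℂ × ℂ) × ℂ) = c • (X₁ q, prolongOne X₁ (q, (p, 0)))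
        - (0, c * prolongOne X₁ (q, (p, 0))) := by simp
    rw [this, map_sub, k1, h0, sub_zero]
  have hmem₀ : ∀ q ∈ Φ.source, (q, p₀) ∈ transversal Φ Φ.source := fun q hq =>
    ⟨hq, by rw [total, hΦ1 q hq]; exact (hΦS hq).2⟩
  -- The target is a product of two discs, so all values of Z share one connected disc of values of
  -- U.
  have htgt : ∀ Q, Q ∈ Φ.target ↔
      Q.1 ∈ Metric.ball (Φ q₀).1 r ∧ Q.2 ∈ Metric.ball (Φ q₀).2 r := by
    intro Q
    rw [hΦt, ← ball_prod_same]; rfl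
  have hu₀ : (Φ q₀).2 ∈ Metric.ball (Φ q₀).2 r := Metric.mem_ball_self hr
  refine ⟨Φ, hqΦ, hsrc, hΦs, hΦs', hΦZ, hΦX,
    fun ζ => newRhs Φ w (Φ.symm (ζ, (Φ q₀).2), p₀), ?_, ?_⟩
  · have hmaps : MapsTo (fun ζ : ℂ => (ζ, (Φ q₀).2)) (Prod.fst '' Φ.target) Φ.target := by
      rintro _ ⟨Q, hQ, rfl⟩
      exact (htgt _).2 ⟨((htgt Q).1 hQ).1, hu₀⟩
    refine hN.comp (ContDiffOn.prodMk
      ((hΦs'.restrict_scalars ℝ).comp (t := Φ.target) (contDiffOn_id.prodMk contDiffOn_const) hmaps)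
      contDiffOn_const) ?_
    intro ζ hζ
    exact hmem₀ _ (Φ.map_target (hmaps hζ))
  · intro q p hy
    have hqs : q ∈ Φ.source := hy.1
    -- independence of `p`
    have hp : newRhs Φ w (q, p) = newRhs Φ w (q, p₀) := by
      set P : Set ℂ := {p | (q, p) ∈ transversal Φ Φ.source}
      have hPo : IsOpen P := hTo.preimage (by fun_prop)
      have hPe : P = {p | fderiv ℂ Z q (1, 0) + p * fderiv ℂ Z q (0, 1) ≠ 0} := by
        ext p
        have h1 : (total Φ (q, (p, 0))).1 =
            fderiv ℂ Z q (1, 0) + p * fderiv ℂ Z q (0, 1) := by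
          rw [total, hΦ1 q hqs, ← smul_eq_mul, ← map_smul, ← map_add]
          simp
        simp only [P, transversal, mem_ofPred_eq, h1, hqs, true_and]
      -- The admissible slopes are the nonzeros of an affine function: none, all of ℂ, or ℂ without
      -- a point, which is connected because ℂ has real dimension two.
      have hPc : IsPreconnected P := by
        rw [hPe]
        by_cases hb : fderiv ℂ Z q (0, 1) = 0
        · by_cases ha : fderiv ℂ Z q (1, 0) = 0
          · simpa [ha, hb] using isPreconnected_empty
          · simpa [ha, hb] using isPreconnected_univ
        · have : {p : ℂ | fderiv ℂ Z q (1, 0) + p * fderiv ℂ Z q (0, 1) ≠ 0} =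
              {-(fderiv ℂ Z q (1, 0)) / fderiv ℂ Z q (0, 1)}ᶜ := by
            ext p
            simp only [mem_ofPred_eq, mem_compl_iff, mem_singleton_iff, ne_eq, not_iff_not]
            rw [eq_div_iff hb, eq_neg_iff_add_eq_zero, add_comm]
          rw [this]
          exact (isConnected_compl_singleton_of_one_lt_rank (by simp) _).isPreconnected
      have hd : ∀ p ∈ P, HasFDerivAt (fun p => newRhs Φ w (q, p)) (0 : ℂ →L[ℝ] ℂ) p := by
        intro p hp
        have h1 := (hNd (q, p) hp).hasFDerivAt.comp p
          ((hasFDerivAt_const q p).prodMk (hasFDerivAt_id p))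
        refine h1.congr_fderiv ?_
        exact ContinuousLinearMap.ext fun c => by simp [(hlin q p hp).1]
      exact hPo.is_const_of_fderiv_eq_zero hPc
        (fun p hp => (hd p hp).differentiableAt.differentiableWithinAt)
        (fun p hp => (hd p hp).fderiv) hy (hmem₀ q hqs)
    rw [hp]
    -- independence of `U`
    have hQ := (htgt _).1 (Φ.map_source hqs)
    have hd : ∀ u ∈ Metric.ball (Φ q₀).2 r, HasFDerivAt
        (fun u => newRhs Φ w (Φ.symm ((Φ q).1, u), p₀)) (0 : ℂ →L[ℝ] ℂ) u := by
      intro u hu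
      have hut : ((Φ q).1, u) ∈ Φ.target := (htgt _).2 ⟨hQ.1, hu⟩
      set q' := Φ.symm ((Φ q).1, u) with hq'
      have hqs' : q' ∈ Φ.source := Φ.map_target hut
      have hsd : HasFDerivAt Φ.symm (fderiv ℂ Φ.symm ((Φ q).1, u)) ((Φ q).1, u) :=
        ((hΦs'.contDiffAt (Φ.open_target.mem_nhds hut)).differentiableAt (by simp)).hasFDerivAt
      -- Moving U at fixed Z is moving along X₁, since Φ carries X₁ to (0, 1).
      have hs1 : fderiv ℂ Φ.symm ((Φ q).1, u) (0, 1) = X₁ q' := by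
        have hc : HasFDerivAt (Φ.symm ∘ Φ) ((fderiv ℂ Φ.symm ((Φ q).1, u)).comp (fderiv ℂ Φ q'))
            q' := by
          refine HasFDerivAt.comp q' ?_ (hΦd q' hqs').hasFDerivAt
          rw [hq', Φ.right_inv hut]; exact hsd
        have hid : Φ.symm ∘ Φ =ᶠ[𝓝 q'] id := by
          filter_upwards [hΦo.mem_nhds hqs'] with x hx using Φ.left_inv hx
        have := hc.unique ((hasFDerivAt_id q').congr_of_eventuallyEq hid)
        rw [← hΦX q' hqs', ← ContinuousLinearMap.comp_apply, this]; rfl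
      have h1 := (hNd (q', p₀) (hmem₀ q' hqs')).hasFDerivAt.comp u
        (((hsd.restrictScalars ℝ).comp u
          ((hasFDerivAt_const (Φ q).1 u).prodMk (hasFDerivAt_id u))).prodMk
          (hasFDerivAt_const p₀ u))
      refine h1.congr_fderiv (ContinuousLinearMap.ext fun c => ?_)
      have h2 : fderiv ℂ Φ.symm ((Φ q).1, u) (0, c) = c • X₁ q' := by
        rw [← hs1, ← map_smul]; simp
      simpa [h2] using (hlin q' p₀ (hmem₀ q' hqs')).2 c
    have := Metric.isOpen_ball.is_const_of_fderiv_eq_zero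
      (convex_ball (Φ q₀).2 r).isPreconnected
      (fun p hp => (hd p hp).differentiableAt.differentiableWithinAt)
      (fun p hp => (hd p hp).fderiv) hQ.2 hu₀
    simpa [Φ.left_inv hqs] using this

/-! ### The second-order chain rule over ℝ. -/

section SecondDerivatives

variable {E F G : Type*} [NormedAddCommGroup E] [NormedSpace ℝ E] [NormedAddCommGroup F]
  [NormedSpace ℝ F] [NormedAddCommGroup G] [NormedSpace ℝ G]

theorem hasFDerivAt_fderiv_two {f : E → F} {x : E} (hf : ContDiffAt ℝ 2 f x) :
    HasFDerivAt (fderiv ℝ f) (fderiv ℝ (fderiv ℝ f) x) x :=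
  ((hf.fderiv_right (m := 1) (by norm_num)).differentiableAt (by simp)).hasFDerivAt

theorem eventually_differentiableAt_of_two {f : E → F} {x : E} (hf : ContDiffAt ℝ 2 f x) :
    ∀ᶠ y in 𝓝 x, DifferentiableAt ℝ f y := by
  filter_upwards [hf.eventually (by simp)] with y hy using hy.differentiableAt (by simp)

theorem fderiv_fderiv_apply {f : E → F} {x : E} (hf : ContDiffAt ℝ 2 f x) (v w : E) :
    fderiv ℝ (fun y => fderiv ℝ f y w) x v = fderiv ℝ (fderiv ℝ f) x v w := by
  rw [((hasFDerivAt_fderiv_two hf).clm_apply (hasFDerivAt_const w x)).fderiv]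
  simp

/-- Second-order chain rule. -/
theorem fderiv_fderiv_comp {g : F → G} {f : E → F} {x : E} (hg : ContDiffAt ℝ 2 g (f x))
    (hf : ContDiffAt ℝ 2 f x) (v w : E) :
    fderiv ℝ (fderiv ℝ (g ∘ f)) x v w =
      fderiv ℝ (fderiv ℝ g) (f x) (fderiv ℝ f x v) (fderiv ℝ f x w)
        + fderiv ℝ g (f x) (fderiv ℝ (fderiv ℝ f) x v w) := by
  have hev : (fun y => fderiv ℝ (g ∘ f) y w) =ᶠ[𝓝 x]
      fun y => fderiv ℝ g (f y) (fderiv ℝ f y w) := by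
    filter_upwards [(eventually_differentiableAt_of_two hf),
      hf.continuousAt.eventually (eventually_differentiableAt_of_two hg)] with y h1 h2
    rw [fderiv_comp y h2 h1]; rfl
  rw [← fderiv_fderiv_apply (hg.comp x hf), hev.fderiv_eq]
  have hfd : HasFDerivAt f (fderiv ℝ f x) x := (hf.differentiableAt (by simp)).hasFDerivAt
  have h : fderiv ℝ (fun y => fderiv ℝ g (f y) (fderiv ℝ f y w)) x = _ :=
    (((hasFDerivAt_fderiv_two hg).comp x hfd).clm_apply
      ((hasFDerivAt_fderiv_two hf).clm_apply (hasFDerivAt_const w x))).fderiv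
  rw [h]
  simp [add_comm]

end SecondDerivatives

theorem fderiv_fderiv_real_eq {E F : Type*} [NormedAddCommGroup E] [NormedSpace ℂ E]
    [NormedSpace ℝ E] [IsScalarTower ℝ ℂ E] [NormedAddCommGroup F] [NormedSpace ℂ F]
    [NormedSpace ℝ F] [IsScalarTower ℝ ℂ F] {f : E → F} {S : Set E} (hS : IsOpen S)
    (hf : ContDiffOn ℂ ∞ f S) {q : E} (hq : q ∈ S) (v w : E) :
    fderiv ℝ (fderiv ℝ f) q v w = fderiv ℂ (fderiv ℂ f) q v w := by
  have hfa : ∀ x ∈ S, ContDiffAt ℂ ∞ f x := fun x hx => hf.contDiffAt (hS.mem_nhds hx)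
  have hr : ContDiffAt ℝ 2 f q :=
    ((hfa q hq).restrict_scalars ℝ).of_le ENat.LEInfty.out
  have hev : (fun y => fderiv ℝ f y w) =ᶠ[𝓝 q] fun y => fderiv ℂ f y w := by
    filter_upwards [hS.mem_nhds hq] with y hy
    exact fderiv_real_eq ((hfa y hy).differentiableAt (by simp)) w
  have hd : HasFDerivAt (fun y => fderiv ℂ f y w) _ q :=
    ((((hfa q hq).fderiv_right (m := ∞) (by simp)).differentiableAt
      (by simp)).hasFDerivAt).clm_apply (hasFDerivAt_const w q)
  rw [← fderiv_fderiv_apply hr, hev.fderiv_eq, fderiv_real_eq hd.differentiableAt, hd.fderiv]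
  simp

/-! ### Complex-linear 2-jets of C² maps and their behaviour under holomorphic coordinates. -/

section HasHolJet

variable {G : Type*} [NormedAddCommGroup G] [NormedSpace ℂ G] [NormedSpace ℝ G]

/-- The 2-jet of `v` at `z` is the one of a holomorphic map with derivatives `a` and `r`. -/
def HasHolJet (v : ℂ → G) (z : ℂ) (a r : G) : Prop :=
  ContDiffAt ℝ 2 v z ∧ (∀ c, fderiv ℝ v z c = c • a) ∧
    ∀ c d, fderiv ℝ (fderiv ℝ v) z c d = (c * d) • r

theorem HasHolJet.unique {v : ℂ → G} {z : ℂ} {a r a' r' : G} (h : HasHolJet v z a r)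
    (h' : HasHolJet v z a' r') : a = a' ∧ r = r' :=
  ⟨by simpa using (h.2.1 1).symm.trans (h'.2.1 1),
    by simpa using (h.2.2 1 1).symm.trans (h'.2.2 1 1)⟩

/-- The 2-jet of the image of a graph under a holomorphic map. -/
theorem HasHolJet.graph {Φ : ℂ × ℂ → ℂ × ℂ} {S : Set (ℂ × ℂ)} (hS : IsOpen S)
    (hΦ : ContDiffOn ℂ ∞ Φ S) {v : ℂ → ℂ} {z a r : ℂ} (hv : HasHolJet v z a r)
    (hz : (z, v z) ∈ S) :
    HasHolJet (fun z => Φ (z, v z)) z (total Φ ((z, v z), (a, r)))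
      (total₂ Φ ((z, v z), (a, r))) := by
  have hΦa : ContDiffAt ℂ ∞ Φ (z, v z) := hΦ.contDiffAt (hS.mem_nhds hz)
  have hΦr : ContDiffAt ℝ 2 Φ (z, v z) := (hΦa.restrict_scalars ℝ).of_le ENat.LEInfty.out
  have hf : ContDiffAt ℝ 2 (fun z => (z, v z)) z := contDiffAt_id.prodMk hv.1
  have hfd : ∀ y, DifferentiableAt ℝ v y → ∀ c, fderiv ℝ (fun z => (z, v z)) y c =
      (c, fderiv ℝ v y c) := by
    intro y hy c
    have : fderiv ℝ (fun z => (z, v z)) y = _ := ((hasFDerivAt_id y).prodMk hy.hasFDerivAt).fderiv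
    rw [this]; rfl
  have h1 : ∀ c, fderiv ℝ (fun z => (z, v z)) z c = c • ((1, a) : ℂ × ℂ) := by
    intro c
    rw [hfd z (hv.1.differentiableAt (by simp)), hv.2.1]; simp
  have h2 : ∀ c d, fderiv ℝ (fderiv ℝ fun z => (z, v z)) z c d = (c * d) • ((0, r) : ℂ × ℂ) := by
    intro c d
    have hev : (fun y => fderiv ℝ (fun z => (z, v z)) y d) =ᶠ[𝓝 z]
        fun y => (d, fderiv ℝ v y d) := by
      filter_upwards [(eventually_differentiableAt_of_two hv.1)] with y hy using hfd y hy d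
    rw [← fderiv_fderiv_apply hf, hev.fderiv_eq, ((hasFDerivAt_const d z).prodMk
      ((hasFDerivAt_fderiv_two hv.1).clm_apply (hasFDerivAt_const d z))).fderiv]
    simp [hv.2.2]
  refine ⟨hΦr.comp z hf, fun c => ?_, fun c d => ?_⟩
  · have : fderiv ℝ (fun z => Φ (z, v z)) z = _ :=
      fderiv_comp z (hΦr.differentiableAt (by simp)) (hf.differentiableAt (by simp))
    rw [this, ContinuousLinearMap.comp_apply, h1,
      fderiv_real_eq (hΦa.differentiableAt (by simp)), map_smul]
    rfl
  · have := fderiv_fderiv_comp (g := Φ) (f := fun z => (z, v z)) hΦr hf c d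
    refine this.trans ?_
    rw [h1, h1, h2, fderiv_fderiv_real_eq hS hΦ hz,
      fderiv_real_eq (hΦa.differentiableAt (by simp))]
    simp only [map_smul, smul_apply, total₂, smul_add, smul_smul, mul_comm]

theorem HasHolJet.fst {N : ℂ → ℂ × ℂ} {z : ℂ} {a r : ℂ × ℂ} (h : HasHolJet N z a r) :
    HasHolJet (fun z => (N z).1) z a.1 r.1 := by
  refine ⟨h.1.fst, fun c => ?_, fun c d => ?_⟩
  · have := ((h.1.differentiableAt (by simp)).hasFDerivAt.fst).fderiv
    rw [this]; simp [h.2.1]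
  · have := fderiv_fderiv_comp (g := Prod.fst) (f := N) contDiffAt_fst h.1 c d
    refine this.trans ?_
    have h0 : fderiv ℝ (fderiv ℝ (Prod.fst : ℂ × ℂ → ℂ)) (N z) = 0 := by
      have : fderiv ℝ (Prod.fst : ℂ × ℂ → ℂ) = fun _ => ContinuousLinearMap.fst ℝ ℂ ℂ :=
        funext fun _ => fderiv_fst
      rw [this]; simp
    rw [h0, fderiv_fst, h.2.2]; simp

theorem HasHolJet.snd {N : ℂ → ℂ × ℂ} {z : ℂ} {a r : ℂ × ℂ} (h : HasHolJet N z a r) :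
    HasHolJet (fun z => (N z).2) z a.2 r.2 := by
  refine ⟨h.1.snd, fun c => ?_, fun c d => ?_⟩
  · have := ((h.1.differentiableAt (by simp)).hasFDerivAt.snd).fderiv
    rw [this]; simp [h.2.1]
  · have := fderiv_fderiv_comp (g := Prod.snd) (f := N) contDiffAt_snd h.1 c d
    refine this.trans ?_
    have h0 : fderiv ℝ (fderiv ℝ (Prod.snd : ℂ × ℂ → ℂ)) (N z) = 0 := by
      have : fderiv ℝ (Prod.snd : ℂ × ℂ → ℂ) = fun _ => ContinuousLinearMap.snd ℝ ℂ ℂ :=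
        funext fun _ => fderiv_snd
      rw [this]; simp
    rw [h0, fderiv_snd, h.2.2]; simp

/-- `U` is the image of `v` near `z` under `Φ`. -/
structure Transforms (Φ : OpenPartialHomeomorph (ℂ × ℂ) (ℂ × ℂ)) (v U : ℂ → ℂ) (z : ℂ) :
    Prop where
  mem : (z, v z) ∈ Φ.source
  left : ContDiffAt ℝ 2 v z
  right : ContDiffAt ℝ 2 U (Φ (z, v z)).1
  eq : ∀ᶠ z' in 𝓝 z, (z', v z') ∈ Φ.source ∧ U (Φ (z', v z')).1 = (Φ (z', v z')).2

/-- The point z is recovered from Z as the first component of Φ⁻¹(Z, U(Z)). If DZ vanished along the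
jet, the chain rule would give the identity of z a zero derivative. -/
theorem Transforms.total_ne_zero {Φ : OpenPartialHomeomorph (ℂ × ℂ) (ℂ × ℂ)} {v U : ℂ → ℂ} {z : ℂ}
    (h : Transforms Φ v U z) (hΦ : ContDiffOn ℂ ∞ Φ Φ.source)
    (hΦ' : ContDiffOn ℂ ∞ Φ.symm Φ.target) {a r : ℂ} (hv : HasHolJet v z a r) :
    (total Φ ((z, v z), (a, r))).1 ≠ 0 := by
  intro h0
  have hπ := (hv.graph Φ.open_source hΦ h.mem).fst
  rw [h0] at hπ
  have hπd : HasFDerivAt (fun z => (Φ (z, v z)).1) (0 : ℂ →L[ℝ] ℂ) z := by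
    have := (hπ.1.differentiableAt (by simp)).hasFDerivAt
    rwa [show fderiv ℝ (fun z => (Φ (z, v z)).1) z = 0 from
      ContinuousLinearMap.ext fun c => by simp [hπ.2.1]] at this
  have hev : ∀ᶠ z' in 𝓝 z, Φ.symm ((Φ (z', v z')).1, U (Φ (z', v z')).1) = (z', v z') := by
    filter_upwards [h.eq] with z' hz'
    rw [hz'.2]
    exact Φ.left_inv hz'.1
  have hmem : ((Φ (z, v z)).1, U (Φ (z, v z)).1) ∈ Φ.target := by
    rw [h.eq.self_of_nhds.2]
    exact Φ.map_source h.mem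
  have hs : DifferentiableAt ℝ Φ.symm ((Φ (z, v z)).1, U (Φ (z, v z)).1) :=
    ((hΦ'.contDiffAt (Φ.open_target.mem_nhds hmem)).differentiableAt (by simp)).restrictScalars ℝ
  have hUd := h.right.differentiableAt (by simp)
  have hcomp : HasFDerivAt (fun z => (Φ.symm ((Φ (z, v z)).1, U (Φ (z, v z)).1)).1) _ z :=
    (hs.hasFDerivAt.comp z (hπd.prodMk (hUd.hasFDerivAt.comp z hπd))).fst
  have hid : (fun z => (Φ.symm ((Φ (z, v z)).1, U (Φ (z, v z)).1)).1) =ᶠ[𝓝 z] id := by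
    filter_upwards [hev] with z' hz'
    rw [hz']; rfl
  have := hcomp.unique ((hasFDerivAt_id z).congr_of_eventuallyEq hid)
  have := congrArg (fun L : ℂ →L[ℝ] ℂ => L 1) this
  simp [Prod.mk_zero_zero] at this

/-- Holomorphic 2-jets are mapped to holomorphic 2-jets. -/
theorem Transforms.hasHolJet {Φ : OpenPartialHomeomorph (ℂ × ℂ) (ℂ × ℂ)} {v U : ℂ → ℂ} {z : ℂ}
    (h : Transforms Φ v U z) (hΦ : ContDiffOn ℂ ∞ Φ Φ.source)
    (hΦ' : ContDiffOn ℂ ∞ Φ.symm Φ.target) {a r : ℂ} (hv : HasHolJet v z a r) :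
    HasHolJet U (Φ (z, v z)).1
      ((total Φ ((z, v z), (a, r))).2 / (total Φ ((z, v z), (a, r))).1)
      (newSecond Φ ((z, v z), (a, r))) := by
  have hT0 := h.total_ne_zero hΦ hΦ' hv
  have hπ := (hv.graph Φ.open_source hΦ h.mem).fst
  have hσ := (hv.graph Φ.open_source hΦ h.mem).snd
  have hev : (U ∘ fun z => (Φ (z, v z)).1) =ᶠ[𝓝 z] fun z => (Φ (z, v z)).2 := by
    filter_upwards [h.eq] with z' hz' using hz'.2
  simp only [newSecond]
  set T := total Φ ((z, v z), (a, r))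
  set T' := total₂ Φ ((z, v z), (a, r))
  have h1 : ∀ c, fderiv ℝ U (Φ (z, v z)).1 (c * T.1) = c * T.2 := by
    intro c
    have := fderiv_comp z (h.right.differentiableAt (by simp)) (hπ.1.differentiableAt (by simp))
    rw [hev.fderiv_eq] at this
    have := congrArg (fun L : ℂ →L[ℝ] ℂ => L c) this
    simp only [ContinuousLinearMap.comp_apply, hσ.2.1, hπ.2.1, smul_eq_mul] at this
    exact this.symm
  have h1' : ∀ c, fderiv ℝ U (Φ (z, v z)).1 c = c • (T.2 / T.1) := by
    intro c
    have := h1 (c / T.1)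
    rw [div_mul_cancel₀ _ hT0] at this
    rw [this, smul_eq_mul]; ring
  refine ⟨h.right, h1', fun c d => ?_⟩
  -- Dividing the directions by DZ solves the second-order chain rule for the second derivative of
  -- U.
  have := fderiv_fderiv_comp (g := U) (f := fun z => (Φ (z, v z)).1) h.right hπ.1
    (c / T.1) (d / T.1)
  rw [hev.fderiv.fderiv_eq, hσ.2.2, hπ.2.1, hπ.2.1, hπ.2.2, h1'] at this
  simp only [smul_eq_mul, div_mul_cancel₀ _ hT0] at this
  rw [← sub_eq_iff_eq_add] at this
  rw [← this, smul_eq_mul]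
  field_simp

/-- `Transforms` only follows the graph of v into that of U; the extra hypothesis says that near the
image point the graph of U comes back into that of v. -/
theorem Transforms.symm {Φ : OpenPartialHomeomorph (ℂ × ℂ) (ℂ × ℂ)} {v U : ℂ → ℂ} {z : ℂ}
    (h : Transforms Φ v U z)
    (hinv : ∀ᶠ ζ in 𝓝 (Φ (z, v z)).1, (ζ, U ζ) ∈ Φ.target ∧
      v (Φ.symm (ζ, U ζ)).1 = (Φ.symm (ζ, U ζ)).2) :
    Transforms Φ.symm U v (Φ (z, v z)).1 ∧
      (Φ.symm ((Φ (z, v z)).1, U (Φ (z, v z)).1)).1 = z := by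
  have h1 : Φ.symm ((Φ (z, v z)).1, U (Φ (z, v z)).1) = (z, v z) := by
    rw [h.eq.self_of_nhds.2]; exact Φ.left_inv h.mem
  exact ⟨⟨hinv.self_of_nhds.1, h.right, by rw [h1]; exact h.left, hinv⟩, by rw [h1]⟩

/-- As a function of r, `newSecond` is affine with slope the Jacobian determinant of Φ, taken in the
basis (1, a), (0, 1), divided by (DZ)³. -/
theorem newSecond_injective {Φ : ℂ × ℂ → ℂ × ℂ} {q : ℂ × ℂ} {a r r' : ℂ}
    (hinj : ∀ v, fderiv ℂ Φ q v = 0 → v = 0) (h0 : (total Φ (q, (a, r))).1 ≠ 0)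
    (h : newSecond Φ (q, (a, r)) = newSecond Φ (q, (a, r'))) : r = r' := by
  have h0' : (fderiv ℂ Φ q (1, a)).1 ≠ 0 := h0
  have hr : ∀ r, fderiv ℂ Φ q (0, r) = r • fderiv ℂ Φ q (0, 1) := by
    intro r; rw [← map_smul]; simp
  simp only [newSecond, total, total₂] at h
  rw [div_left_inj' (pow_ne_zero 3 h0'), hr r, hr r'] at h
  simp only [Prod.fst_add, Prod.snd_add, Prod.smul_fst, Prod.smul_snd, smul_eq_mul] at h
  have h1 : (r - r') * ((fderiv ℂ Φ q (0, 1)).2 * (fderiv ℂ Φ q (1, a)).1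
      - (fderiv ℂ Φ q (1, a)).2 * (fderiv ℂ Φ q (0, 1)).1) = 0 := by linear_combination h
  rcases mul_eq_zero.1 h1 with h2 | h2
  · exact sub_eq_zero.1 h2
  · exfalso
    have := hinj ((fderiv ℂ Φ q (1, a)).1 • ((0, 1) : ℂ × ℂ)
      - (fderiv ℂ Φ q (0, 1)).1 • ((1, a) : ℂ × ℂ)) (by
        rw [map_sub, map_smul, map_smul]
        ext
        · simp; ring
        · simp; linear_combination h2)
    have e1 := congrArg Prod.fst this
    have e2 := congrArg Prod.snd this
    simp at e1 e2
    rw [e1] at e2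
    simp at e2
    exact h0' e2

/-- A point transformation maps the equation with right-hand side `w` to the one with right-hand
side `W`. -/
theorem Transforms.equation_iff {Φ : OpenPartialHomeomorph (ℂ × ℂ) (ℂ × ℂ)} {v U : ℂ → ℂ} {z : ℂ}
    (h : Transforms Φ v U z) (hΦ : ContDiffOn ℂ ∞ Φ Φ.source)
    (hΦ' : ContDiffOn ℂ ∞ Φ.symm Φ.target)
    (hinv : ∀ᶠ ζ in 𝓝 (Φ (z, v z)).1, (ζ, U ζ) ∈ Φ.target ∧
      v (Φ.symm (ζ, U ζ)).1 = (Φ.symm (ζ, U ζ)).2)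
    {w : (ℂ × ℂ) × ℂ → ℂ} {W : ℂ → ℂ}
    (hW : ∀ q p, (q, p) ∈ transversal Φ Φ.source → newRhs Φ w (q, p) = W (Φ q).1) :
    (∃ a, HasHolJet v z a (w ((z, v z), a))) ↔
      ∃ P, HasHolJet U (Φ (z, v z)).1 P (W (Φ (z, v z)).1) := by
  constructor
  · rintro ⟨a, ha⟩
    have h1 := h.hasHolJet hΦ hΦ' ha
    refine ⟨(total Φ ((z, v z), (a, w ((z, v z), a)))).2
        / (total Φ ((z, v z), (a, w ((z, v z), a)))).1, ?_⟩
    have h0 := h.total_ne_zero hΦ hΦ' ha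
    rw [← hW (z, v z) a ⟨h.mem, h0⟩]
    exact h1
  -- Conversely, Φ⁻¹ first shows that the jet of v is complex-linear with some second derivative r;
  -- comparing `newSecond` at r and at the value of w then identifies r.
  · rintro ⟨P, hP⟩
    obtain ⟨h2, h3⟩ := h.symm hinv
    have h4 := h2.hasHolJet hΦ' (by simpa using hΦ) hP
    rw [h3] at h4
    obtain ⟨a, r, hv⟩ : ∃ a r, HasHolJet v z a r := ⟨_, _, h4⟩
    have h0 := h.total_ne_zero hΦ hΦ' hv
    have h5 := ((h.hasHolJet hΦ hΦ' hv).unique hP).2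
    rw [← hW (z, v z) a ⟨h.mem, h0⟩] at h5
    refine ⟨a, ?_⟩
    rwa [← newSecond_injective (q := (z, v z)) ?_ h0 h5]
    intro x hx
    have hd : HasFDerivAt Φ (fderiv ℂ Φ (z, v z)) (z, v z) :=
      ((hΦ.contDiffAt (Φ.open_source.mem_nhds h.mem)).differentiableAt (by simp)).hasFDerivAt
    have hs : HasFDerivAt Φ.symm (fderiv ℂ Φ.symm (Φ (z, v z))) (Φ (z, v z)) :=
      ((hΦ'.contDiffAt (Φ.open_target.mem_nhds (Φ.map_source h.mem))).differentiableAt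
        (by simp)).hasFDerivAt
    have hid : Φ.symm ∘ Φ =ᶠ[𝓝 (z, v z)] id := by
      filter_upwards [Φ.open_source.mem_nhds h.mem] with x hx using Φ.left_inv hx
    have := (hs.comp _ hd).unique ((hasFDerivAt_id _).congr_of_eventuallyEq hid)
    have := congrArg (fun L : ℂ × ℂ →L[ℂ] ℂ × ℂ => L x) this
    simpa [hx] using this.symm

end HasHolJet

/-! ### Passage between the real planes and ℂ: jets, solutions and transformations. -/

section Conjugation

variable {E E' F F' : Type*} [NormedAddCommGroup E] [NormedSpace ℝ E] [NormedAddCommGroup F]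
  [NormedSpace ℝ F] [NormedAddCommGroup E'] [NormedSpace ℝ E'] [NormedAddCommGroup F']
  [NormedSpace ℝ F']

/-- The map `f` read in other linear coordinates. -/
def conjugate (A : E ≃L[ℝ] E') (B : F ≃L[ℝ] F') (f : E → F) : E' → F' :=
  fun z => B (f (A.symm z))

theorem fderiv_conjugate (A : E ≃L[ℝ] E') (B : F ≃L[ℝ] F') (f : E → F) (z v : E') :
    fderiv ℝ (conjugate A B f) z v = B (fderiv ℝ f (A.symm z) (A.symm v)) := by
  have h1 : fderiv ℝ (conjugate A B f) z = _ :=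
    B.comp_fderiv (f := fun z => f (A.symm z)) (x := z)
  have h2 : fderiv ℝ (fun z => f (A.symm z)) z = _ := A.symm.comp_right_fderiv (f := f) (x := z)
  rw [h1, h2]; rfl

theorem contDiffAt_conjugate (A : E ≃L[ℝ] E') (B : F ≃L[ℝ] F') {f : E → F} {z : E'}
    {n : WithTop ℕ∞} (hf : ContDiffAt ℝ n f (A.symm z)) : ContDiffAt ℝ n (conjugate A B f) z :=
  B.contDiff.contDiffAt.comp z (hf.comp z A.symm.contDiff.contDiffAt)

theorem contDiffOn_conjugate (A : E ≃L[ℝ] E') (B : F ≃L[ℝ] F') {f : E → F} {S : Set E}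
    {n : WithTop ℕ∞} (hf : ContDiffOn ℝ n f S) :
    ContDiffOn ℝ n (conjugate A B f) (A.symm ⁻¹' S) :=
  B.contDiff.comp_contDiffOn (hf.comp A.symm.contDiff.contDiffOn (mapsTo_preimage _ _))

theorem fderiv_fderiv_conjugate (A : E ≃L[ℝ] E') (B : F ≃L[ℝ] F') {f : E → F} {z : E'}
    (hf : ContDiffAt ℝ 2 f (A.symm z)) (v w : E') :
    fderiv ℝ (fderiv ℝ (conjugate A B f)) z v w =
      B (fderiv ℝ (fderiv ℝ f) (A.symm z) (A.symm v) (A.symm w)) := by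
  rw [← fderiv_fderiv_apply (contDiffAt_conjugate A B hf), ← fderiv_fderiv_apply hf,
    ← fderiv_conjugate A B (fun q => fderiv ℝ f q (A.symm w))]
  congr 2
  funext z
  exact fderiv_conjugate A B f z w

end Conjugation

/-- The plane as the complex line. -/
def toC : Plane ≃L[ℝ] ℂ := Complex.equivRealProdCLM.symm

@[simp] theorem toC_re (p : Plane) : (toC p).re = p.1 := rfl
@[simp] theorem toC_im (p : Plane) : (toC p).im = p.2 := rfl
@[simp] theorem toC_symm_fst (z : ℂ) : (toC.symm z).1 = z.re := rfl
@[simp] theorem toC_symm_snd (z : ℂ) : (toC.symm z).2 = z.im := rfl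

theorem toC_symm_one : toC.symm 1 = (1, 0) := rfl
theorem toC_symm_I : toC.symm Complex.I = (0, 1) := rfl

/-- The space of independent and dependent variables as `ℂ²`. -/
def toC₂ : PointSpace ≃L[ℝ] ℂ × ℂ := toC.prodCongr toC

@[simp] theorem toC₂_fst (q : PointSpace) : (toC₂ q).1 = toC q.1 := rfl
@[simp] theorem toC₂_snd (q : PointSpace) : (toC₂ q).2 = toC q.2 := rfl
@[simp] theorem toC₂_symm_fst (q : ℂ × ℂ) : (toC₂.symm q).1 = toC.symm q.1 := rfl
@[simp] theorem toC₂_symm_snd (q : ℂ × ℂ) : (toC₂.symm q).2 = toC.symm q.2 := rfl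
theorem toC₂_mk (p p' : Plane) : toC₂ (p, p') = (toC p, toC p') := rfl
/-- The right-hand side `w₁ + i w₂` as a function of `((z, u), u_z)`. -/
def complexRhs (w₁ w₂ : PointSpace × (ℝ × ℝ) → ℝ) (y : (ℂ × ℂ) × ℂ) : ℂ :=
  toC (w₁ (toC₂.symm y.1, toC.symm y.2), w₂ (toC₂.symm y.1, toC.symm y.2))

theorem cauchyRiemann_eq_zero_iff (J : Jet) :
    cauchyRiemann J = 0 ↔ toC J.uy = Complex.I * toC J.ux := by
  simp only [cauchyRiemann, Prod.mk_eq_zero, Complex.ext_iff, Complex.mul_re, Complex.mul_im,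
    Complex.I_re, Complex.I_im, toC_re, toC_im]
  constructor <;> rintro ⟨h1, h2⟩ <;> constructor <;> linarith

/-- The derived Cauchy–Riemann equations give f_xx = g_xy = −f_yy and g_xx = −f_xy = −g_yy, so the
left-hand sides are 4f_xx and 4g_xx; the factors 4 cancel. The Cauchy–Riemann equations themselves
give (h, l) = u_x. -/
theorem onSystem_iff (w₁ w₂ : PointSpace × (ℝ × ℝ) → ℝ) (J : Jet) :
    OnSystem w₁ w₂ J ↔ toC J.uy = Complex.I * toC J.ux ∧ toC J.uxy = Complex.I * toC J.uxx ∧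
      toC J.uyy = -toC J.uxx ∧ toC J.uxx = complexRhs w₁ w₂ (toC₂ J.pt, toC J.ux) := by
  rw [OnSystem, cauchyRiemann_eq_zero_iff]
  have key : cauchyRiemann J = 0 → (J.h, J.l) = J.ux := by
    intro h
    simp only [cauchyRiemann, Prod.mk_eq_zero] at h
    ext
    · simp only [Jet.h]; linarith [h.1]
    · simp only [Jet.l]; linarith [h.2]
  rw [cauchyRiemann_eq_zero_iff] at key
  constructor
  · rintro ⟨h1, h2, h3, h4⟩
    refine ⟨h2, ?_⟩
    simp only [secondOrder, key h2, Prod.mk_eq_zero] at h1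
    simp only [cauchyRiemannX, cauchyRiemannY, Prod.mk_eq_zero] at h3 h4
    simp only [complexRhs, ContinuousLinearEquiv.symm_apply_apply, Complex.ext_iff, Complex.mul_re,
      Complex.mul_im, Complex.I_re, Complex.I_im, toC_re, toC_im, Complex.neg_re, Complex.neg_im]
    refine ⟨⟨?_, ?_⟩, ⟨?_, ?_⟩, ?_, ?_⟩ <;> linarith [h1.1, h1.2, h3.1, h3.2, h4.1, h4.2]
  · rintro ⟨h2, h3, h4, h1⟩
    simp only [complexRhs, ContinuousLinearEquiv.symm_apply_apply, Complex.ext_iff, Complex.mul_re,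
      Complex.mul_im, Complex.I_re, Complex.I_im, toC_re, toC_im, Complex.neg_re,
      Complex.neg_im] at h1 h3 h4
    refine ⟨?_, h2, ?_, ?_⟩
    · simp only [secondOrder, key h2, Prod.mk_eq_zero]
      constructor <;> linarith [h1.1, h1.2, h3.1, h3.2, h4.1, h4.2]
    · simp only [cauchyRiemannX, Prod.mk_eq_zero]
      constructor <;> linarith [h1.1, h1.2, h3.1, h3.2, h4.1, h4.2]
    · simp only [cauchyRiemannY, Prod.mk_eq_zero]
      constructor <;> linarith [h1.1, h1.2, h3.1, h3.2, h4.1, h4.2]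

theorem jetOf_eq {u : Plane → Plane} {p : Plane} (hu : ContDiffAt ℝ 2 u p) :
    jetOf u p = ((p, u p), (fderiv ℝ u p (1, 0), fderiv ℝ u p (0, 1)),
      (fderiv ℝ (fderiv ℝ u) p (1, 0) (1, 0), fderiv ℝ (fderiv ℝ u) p (0, 1) (1, 0),
        fderiv ℝ (fderiv ℝ u) p (0, 1) (0, 1))) := by
  simp only [jetOf, fderiv_fderiv_apply hu]

/-- The first-order and derived Cauchy–Riemann equations at p say precisely that the first two real
derivatives there are complex linear and bilinear. The map u need not be holomorphic near p. -/
theorem onSystem_jetOf_iff (w₁ w₂ : PointSpace × (ℝ × ℝ) → ℝ) {u : Plane → Plane} {p : Plane}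
    (hu : ContDiffAt ℝ 2 u p) :
    OnSystem w₁ w₂ (jetOf u p) ↔ ∃ a, HasHolJet (conjugate toC toC u) (toC p) a
      (complexRhs w₁ w₂ ((toC p, conjugate toC toC u (toC p)), a)) := by
  rw [onSystem_iff, jetOf_eq hu]
  have hu' : ContDiffAt ℝ 2 u (toC.symm (toC p)) := by simpa using hu
  have e0 : conjugate toC toC u (toC p) = toC (u p) := by simp [conjugate]
  have e1 : ∀ c, fderiv ℝ (conjugate toC toC u) (toC p) c = toC (fderiv ℝ u p (toC.symm c)) := by
    intro c; rw [fderiv_conjugate]; simp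
  have e2 : ∀ c d, fderiv ℝ (fderiv ℝ (conjugate toC toC u)) (toC p) c d =
      toC (fderiv ℝ (fderiv ℝ u) p (toC.symm c) (toC.symm d)) := by
    intro c d; rw [fderiv_fderiv_conjugate _ _ hu']; simp
  have sym : ∀ v w, fderiv ℝ (fderiv ℝ u) p v w = fderiv ℝ (fderiv ℝ u) p w v :=
    (hu.isSymmSndFDerivAt (by simp)).eq
  simp only [Jet.pt, Jet.ux, Jet.uy, Jet.uxx, Jet.uxy, Jet.uyy, e0, toC₂_mk]
  constructor
  · rintro ⟨h1, h2, h3, h4⟩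
    refine ⟨toC (fderiv ℝ u p (1, 0)), contDiffAt_conjugate _ _ hu', fun c => ?_, fun c d => ?_⟩
    · have hc : toC.symm c = c.re • (1, 0) + c.im • (0, 1) := by ext <;> simp
      rw [e1, hc, map_add, map_smul, map_smul, map_add, map_smul, map_smul, h1]
      apply Complex.ext <;> simp <;> ring
    · have hc : toC.symm c = c.re • (1, 0) + c.im • (0, 1) := by ext <;> simp
      have hd : toC.symm d = d.re • (1, 0) + d.im • (0, 1) := by ext <;> simp
      rw [← h4, e2, hc, hd]
      simp only [map_add, map_smul, add_apply, smul_apply]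
      rw [sym (1, 0) (0, 1), h2, h3]
      apply Complex.ext <;> simp <;> ring
  · rintro ⟨a, -, h1, h2⟩
    have ha : toC (fderiv ℝ u p (1, 0)) = a := by rw [← toC_symm_one, ← e1, h1]; simp
    refine ⟨?_, ?_, ?_, ?_⟩
    · rw [ha, ← toC_symm_I, ← e1, h1]; rfl
    · rw [← toC_symm_I, ← toC_symm_one, ← e2, ← e2, h2, h2]; simp
    · rw [← toC_symm_I, ← toC_symm_one, ← e2, ← e2, h2, h2]; simp
    · rw [ha, ← toC_symm_one, ← e2, h2]; simp

/-- On an open set the Cauchy–Riemann equations may be differentiated, so the derived equations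
demanded by `OnSystem` come for free. -/
theorem isSolution_iff {w₁ w₂ : PointSpace × (ℝ × ℝ) → ℝ} {V : Set Plane} (hV : IsOpen V)
    {u : Plane → Plane} (hu : ContDiffOn ℝ 2 u V) :
    IsSolution w₁ w₂ V u ↔ ∀ p ∈ V, OnSystem w₁ w₂ (jetOf u p) := by
  constructor
  · rintro ⟨-, h⟩ p hp
    have hup : ContDiffAt ℝ 2 u p := hu.contDiffAt (hV.mem_nhds hp)
    refine ⟨(h p hp).1, (h p hp).2, ?_⟩
    have sym : ∀ v w, fderiv ℝ (fderiv ℝ u) p v w = fderiv ℝ (fderiv ℝ u) p w v :=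
      (hup.isSymmSndFDerivAt (by simp)).eq
    have hcr : (fun p' => (fderiv ℝ u p' (0, 1))) =ᶠ[𝓝 p]
        fun p' => (-(fderiv ℝ u p' (1, 0)).2, (fderiv ℝ u p' (1, 0)).1) := by
      filter_upwards [hV.mem_nhds hp] with p' hp'
      have := (h p' hp').2
      simp only [cauchyRiemann, jetOf, Prod.mk_eq_zero] at this
      ext
      · simp only; linarith [this.2]
      · simp only; linarith [this.1]
    have hd : HasFDerivAt (fun p' => fderiv ℝ u p' (1, 0)) _ p :=
      (hasFDerivAt_fderiv_two hup).clm_apply (hasFDerivAt_const ((1, 0) : Plane) p)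
    have hB : ∀ v, fderiv ℝ (fderiv ℝ u) p v (0, 1) =
        (-(fderiv ℝ (fderiv ℝ u) p v (1, 0)).2, (fderiv ℝ (fderiv ℝ u) p v (1, 0)).1) := by
      intro v
      rw [← fderiv_fderiv_apply hup, hcr.fderiv_eq, (hd.snd.fun_neg.prodMk hd.fst).fderiv]
      simp
    have hB1 := hB (1, 0)
    have hB2 := hB (0, 1)
    rw [sym (1, 0) (0, 1)] at hB1
    rw [jetOf_eq hup]
    simp only [cauchyRiemannX, cauchyRiemannY, Prod.mk_eq_zero, hB1, hB2]
    simp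
  · exact fun h => ⟨hu, fun p hp => ⟨(h p hp).1, (h p hp).2.1⟩⟩

/-- A point transformation of `ℂ²` as one of the real point space. -/
def realify (Φ : OpenPartialHomeomorph (ℂ × ℂ) (ℂ × ℂ)) :
    OpenPartialHomeomorph PointSpace PointSpace :=
  (toC₂.toHomeomorph.transOpenPartialHomeomorph Φ).transHomeomorph toC₂.symm.toHomeomorph

theorem realify_apply (Φ : OpenPartialHomeomorph (ℂ × ℂ) (ℂ × ℂ)) (q : PointSpace) :
    realify Φ q = toC₂.symm (Φ (toC₂ q)) := rfl

theorem realify_source (Φ : OpenPartialHomeomorph (ℂ × ℂ) (ℂ × ℂ)) :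
    (realify Φ).source = toC₂ ⁻¹' Φ.source := rfl

theorem CarriesMap.mapsTo {Φ : OpenPartialHomeomorph PointSpace PointSpace} {V V' : Set Plane}
    {u U : Plane → Plane} (h : CarriesMap Φ V u V' U) {p : Plane} (hp : p ∈ V) :
    (p, u p) ∈ Φ.source ∧ (Φ (p, u p)).1 ∈ V' ∧ U (Φ (p, u p)).1 = (Φ (p, u p)).2 := by
  obtain ⟨-, -, -, -, hs, he⟩ := h
  have hm : (p, u p) ∈ graphOver u V := ⟨p, hp, rfl⟩
  have : Φ (p, u p) ∈ graphOver U V' := he ▸ mem_image_of_mem Φ hm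
  obtain ⟨P, hP, hPe⟩ := this
  rw [← hPe]
  exact ⟨hs hm, hP, rfl⟩

theorem CarriesMap.surjOn {Φ : OpenPartialHomeomorph PointSpace PointSpace} {V V' : Set Plane}
    {u U : Plane → Plane} (h : CarriesMap Φ V u V' U) {P : Plane} (hP : P ∈ V') :
    ∃ p ∈ V, Φ (p, u p) = (P, U P) := by
  obtain ⟨-, -, -, -, hs, he⟩ := h
  have : (P, U P) ∈ Φ '' graphOver u V := he ▸ ⟨P, hP, rfl⟩
  obtain ⟨_, ⟨p, hp, rfl⟩, h⟩ := this
  exact ⟨p, hp, h⟩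

/-- Every point of V' lies under the image of a point of the first graph, so the jetwise equivalence
already contains the one for solutions. -/
theorem reduces_of_onSystem_iff {Φ : OpenPartialHomeomorph PointSpace PointSpace}
    {w₁ w₂ w₁' w₂' : PointSpace × (ℝ × ℝ) → ℝ}
    (h : ∀ V u V' U, CarriesMap Φ V u V' U →
      ∀ p ∈ V, OnSystem w₁ w₂ (jetOf u p) ↔ OnSystem w₁' w₂' (jetOf U (Φ (p, u p)).1)) :
    Reduces Φ w₁ w₂ w₁' w₂' := by
  intro V u V' U hc
  refine ⟨h V u V' U hc, ?_⟩
  rw [isSolution_iff hc.1 hc.2.2.1, isSolution_iff hc.2.1 hc.2.2.2.1]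
  constructor
  · intro hu P hP
    obtain ⟨p, hp, he⟩ := hc.surjOn hP
    have := (h V u V' U hc p hp).1 (hu p hp)
    rwa [he] at this
  · intro hU p hp
    exact (h V u V' U hc p hp).2 (hU _ (hc.mapsTo hp).2.1)

theorem reduces_realify {Φ : OpenPartialHomeomorph (ℂ × ℂ) (ℂ × ℂ)}
    (hΦ : ContDiffOn ℂ ∞ Φ Φ.source) (hΦ' : ContDiffOn ℂ ∞ Φ.symm Φ.target)
    {w₁ w₂ : PointSpace × (ℝ × ℝ) → ℝ} {W : ℂ → ℂ}
    (hW : ∀ q p, (q, p) ∈ transversal Φ Φ.source →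
      newRhs Φ (complexRhs w₁ w₂) (q, p) = W (Φ q).1) :
    Reduces (realify Φ) w₁ w₂ (fun a => (W (toC a.1.1)).re) (fun a => (W (toC a.1.1)).im) := by
  refine reduces_of_onSystem_iff fun V u V' U hc p hp => ?_
  obtain ⟨hm, hm', he⟩ := hc.mapsTo hp
  have hu : ∀ p ∈ V, ContDiffAt ℝ 2 u p := fun p hp => hc.2.2.1.contDiffAt (hc.1.mem_nhds hp)
  have hU : ∀ p ∈ V', ContDiffAt ℝ 2 U p := fun p hp =>
    hc.2.2.2.1.contDiffAt (hc.2.1.mem_nhds hp)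
  rw [onSystem_jetOf_iff _ _ (hu p hp), onSystem_jetOf_iff _ _ (hU _ hm')]
  have hgr : ∀ z, toC.symm z ∈ V → ((z, conjugate toC toC u z) ∈ Φ.source ∧
      toC.symm (Φ (z, conjugate toC toC u z)).1 ∈ V' ∧
      conjugate toC toC U (Φ (z, conjugate toC toC u z)).1 =
        (Φ (z, conjugate toC toC u z)).2) := by
    intro z hz
    obtain ⟨h1, h2, h3⟩ := hc.mapsTo hz
    have e : toC₂ (toC.symm z, u (toC.symm z)) = (z, conjugate toC toC u z) := by
      simp [toC₂_mk, conjugate]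
    rw [realify_source, mem_preimage, e] at h1
    rw [realify_apply, e] at h2 h3
    refine ⟨h1, h2, ?_⟩
    apply toC.symm.injective
    simpa [conjugate] using h3
  have hΦp : toC (realify Φ (p, u p)).1 = (Φ (toC p, conjugate toC toC u (toC p))).1 := by
    rw [realify_apply]
    change toC (toC.symm _) = _
    simp [conjugate, toC₂_mk]
  have hz : toC.symm (toC p) ∈ V := by simpa using hp
  have hT : Transforms Φ (conjugate toC toC u) (conjugate toC toC U) (toC p) := by
    refine ⟨(hgr _ hz).1, contDiffAt_conjugate _ _ (hu _ hz),
      contDiffAt_conjugate _ _ (hU _ (hgr _ hz).2.1), ?_⟩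
    filter_upwards [(hc.1.preimage toC.symm.continuous).mem_nhds hz] with z' hz'
    exact ⟨(hgr z' hz').1, (hgr z' hz').2.2⟩
  have hinv : ∀ᶠ ζ in 𝓝 (Φ (toC p, conjugate toC toC u (toC p))).1,
      (ζ, conjugate toC toC U ζ) ∈ Φ.target ∧
      conjugate toC toC u (Φ.symm (ζ, conjugate toC toC U ζ)).1 =
        (Φ.symm (ζ, conjugate toC toC U ζ)).2 := by
    filter_upwards [(hc.2.1.preimage toC.symm.continuous).mem_nhds (hgr _ hz).2.1] with ζ hζ
    obtain ⟨p', hp', he'⟩ := hc.surjOn hζ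
    have hz' : toC.symm (toC p') ∈ V := by simpa using hp'
    have hm := (hgr _ hz').1
    have e : Φ (toC p', conjugate toC toC u (toC p')) = (ζ, conjugate toC toC U ζ) := by
      rw [realify_apply, ContinuousLinearEquiv.symm_apply_eq] at he'
      simpa [conjugate, toC₂_mk] using he'
    rw [← e]
    exact ⟨Φ.map_source hm, by rw [Φ.left_inv hm]⟩
  rw [hT.equation_iff hΦ hΦ' hinv hW, hΦp]
  have hrhs : ∀ y : (ℂ × ℂ) × ℂ, complexRhs (fun a => (W (toC a.1.1)).re)
      (fun a => (W (toC a.1.1)).im) y = W y.1.1 := by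
    intro y
    have : toC (toC₂.symm y.1).1 = y.1.1 := toC.apply_symm_apply y.1.1
    simp only [complexRhs, this]
    apply Complex.ext <;> simp
  simp only [hrhs]

/-! ### Real point symmetries as holomorphic symmetries. -/

/-- The 2-jet at `q` of a holomorphic function with derivatives `a` and `r`. -/
def holToJet (q : PointSpace) (a r : ℂ) : Jet :=
  (q, (toC.symm a, toC.symm (Complex.I * a)),
    (toC.symm r, toC.symm (Complex.I * r), toC.symm (-r)))

/-- Supplies a jet of the system over every point with every slope a, so that Lie's criterion can be
tested with a free. -/
theorem onSystem_holToJet (w₁ w₂ : PointSpace × (ℝ × ℝ) → ℝ) (q : PointSpace) (a : ℂ) :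
    OnSystem w₁ w₂ (holToJet q a (complexRhs w₁ w₂ (toC₂ q, a))) := by
  rw [onSystem_iff]
  simp [holToJet, Jet.pt, Jet.ux, Jet.uy, Jet.uxx, Jet.uxy, Jet.uyy]

/-- Since u_y = i u_x, the real combination η − ξ¹u_x − ξ²u_y is the complex one η − (ξ¹ + iξ²)u_x.
-/
theorem toC_charPart (v : PointSpace) (a : ℂ) :
    toC (charPart v (toC.symm a) (toC.symm (Complex.I * a))) = (toC₂ v).2 - (toC₂ v).1 * a := by
  apply Complex.ext <;> simp [charPart] <;> ring

theorem toC₂_dx (a : ℂ) : toC₂ ((1, 0), toC.symm a) = (1, a) := by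
  rw [toC₂_mk]; simp [← toC_symm_one]

theorem toC₂_dy (a : ℂ) :
    toC₂ ((0, 1), toC.symm (Complex.I * a)) = Complex.I • ((1, a) : ℂ × ℂ) := by
  rw [toC₂_mk]; simp [← toC_symm_I]

theorem toC₂_fderiv (X : PointSpace → PointSpace) (q v : PointSpace) :
    toC₂ (fderiv ℝ X q v) = fderiv ℝ (conjugate toC₂ toC₂ X) (toC₂ q) (toC₂ v) := by
  rw [fderiv_conjugate]; simp

theorem toC₂_fderiv_fderiv {X : PointSpace → PointSpace} {q : PointSpace} (hX : ContDiffAt ℝ 2 X q)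
    (v w : PointSpace) : toC₂ (fderiv ℝ (fderiv ℝ X) q v w) =
      fderiv ℝ (fderiv ℝ (conjugate toC₂ toC₂ X)) (toC₂ q) (toC₂ v) (toC₂ w) := by
  rw [fderiv_fderiv_conjugate _ _ (by simpa using hX)]; simp

theorem fderiv_cauchyRiemann (J v : Jet) : fderiv ℝ cauchyRiemann J v = cauchyRiemann v := by
  let A : Jet →ₗ[ℝ] ℝ × ℝ :=
    { toFun := cauchyRiemann
      map_add' := fun x y => by ext <;> simp [cauchyRiemann, Jet.ux, Jet.uy] <;> ring
      map_smul' := fun c x => by ext <;> simp [cauchyRiemann, Jet.ux, Jet.uy] <;> ring }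
  exact congrArg (· v) (LinearMap.toContinuousLinearMap A).fderiv

theorem fderiv_secondOrder {w₁ w₂ : PointSpace × (ℝ × ℝ) → ℝ} {J : Jet}
    (hw₁ : DifferentiableAt ℝ w₁ (J.pt, (J.h, J.l)))
    (hw₂ : DifferentiableAt ℝ w₂ (J.pt, (J.h, J.l))) (v : Jet) :
    fderiv ℝ (secondOrder w₁ w₂) J v =
      (v.uxx.1 - v.uyy.1 + 2 * v.uxy.2 - 4 * fderiv ℝ w₁ (J.pt, (J.h, J.l)) (v.pt, (v.h, v.l)),
       v.uxx.2 - v.uyy.2 - 2 * v.uxy.1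
        - 4 * fderiv ℝ w₂ (J.pt, (J.h, J.l)) (v.pt, (v.h, v.l))) := by
  let A : Jet →ₗ[ℝ] ℝ × ℝ :=
    { toFun := fun v => (v.uxx.1 - v.uyy.1 + 2 * v.uxy.2, v.uxx.2 - v.uyy.2 - 2 * v.uxy.1)
      map_add' := fun x y => by ext <;> simp [Jet.uxx, Jet.uxy, Jet.uyy] <;> ring
      map_smul' := fun c x => by ext <;> simp [Jet.uxx, Jet.uxy, Jet.uyy] <;> ring }
  let B : Jet →ₗ[ℝ] PointSpace × (ℝ × ℝ) :=
    { toFun := fun v => (v.pt, (v.h, v.l))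
      map_add' := fun x y => by ext <;> simp [Jet.h, Jet.l, Jet.pt, Jet.ux, Jet.uy] <;> ring
      map_smul' := fun c x => by ext <;> simp [Jet.h, Jet.l, Jet.pt, Jet.ux, Jet.uy] <;> ring }
  have hA := (LinearMap.toContinuousLinearMap A).hasFDerivAt (x := J)
  have hB := (LinearMap.toContinuousLinearMap B).hasFDerivAt (x := J)
  have h1 := (HasFDerivAt.comp (g := w₁) J hw₁.hasFDerivAt hB).const_mul 4
  have h2 := (HasFDerivAt.comp (g := w₂) J hw₂.hasFDerivAt hB).const_mul 4
  have h : HasFDerivAt (secondOrder w₁ w₂) _ J :=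
    (hA.fst.fun_sub h1).prodMk (hA.snd.fun_sub h2)
  rw [h.fderiv]
  rfl

section Symmetry

variable {Ω : Set PointSpace} {w₁ w₂ : PointSpace × (ℝ × ℝ) → ℝ} {X : PointSpace → PointSpace}

theorem isOpen_toC₂_symm_preimage (hΩ : IsOpen Ω) : IsOpen (toC₂.symm ⁻¹' Ω) :=
  hΩ.preimage toC₂.symm.continuous

/-- Symmetries of the Cauchy-Riemann equations are holomorphic. -/
theorem IsSymmetry.contDiffOn_complex (hΩ : IsOpen Ω) (hX : IsSymmetry Ω w₁ w₂ X) :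
    ContDiffOn ℂ ∞ (conjugate toC₂ toC₂ X) (toC₂.symm ⁻¹' Ω) := by
  refine contDiffOn_complex_of_real (isOpen_toC₂_symm_preimage hΩ)
    (contDiffOn_conjugate _ _ hX.1) fun y hy => ?_
  set q := toC₂.symm y
  have hyq : toC₂ q = y := by simp [q]
  set L := fderiv ℝ (conjugate toC₂ toC₂ X) y with hL
  have key : ∀ a : ℂ, (L (Complex.I • ((1, a) : ℂ × ℂ))).2 - (L (Complex.I • ((1, a) : ℂ × ℂ))).1 * a
      = Complex.I * ((L (1, a)).2 - (L (1, a)).1 * a) := by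
    intro a
    have h := (hX.2 (holToJet q a (complexRhs w₁ w₂ (toC₂ q, a))) hy
      (onSystem_holToJet w₁ w₂ q a)).2
    rw [fderiv_cauchyRiemann, cauchyRiemann_eq_zero_iff] at h
    simp only [prolong, holToJet, Jet.pt, Jet.ux, Jet.uy, totalX, totalY,
      toC_charPart, toC₂_fderiv, toC₂_dx, toC₂_dy,
      hyq] at h
    exact h
  -- B measures the failure of complex linearity and is antilinear, so B(1, a) = B(1, 0) + ā B(0,
  -- 1). By `key` its second component is a times its first for every a; comparing the coefficients
  -- of 1, a, ā and aā gives B = 0, and a = 0, 1, −1, i are enough values.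
  let B : ℂ × ℂ →ₗ[ℝ] ℂ × ℂ :=
    { toFun := fun v => L (Complex.I • v) - Complex.I • L v
      map_add' := fun x y => by simp only [smul_add, map_add]; abel
      map_smul' := fun c x => by
        simp only [smul_comm Complex.I c, map_smul, RingHom.id_apply, smul_sub] }
  have hBI : ∀ v, B (Complex.I • v) = -(Complex.I • B v) := by
    intro v
    change L (Complex.I • Complex.I • v) - Complex.I • L (Complex.I • v) =
      -(Complex.I • (L (Complex.I • v) - Complex.I • L v))
    rw [smul_smul, Complex.I_mul_I, smul_sub, smul_smul, Complex.I_mul_I, neg_one_smul,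
      neg_one_smul, map_neg]
    abel
  have hB : ∀ a : ℂ, (B (1, a)).2 = (B (1, a)).1 * a := by
    intro a
    change (L _ - Complex.I • L _).2 = (L _ - Complex.I • L _).1 * a
    simp only [Prod.fst_sub, Prod.snd_sub, Prod.smul_fst, Prod.smul_snd, smul_eq_mul]
    linear_combination key a
  have hB1 : ∀ c : ℝ, B (1, (c : ℂ)) = B (1, 0) + c • B (0, 1) := by
    intro c
    rw [← map_smul, ← map_add]; simp
  have hBi : B (1, Complex.I) = B (1, 0) - Complex.I • B (0, 1) := by
    rw [sub_eq_add_neg, ← hBI, ← map_add]; simp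
  have k0 := hB 0
  have k1 := hB (1 : ℝ)
  have k2 := hB (-1 : ℝ)
  have k3 := hB Complex.I
  rw [hB1] at k1 k2
  rw [hBi] at k3
  simp at k0 k1 k2 k3
  rw [k0] at k1 k2 k3
  have b1' : (B (0, 1)).1 = 0 := by linear_combination -(k1 + k2) / 2
  rw [b1'] at k1 k2 k3
  have b2' : (B (0, 1)).2 = (B (1, 0)).1 := by linear_combination k1
  rw [b2'] at k3
  have b1 : (B (1, 0)).1 = 0 := by
    have : (2 * Complex.I) * (B (1, 0)).1 = 0 := by linear_combination -k3
    simpa using this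
  have z1 : B (1, 0) = 0 := Prod.ext b1 k0
  have z2 : B (0, 1) = 0 := Prod.ext b1' (b2'.trans b1)
  have hB0 : ∀ v, B v = 0 := by
    intro v
    have hv : v = v.1 • ((1, 0) : ℂ × ℂ) + v.2 • ((0, 1) : ℂ × ℂ) := by ext <;> simp
    rw [hv, complex_smul_eq v.1 ((1, 0) : ℂ × ℂ), complex_smul_eq v.2 ((0, 1) : ℂ × ℂ)]
    simp only [map_add, map_smul, hBI, z1, z2]
    simp
  exact fun v => sub_eq_zero.1 (hB0 v)

theorem contDiffOn_complexRhs (hw₁ : ContDiffOn ℝ ∞ w₁ (Ω ×ˢ univ))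
    (hw₂ : ContDiffOn ℝ ∞ w₂ (Ω ×ˢ univ)) :
    ContDiffOn ℝ ∞ (complexRhs w₁ w₂) ((toC₂.symm ⁻¹' Ω) ×ˢ univ) := by
  have hm : ContDiff ℝ ∞ fun y : (ℂ × ℂ) × ℂ => (toC₂.symm y.1, toC.symm y.2) :=
    (toC₂.symm.contDiff.comp contDiff_fst).prodMk (toC.symm.contDiff.comp contDiff_snd)
  have hmaps : MapsTo (fun y : (ℂ × ℂ) × ℂ => (toC₂.symm y.1, toC.symm y.2))
      ((toC₂.symm ⁻¹' Ω) ×ˢ univ) (Ω ×ˢ univ) := fun y hy => ⟨hy.1, mem_univ _⟩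
  exact toC.contDiff.comp_contDiffOn
    ((hw₁.comp hm.contDiffOn hmaps).prodMk (hw₂.comp hm.contDiffOn hmaps))

/-- At a holomorphic jet the prolongation of a holomorphic field again satisfies the Cauchy–Riemann
relations, so the two real second-order conditions are four times the real and imaginary parts of
the complex one. -/
theorem IsSymmetry.isHolSymmetry (hΩ : IsOpen Ω) (hw₁ : ContDiffOn ℝ ∞ w₁ (Ω ×ˢ univ))
    (hw₂ : ContDiffOn ℝ ∞ w₂ (Ω ×ˢ univ)) (hX : IsSymmetry Ω w₁ w₂ X) :
    IsHolSymmetry (toC₂.symm ⁻¹' Ω) (complexRhs w₁ w₂) (conjugate toC₂ toC₂ X) := by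
  have hXC := hX.contDiffOn_complex hΩ
  refine ⟨hXC, fun y hy a => ?_⟩
  have hSo := isOpen_toC₂_symm_preimage hΩ
  set q := toC₂.symm y with hq
  have hyq : toC₂ q = y := by simp [q]
  have hXq : ContDiffAt ℝ 2 X q :=
    (hX.1.contDiffAt (hΩ.mem_nhds hy)).of_le ENat.LEInfty.out
  set r := complexRhs w₁ w₂ (y, a) with hr
  set J := holToJet q a r with hJ
  have h := (hX.2 J hy (by rw [hJ, hr, ← hyq]; exact onSystem_holToJet w₁ w₂ q a)).1
  have hXCd : DifferentiableAt ℂ (conjugate toC₂ toC₂ X) y :=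
    (hXC.contDiffAt (hSo.mem_nhds hy)).differentiableAt (by simp)
  set T := total (conjugate toC₂ toC₂ X) (y, (a, r)) with hT
  set T₂ := total₂ (conjugate toC₂ toC₂ X) (y, (a, r)) with hT₂
  have tX : toC₂ (totalX X J) = T := by
    rw [totalX, toC₂_fderiv]
    change fderiv ℝ _ (toC₂ q) (toC₂ ((1, 0), toC.symm a)) = _
    rw [toC₂_dx, hyq, fderiv_real_eq hXCd]; rfl
  have tY : toC₂ (totalY X J) = Complex.I • T := by
    rw [totalY, toC₂_fderiv]
    change fderiv ℝ _ (toC₂ q) (toC₂ ((0, 1), toC.symm (Complex.I * a))) = _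
    rw [toC₂_dy, hyq, fderiv_real_eq hXCd, map_smul]; rfl
  have hlin : ∀ c : ℂ, fderiv ℝ (conjugate toC₂ toC₂ X) y (0, c * r) =
      c • fderiv ℂ (conjugate toC₂ toC₂ X) y (0, r) := by
    intro c
    rw [fderiv_real_eq hXCd, ← map_smul]; simp
  have tXX : toC₂ (totalXX X J) = T₂ := by
    rw [totalXX, map_add, toC₂_fderiv, toC₂_fderiv_fderiv (q := J.pt) hXq]
    change fderiv ℝ (fderiv ℝ (conjugate toC₂ toC₂ X)) (toC₂ q) (toC₂ ((1, 0), toC.symm a))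
        (toC₂ ((1, 0), toC.symm a))
      + fderiv ℝ _ (toC₂ q) (toC₂ (0, toC.symm r)) = _
    rw [toC₂_dx, hyq, fderiv_fderiv_real_eq hSo hXC hy, fderiv_real_eq hXCd, toC₂_mk]
    simp [hT₂, total₂]
  have tXY : toC₂ (totalXY X J) = Complex.I • T₂ := by
    rw [totalXY, map_add, toC₂_fderiv, toC₂_fderiv_fderiv (q := J.pt) hXq]
    change fderiv ℝ (fderiv ℝ (conjugate toC₂ toC₂ X)) (toC₂ q) (toC₂ ((1, 0), toC.symm a))
        (toC₂ ((0, 1), toC.symm (Complex.I * a)))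
      + fderiv ℝ _ (toC₂ q) (toC₂ (0, toC.symm (Complex.I * r))) = _
    rw [toC₂_dx, toC₂_dy, hyq, fderiv_fderiv_real_eq hSo hXC hy, toC₂_mk, map_smul, map_zero,
      ContinuousLinearEquiv.apply_symm_apply, hlin, ← smul_add]
    rfl
  have tYY : toC₂ (totalYY X J) = -T₂ := by
    rw [totalYY, map_add, toC₂_fderiv, toC₂_fderiv_fderiv (q := J.pt) hXq]
    change fderiv ℝ (fderiv ℝ (conjugate toC₂ toC₂ X)) (toC₂ q) (toC₂ ((0, 1), toC.symm (Complex.I * a)))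
        (toC₂ ((0, 1), toC.symm (Complex.I * a)))
      + fderiv ℝ _ (toC₂ q) (toC₂ (0, toC.symm (-r))) = _
    rw [toC₂_dy, hyq, fderiv_fderiv_real_eq hSo hXC hy, toC₂_mk, map_smul, map_smul, map_zero,
      ContinuousLinearEquiv.apply_symm_apply, neg_eq_neg_one_mul, hlin, smul_apply, smul_smul,
      Complex.I_mul_I, ← smul_add, neg_one_smul]
    rfl
  have cx : ∀ v : PointSpace, (v.1.1 = (toC₂ v).1.re) ∧ v.1.2 = (toC₂ v).1.im := fun v => ⟨rfl, rfl⟩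
  have jx : toC (prolong X J).ux = T.2 - T.1 * a := by
    rw [← tX]; exact toC_charPart _ _
  have jy : toC (prolong X J).uy = Complex.I * (T.2 - T.1 * a) := by
    have : toC (prolong X J).uy = _ := toC_charPart (totalY X J) a
    rw [this, tY]; simp; ring
  have jxx : toC (prolong X J).uxx = T₂.2 - T₂.1 * a - 2 * r * T.1 := by
    change toC (charPart (totalXX X J) (toC.symm a) (toC.symm (Complex.I * a))
      - (2 * (totalX X J).1.1) • toC.symm r
      - (2 * (totalX X J).1.2) • toC.symm (Complex.I * r)) = _
    rw [map_sub, map_sub, toC_charPart, tXX, map_smul, map_smul, (cx _).1, (cx _).2, tX]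
    apply Complex.ext <;> simp <;> ring
  have jxy : toC (prolong X J).uxy = Complex.I * (T₂.2 - T₂.1 * a - 2 * r * T.1) := by
    change toC (charPart (totalXY X J) (toC.symm a) (toC.symm (Complex.I * a))
      - (totalY X J).1.1 • toC.symm r - (totalY X J).1.2 • toC.symm (Complex.I * r)
      - (totalX X J).1.1 • toC.symm (Complex.I * r) - (totalX X J).1.2 • toC.symm (-r)) = _
    simp only [map_sub, toC_charPart, tXY, map_smul, (cx _).1, (cx _).2, tX, tY]
    apply Complex.ext <;> simp <;> ring
  have jyy : toC (prolong X J).uyy = -(T₂.2 - T₂.1 * a - 2 * r * T.1) := by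
    change toC (charPart (totalYY X J) (toC.symm a) (toC.symm (Complex.I * a))
      - (2 * (totalY X J).1.1) • toC.symm (Complex.I * r)
      - (2 * (totalY X J).1.2) • toC.symm (-r)) = _
    simp only [map_sub, toC_charPart, tYY, map_smul, (cx _).1, (cx _).2, tY]
    apply Complex.ext <;> simp <;> ring
  have jhl : ((prolong X J).h, (prolong X J).l) = toC.symm (T.2 - T.1 * a) := by
    have h1 := congrArg Complex.re jx
    have h2 := congrArg Complex.im jx
    have h3 := congrArg Complex.re jy
    have h4 := congrArg Complex.im jy
    rw [toC_re] at h1 h3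
    rw [toC_im] at h2 h4
    simp only [Complex.mul_re, Complex.mul_im (z := Complex.I), Complex.I_re, Complex.I_im] at h3 h4
    ext
    · rw [toC_symm_fst]; simp only [Jet.h]; rw [h1, h4]; ring
    · rw [toC_symm_snd]; simp only [Jet.l]; rw [h2, h3]; ring
  have Jhl : (J.h, J.l) = toC.symm a := by
    ext
    · simp [Jet.h, J, holToJet, Jet.ux, Jet.uy]
    · simp [Jet.l, J, holToJet, Jet.ux, Jet.uy]
  have hJpt : (J.pt, (J.h, J.l)) = (q, toC.symm a) := by rw [Jhl]; rfl
  have hΩo : IsOpen (Ω ×ˢ (univ : Set (ℝ × ℝ))) := hΩ.prod isOpen_univ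
  have hw₁d : DifferentiableAt ℝ w₁ (q, toC.symm a) :=
    (hw₁.contDiffAt (hΩo.mem_nhds (mk_mem_prod hy (mem_univ _)))).differentiableAt (by simp)
  have hw₂d : DifferentiableAt ℝ w₂ (q, toC.symm a) :=
    (hw₂.contDiffAt (hΩo.mem_nhds (mk_mem_prod hy (mem_univ _)))).differentiableAt (by simp)
  rw [fderiv_secondOrder (by rwa [hJpt]) (by rwa [hJpt]), hJpt, jhl] at h
  have hpt : (prolong X J).pt = X q := rfl
  rw [hpt] at h
  have hm : HasFDerivAt (fun y : (ℂ × ℂ) × ℂ => (toC₂.symm y.1, toC.symm y.2))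
      (((toC₂.symm : ℂ × ℂ →L[ℝ] PointSpace).comp (ContinuousLinearMap.fst ℝ (ℂ × ℂ) ℂ)).prod
        ((toC.symm : ℂ →L[ℝ] Plane).comp (ContinuousLinearMap.snd ℝ (ℂ × ℂ) ℂ))) (y, a) :=
    (toC₂.symm.hasFDerivAt.comp _ hasFDerivAt_fst).prodMk
      (toC.symm.hasFDerivAt.comp _ hasFDerivAt_snd)
  have hwC : HasFDerivAt (complexRhs w₁ w₂) _ (y, a) :=
    toC.hasFDerivAt.comp (y, a) ((hw₁d.hasFDerivAt.comp (y, a) hm).prodMk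
      (hw₂d.hasFDerivAt.comp (y, a) hm))
  have hXy : toC₂.symm (conjugate toC₂ toC₂ X y) = X q := by simp [conjugate, hq]
  have hη₁ : prolongOne (conjugate toC₂ toC₂ X) (y, (a, 0)) = T.2 - T.1 * a := by
    rw [prolongOne, mul_comm]; rfl
  have hη₂ : prolongTwo (conjugate toC₂ toC₂ X) (y, (a, r)) =
      T₂.2 - T₂.1 * a - 2 * r * T.1 := by
    rw [prolongTwo, ← hT, ← hT₂]; ring
  rw [hwC.fderiv, hη₁, hη₂]
  have h1 := congrArg Prod.fst h
  have h2 := congrArg Prod.snd h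
  have xx1 := congrArg Complex.re jxx
  have xx2 := congrArg Complex.im jxx
  have xy1 := congrArg Complex.re jxy
  have xy2 := congrArg Complex.im jxy
  have yy1 := congrArg Complex.re jyy
  have yy2 := congrArg Complex.im jyy
  set η := T₂.2 - T₂.1 * a - 2 * r * T.1
  rw [toC_re] at xx1 xy1 yy1
  rw [toC_im] at xx2 xy2 yy2
  simp only [Complex.mul_re, Complex.mul_im, Complex.neg_re, Complex.neg_im, Complex.I_re,
    Complex.I_im] at xy1 xy2 yy1 yy2
  simp only [Prod.fst_zero, Prod.snd_zero] at h1 h2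
  change toC (fderiv ℝ w₁ (q, toC.symm a)
      (toC₂.symm (conjugate toC₂ toC₂ X y), toC.symm (T.2 - T.1 * a)),
    fderiv ℝ w₂ (q, toC.symm a)
      (toC₂.symm (conjugate toC₂ toC₂ X y), toC.symm (T.2 - T.1 * a))) = η
  rw [hXy]
  apply Complex.ext
  · rw [toC_re]; simp only; linarith
  · rw [toC_im]; simp only; linarith

end Symmetry

/-! ### Density of regular points and canonical coordinates over ℂ. -/

theorem frequently_ne_zero_and {E F G : Type*} [NormedAddCommGroup E] [NormedSpace ℂ E]
    [NormedAddCommGroup F] [NormedSpace ℂ F] [CompleteSpace F]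
    [NormedAddCommGroup G] [NormedSpace ℂ G] [CompleteSpace G] {S : Set E} (hS : IsOpen S)
    (hSc : IsPreconnected S) {f : E → F} {g : E → G} (hf : DifferentiableOn ℂ f S)
    (hg : DifferentiableOn ℂ g S) (hf0 : ∃ q ∈ S, f q ≠ 0) (hg0 : ∃ q ∈ S, g q ≠ 0) :
    ∀ q ∈ S, ∃ᶠ q' in 𝓝 q, f q' ≠ 0 ∧ g q' ≠ 0 := by
  intro q hq
  rw [frequently_nhds_iff]
  intro U hqU hU
  obtain ⟨q', ⟨hq'U, hq'S⟩, hq'⟩ := (frequently_nhds_iff.1 (dense_ne_zero hS hSc hf hf0 q hq))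
    (U ∩ S) ⟨hqU, hq⟩ (hU.inter hS)
  have hO : IsOpen ((U ∩ S) ∩ f ⁻¹' {0}ᶜ) :=
    (hf.continuousOn.mono inter_subset_right).isOpen_inter_preimage (hU.inter hS)
      isOpen_compl_singleton
  obtain ⟨x, hx, hgx⟩ := (frequently_nhds_iff.1 (dense_ne_zero hS hSc hg hg0 q' hq'S))
    ((U ∩ S) ∩ f ⁻¹' {0}ᶜ) ⟨⟨hq'U, hq'S⟩, hq'⟩ hO
  exact ⟨x, hx.1.1, hx.2, hgx⟩

/-- A smooth quotient of holomorphic maps is holomorphic. -/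
theorem contDiffOn_of_smul_eq {S : Set (ℂ × ℂ)} (hS : IsOpen S) (hSc : IsPreconnected S)
    {P Q : ℂ × ℂ → ℂ × ℂ} (hP : ContDiffOn ℂ ∞ P S) (hQ : ContDiffOn ℂ ∞ Q S) {ρ : ℂ × ℂ → ℂ}
    (hρ : ContDiffOn ℝ ∞ ρ S) (h : ∀ q ∈ S, P q = ρ q • Q q) (hQ0 : ∃ q ∈ S, Q q ≠ 0) :
    ContDiffOn ℂ ∞ ρ S := by
  have hPd : ∀ q ∈ S, DifferentiableAt ℂ P q := fun q hq =>
    (hP.contDiffAt (hS.mem_nhds hq)).differentiableAt (by simp)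
  have hQd : ∀ q ∈ S, DifferentiableAt ℂ Q q := fun q hq =>
    (hQ.contDiffAt (hS.mem_nhds hq)).differentiableAt (by simp)
  have hρd : ∀ q ∈ S, DifferentiableAt ℝ ρ q := fun q hq =>
    (hρ.contDiffAt (hS.mem_nhds hq)).differentiableAt (by simp)
  refine contDiffOn_complex_of_real hS hρ fun q hq v => ?_
  -- Comparing the derivatives of P = ρQ along Iv and v leaves the antilinear part of dρ times Q. It
  -- vanishes where Q ≠ 0, and elsewhere by density and continuity of dρ.
  have hne : ∀ q ∈ S, Q q ≠ 0 →
      fderiv ℝ ρ q (Complex.I • v) - Complex.I • fderiv ℝ ρ q v = 0 := by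
    intro q hq hQq
    have hev : P =ᶠ[𝓝 q] fun q => ρ q • Q q := by
      filter_upwards [hS.mem_nhds hq] with x hx using h x hx
    have hd : ∀ w, fderiv ℂ P q w = ρ q • fderiv ℂ Q q w + fderiv ℝ ρ q w • Q q := by
      intro w
      rw [← fderiv_real_eq (hPd q hq), ← fderiv_real_eq (hQd q hq), hev.fderiv_eq,
        fderiv_fun_smul (hρd q hq) ((hQd q hq).restrictScalars ℝ)]
      rfl
    have h1 := hd (Complex.I • v)
    rw [map_smul, map_smul, hd v] at h1
    have h2 : (fderiv ℝ ρ q (Complex.I • v) - Complex.I • fderiv ℝ ρ q v) • Q q = 0 := by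
      rw [sub_smul, smul_assoc, sub_eq_zero]
      rw [smul_add, smul_comm Complex.I (ρ q)] at h1
      exact (add_left_cancel h1).symm
    exact (smul_eq_zero.1 h2).resolve_right hQq
  by_contra hcon
  have hρ' : ContinuousOn (fderiv ℝ ρ) S := hρ.continuousOn_fderiv_of_isOpen hS (by simp)
  have hc : ContinuousAt (fun q => fderiv ℝ ρ q (Complex.I • v) - Complex.I • fderiv ℝ ρ q v) q :=
    (((hρ'.clm_apply continuousOn_const).sub
      ((hρ'.clm_apply continuousOn_const).const_smul Complex.I)).continuousAt (hS.mem_nhds hq))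
  have hev := hc.eventually_ne (sub_ne_zero.2 hcon)
  obtain ⟨x, hx, hx'⟩ := ((dense_ne_zero hS hSc
    (fun q hq => (hQd q hq).differentiableWithinAt) hQ0 q hq).and_eventually
    (hev.and (hS.mem_nhds hq))).exists
  exact hx'.1 (hne x hx'.2 hx)

/-- Density of the regular points, in holomorphic terms. -/
theorem frequently_regular {S : Set (ℂ × ℂ)} (hS : IsOpen S) (hSc : IsPreconnected S)
    {X₁ X₂ : ℂ × ℂ → ℂ × ℂ} (hX₁ : ContDiffOn ℂ ∞ X₁ S) (hX₂ : ContDiffOn ℂ ∞ X₂ S)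
    (hX₂0 : ∃ q ∈ S, X₂ q ≠ 0) {σ : ℂ × ℂ → ℂ} (hσ : ContDiffOn ℂ ∞ σ S)
    (hσc : ¬ ∃ c, ∀ q ∈ S, σ q = c) (hX : ∀ q ∈ S, X₁ q = σ q • X₂ q) :
    ∀ q ∈ S, ∃ᶠ q' in 𝓝 q, X₁ q' ≠ 0 ∧ fderiv ℂ σ q' ≠ 0 := by
  have hσ' : ContDiffOn ℂ ∞ (fderiv ℂ σ) S := (contDiffOn_infty_iff_fderiv_of_isOpen hS |>.1 hσ).2
  have hσ0 : ∃ q ∈ S, σ q ≠ 0 := by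
    by_contra! h
    exact hσc ⟨0, h⟩
  have hdσ : ∃ q ∈ S, fderiv ℂ σ q ≠ 0 := by
    by_contra! h
    obtain ⟨c, hc, -⟩ := hσ0
    exact hσc ⟨σ c, fun q hq => hS.is_const_of_fderiv_eq_zero hSc
      (hσ.differentiableOn (by simp)) (fun x hx => h x hx) hq hc⟩
  refine frequently_ne_zero_and hS hSc (hX₁.differentiableOn (by simp))
    (hσ'.differentiableOn (by simp)) ?_ hdσ
  have ⟨q, hq, _⟩ := hσ0
  obtain ⟨x, ⟨hx1, hx2⟩, hxS⟩ := ((frequently_ne_zero_and hS hSc (hX₂.differentiableOn (by simp))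
    (hσ.differentiableOn (by simp)) hX₂0 hσ0 q hq).and_eventually (hS.mem_nhds hq)).exists
  exact ⟨x, hxS, by rw [hX x hxS]; exact smul_ne_zero hx2 hx1⟩

/-- Canonical coordinates for two commuting holomorphic symmetries with `X₁ = σ X₂`. -/
theorem exists_canonical_coordinates {S : Set (ℂ × ℂ)} (hS : IsOpen S) {w : (ℂ × ℂ) × ℂ → ℂ}
    (hw : ContDiffOn ℝ ∞ w (S ×ˢ univ)) {X₁ Y₁ X₂ Y₂ : ℂ × ℂ → ℂ × ℂ}
    (hX₁ : IsHolSymmetry S w X₁) (hY₁ : IsHolSymmetry S w Y₁)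
    (hX₂ : IsHolSymmetry S w X₂) (hY₂ : IsHolSymmetry S w Y₂)
    {ε : ℂ} (hε : ε.im ≠ 0)
    (hXY₁ : ∀ q ∈ S, Y₁ q = ε • X₁ q) (hXY₂ : ∀ q ∈ S, Y₂ q = ε • X₂ q)
    {σ : ℂ × ℂ → ℂ} (hσ : ContDiffOn ℂ ∞ σ S) (hX : ∀ q ∈ S, X₁ q = σ q • X₂ q)
    (hcomm : ∀ q ∈ S, fderiv ℂ X₂ q (X₁ q) = fderiv ℂ X₁ q (X₂ q)) {q₀ : ℂ × ℂ} (hq₀ : q₀ ∈ S)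
    (hX₁q : X₁ q₀ ≠ 0) (hσq : fderiv ℂ σ q₀ ≠ 0) :
    ∃ Φ : OpenPartialHomeomorph (ℂ × ℂ) (ℂ × ℂ), q₀ ∈ Φ.source ∧ Φ.source ⊆ S ∧
      ContDiffOn ℂ ∞ Φ Φ.source ∧ ContDiffOn ℂ ∞ Φ.symm Φ.target ∧
      (∀ q ∈ Φ.source, fderiv ℂ Φ q (X₁ q) = (0, 1)) ∧
      (∀ q ∈ Φ.source, fderiv ℂ Φ q (X₂ q) = (0, (Φ q).1)) ∧
      ∃ W : ℂ → ℂ, ContDiffOn ℝ ∞ W (Prod.fst '' Φ.target) ∧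
        ∀ q p, (q, p) ∈ transversal Φ Φ.source → newRhs Φ w (q, p) = W (Φ q).1 := by
  set S' : Set (ℂ × ℂ) := S ∩ X₁ ⁻¹' {0}ᶜ
  have hS' : IsOpen S' := hX₁.1.continuousOn.isOpen_inter_preimage hS isOpen_compl_singleton
  have hS'S : S' ⊆ S := inter_subset_left
  have hσ0 : ∀ q ∈ S', σ q ≠ 0 := by
    rintro q ⟨hq, hq'⟩ h
    apply hq'
    rw [hX q hq, h, zero_smul]
    rfl
  have hX₂0 : ∀ q ∈ S', X₂ q ≠ 0 := by
    rintro q ⟨hq, hq'⟩ h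
    apply hq'
    rw [hX q hq, h, smul_zero]
    rfl
  have hσd : ∀ q ∈ S, DifferentiableAt ℂ σ q := fun q hq =>
    (hσ.contDiffAt (hS.mem_nhds hq)).differentiableAt (by simp)
  have hX₂d : ∀ q ∈ S, DifferentiableAt ℂ X₂ q := fun q hq =>
    (hX₂.1.contDiffAt (hS.mem_nhds hq)).differentiableAt (by simp)
  -- With X₁ = σX₂, commutation reads (X₂σ) X₂ = 0.
  have hXσ : ∀ q ∈ S', fderiv ℂ σ q (X₂ q) = 0 := by
    intro q hq'
    have hq := hS'S hq'
    have hev : X₁ =ᶠ[𝓝 q] fun q => σ q • X₂ q := by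
      filter_upwards [hS.mem_nhds hq] with x hx using hX x hx
    have h := hcomm q hq
    rw [hev.fderiv_eq, fderiv_fun_smul (hσd q hq) (hX₂d q hq), hX q hq, map_smul] at h
    have h' : fderiv ℂ σ q (X₂ q) • X₂ q = 0 := by simpa using h
    exact (smul_eq_zero.1 h').resolve_right (hX₂0 q hq')
  have hZd : ∀ q ∈ S', fderiv ℂ (fun q => (σ q)⁻¹) q = -(σ q ^ 2)⁻¹ • fderiv ℂ σ q := fun q hq => by
    have := ((hasDerivAt_inv (hσ0 q hq)).comp_hasFDerivAt q (hσd q (hS'S hq)).hasFDerivAt).fderiv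
    exact this
  have hq₀' : q₀ ∈ S' := ⟨hq₀, hX₁q⟩
  have hsub : ∀ {X}, IsHolSymmetry S w X → IsHolSymmetry S' w X := fun h =>
    ⟨h.1.mono hS'S, fun q hq => h.2 q (hS'S hq)⟩
  -- The invariant Z is 1/σ rather than σ, because X₁ is the field to be straightened and X₂ = Z X₁.
  obtain ⟨Φ, h1, h2, h3, h4, h5, h6, h7⟩ := exists_linearizing_coordinates (S := S') hS'
    (hw.mono (prod_mono hS'S Subset.rfl)) (hsub hX₁) (hsub hY₁) (hsub hX₂) (hsub hY₂) hε
    (fun q hq => hXY₁ q (hS'S hq)) (fun q hq => hXY₂ q (hS'S hq)) (Z := fun q => (σ q)⁻¹)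
    ((hσ.mono hS'S).inv hσ0)
    (fun q hq => by rw [hX q (hS'S hq), smul_smul, inv_mul_cancel₀ (hσ0 q hq), one_smul])
    (fun q hq => by
      rw [hZd q hq, hX q (hS'S hq), map_smul, smul_apply, hXσ q hq, smul_zero, smul_zero])
    hq₀' hX₁q (by
      rw [hZd q₀ hq₀']
      exact smul_ne_zero (neg_ne_zero.2 (inv_ne_zero (pow_ne_zero 2 (hσ0 q₀ hq₀')))) hσq)
  refine ⟨Φ, h1, h2.trans hS'S, h3, h4, h6, fun q hq => ?_, h7⟩
  have hqS' := h2 hq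
  have : X₂ q = (σ q)⁻¹ • X₁ q := by
    rw [hX q (hS'S hqS'), smul_smul, inv_mul_cancel₀ (hσ0 q hqS'), one_smul]
  rw [this, map_smul, h6 q hq, h5]
  simp

/-! ### Complex conjugation of the canonical coordinates. -/

section Reflection

/-- Complex conjugation of the plane. -/
def reflect : Plane ≃L[ℝ] Plane :=
  (ContinuousLinearEquiv.refl ℝ ℝ).prodCongr (ContinuousLinearEquiv.neg ℝ)

theorem reflect_apply (p : Plane) : reflect p = (p.1, -p.2) := rfl
theorem reflect_symm_apply (p : Plane) : reflect.symm p = (p.1, -p.2) := rfl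

/-- Complex conjugation of independent and dependent variables. -/
def reflect₂ : PointSpace ≃L[ℝ] PointSpace := reflect.prodCongr reflect

theorem reflect₂_apply (q : PointSpace) : reflect₂ q = (reflect q.1, reflect q.2) := rfl
-- Conjugating both variables preserves the Cauchy–Riemann equations and conjugates u_zz, hence the
-- sign of W₂.
theorem onSystem_reflect_iff {W₁ W₂ : Plane → ℝ} {U : Plane → Plane} {p : Plane}
    (hU : ContDiffAt ℝ 2 U p) :
    OnSystem (fun a => W₁ a.1.1) (fun a => W₂ a.1.1)
        (jetOf (conjugate reflect reflect U) (reflect p)) ↔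
      OnSystem (fun a => W₁ (reflect a.1.1)) (fun a => -W₂ (reflect a.1.1)) (jetOf U p) := by
  have hU' : ContDiffAt ℝ 2 U (reflect.symm (reflect p)) := by simpa using hU
  have e1 : reflect.symm (1, 0) = (1, 0) := by rw [reflect_symm_apply]; simp
  have e2 : reflect.symm (0, 1) = -(0, 1) := by rw [reflect_symm_apply]; simp
  rw [jetOf_eq hU, jetOf_eq (contDiffAt_conjugate _ _ hU')]
  simp only [fderiv_conjugate, fderiv_fderiv_conjugate _ _ hU', e1, e2,
    ContinuousLinearEquiv.symm_apply_apply, map_neg, neg_apply, neg_neg]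
  simp only [OnSystem, secondOrder, cauchyRiemann, cauchyRiemannX, cauchyRiemannY, Jet.ux,
    Jet.uy, Jet.uxx, Jet.uxy, Jet.uyy, reflect_apply, Prod.mk_eq_zero, Prod.fst_neg, Prod.snd_neg]
  constructor <;> rintro ⟨⟨h1, h2⟩, ⟨h3, h4⟩, ⟨h5, h6⟩, h7, h8⟩ <;>
    refine ⟨⟨?_, ?_⟩, ⟨?_, ?_⟩, ⟨?_, ?_⟩, ?_, ?_⟩ <;> linarith

theorem Reduces.transHomeomorph_reflect₂ {Ψ : OpenPartialHomeomorph PointSpace PointSpace}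
    {w₁ w₂ : PointSpace × (ℝ × ℝ) → ℝ} {W₁ W₂ : Plane → ℝ}
    (h : Reduces Ψ w₁ w₂ (fun a => W₁ a.1.1) (fun a => W₂ a.1.1)) :
    Reduces (Ψ.transHomeomorph reflect₂.toHomeomorph) w₁ w₂
      (fun a => W₁ (reflect a.1.1)) (fun a => -W₂ (reflect a.1.1)) := by
  refine reduces_of_onSystem_iff fun V u V' U hc p hp => ?_
  have hΨ : ∀ q, Ψ.transHomeomorph reflect₂.toHomeomorph q = reflect₂ (Ψ q) := fun q => rfl
  have hrr : ∀ p, reflect (reflect p) = p := fun p => by simp [reflect_apply]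
  have hrs : ∀ p, reflect.symm p = reflect p := fun p => rfl
  have hc' : CarriesMap Ψ V u (reflect ⁻¹' V') (conjugate reflect reflect U) := by
    obtain ⟨h1, h2, h3, h4, h5, h6⟩ := hc
    refine ⟨h1, h2.preimage reflect.continuous, h3, contDiffOn_conjugate _ _ h4, h5, ?_⟩
    have e : Ψ '' graphOver u V =
        reflect₂ '' (Ψ.transHomeomorph reflect₂.toHomeomorph '' graphOver u V) := by
      rw [image_image]
      refine image_congr fun q _ => ?_
      simp [hΨ, reflect₂_apply, hrr]
    rw [e, h6]
    ext Q
    constructor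
    · rintro ⟨_, ⟨P, hP, rfl⟩, rfl⟩
      refine ⟨reflect P, by simpa [hrr] using hP, ?_⟩
      simp [conjugate, hrs, hrr, reflect₂_apply]
    · rintro ⟨P, hP, rfl⟩
      refine ⟨_, ⟨reflect P, hP, rfl⟩, ?_⟩
      simp [conjugate, hrs, hrr, reflect₂_apply]
  have hm := (hc.mapsTo hp).2.1
  have key := onSystem_reflect_iff (W₁ := W₁) (W₂ := W₂)
    (hc.2.2.2.1.contDiffAt (hc.2.1.mem_nhds hm))
  have e : reflect (Ψ.transHomeomorph reflect₂.toHomeomorph (p, u p)).1 = (Ψ (p, u p)).1 :=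
    hrr (Ψ (p, u p)).1
  rw [(h V u _ _ hc').1 p hp, ← key, e]

end Reflection

/-! ### The complex factor σ and the return to real coordinates. -/

theorem toC₂_fderiv_realify {Φ : OpenPartialHomeomorph (ℂ × ℂ) (ℂ × ℂ)}
    (hΦ : ContDiffOn ℂ ∞ Φ Φ.source) {q : PointSpace} (hq : q ∈ (realify Φ).source)
    (v : PointSpace) : fderiv ℝ (realify Φ) q v = toC₂.symm (fderiv ℂ Φ (toC₂ q) (toC₂ v)) := by
  have hd : DifferentiableAt ℂ Φ (toC₂ q) :=
    (hΦ.contDiffAt (Φ.open_source.mem_nhds hq)).differentiableAt (by simp)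
  rw [← fderiv_real_eq hd]
  exact fderiv_conjugate toC₂.symm toC₂.symm Φ q v

theorem isPointTransformation_realify {Φ : OpenPartialHomeomorph (ℂ × ℂ) (ℂ × ℂ)}
    (hΦ : ContDiffOn ℂ ∞ Φ Φ.source) (hΦ' : ContDiffOn ℂ ∞ Φ.symm Φ.target) :
    IsPointTransformation (realify Φ) :=
  ⟨contDiffOn_conjugate toC₂.symm toC₂.symm (hΦ.restrict_scalars ℝ),
    contDiffOn_conjugate toC₂.symm toC₂.symm (hΦ'.restrict_scalars ℝ)⟩

theorem isPreconnected_toC₂_symm_preimage {Ω : Set PointSpace} (hΩ : IsPreconnected Ω) :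
    IsPreconnected (toC₂.symm ⁻¹' Ω) := by
  rw [← toC₂.image_eq_preimage_symm]
  exact hΩ.image _ toC₂.continuous.continuousOn

theorem fderiv_comp_toC₂_symm {F : Type*} [NormedAddCommGroup F] [NormedSpace ℝ F]
    (σ : PointSpace → F) (q v : PointSpace) :
    fderiv ℝ (fun y => σ (toC₂.symm y)) (toC₂ q) (toC₂ v) = fderiv ℝ σ q v := by
  have := fderiv_conjugate toC₂ (ContinuousLinearEquiv.refl ℝ F) σ (toC₂ q) (toC₂ v)
  rw [ContinuousLinearEquiv.symm_apply_apply, ContinuousLinearEquiv.symm_apply_apply] at this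
  exact this

/-- A real-valued function that is holomorphic has vanishing differential. -/
theorem fderiv_eq_zero_of_ofReal {ρ : PointSpace → ℝ} {q : PointSpace}
    (hρ : DifferentiableAt ℝ ρ q)
    (h : DifferentiableAt ℂ (fun y => (ρ (toC₂.symm y) : ℂ)) (toC₂ q)) : fderiv ℝ ρ q = 0 := by
  have hre : ∀ v, fderiv ℂ (fun y => (ρ (toC₂.symm y) : ℂ)) (toC₂ q) (toC₂ v) =
      (fderiv ℝ ρ q v : ℂ) := by
    intro v
    rw [← fderiv_real_eq h, fderiv_comp_toC₂_symm (fun q => (ρ q : ℂ))]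
    exact DFunLike.congr_fun (Complex.ofRealCLM.hasFDerivAt.comp q hρ.hasFDerivAt).fderiv v
  refine ContinuousLinearMap.ext fun v => ?_
  -- The derivative along iv is real, but by complex linearity it is also i times the real
  -- derivative along v.
  have h1 := hre (toC₂.symm (Complex.I • toC₂ v))
  rw [ContinuousLinearEquiv.apply_symm_apply, map_smul, hre v] at h1
  have := congrArg Complex.im h1
  simpa using this

variable {Ω : Set PointSpace} {w₁ w₂ : PointSpace × (ℝ × ℝ) → ℝ}
  {X₁ Y₁ X₂ Y₂ : PointSpace → PointSpace} {ρ₁ ρ₂ : PointSpace → ℝ}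

/-- The two fields `X₂, Y₂` are dependent over `ℂ`, with factor `±i`. -/
theorem exists_smul_I (hΩ : IsOpen Ω) (hΩc : IsPreconnected Ω)
    (hX₁ : IsSymmetry Ω w₁ w₂ X₁) (hY₁ : IsSymmetry Ω w₁ w₂ Y₁)
    (hX₂ : IsSymmetry Ω w₁ w₂ X₂) (hY₂ : IsSymmetry Ω w₁ w₂ Y₂)
    (hρ₁ : ContDiffOn ℝ ∞ ρ₁ Ω) (hρ₂ : ContDiffOn ℝ ∞ ρ₂ Ω) (hρ₁c : NonconstantOn ρ₁ Ω)
    (hX : ∀ q ∈ Ω, X₁ q = ρ₁ q • X₂ q - ρ₂ q • Y₂ q)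
    (hY : ∀ q ∈ Ω, Y₁ q = ρ₁ q • Y₂ q + ρ₂ q • X₂ q) :
    ∃ s : ℝ, (s = 1 ∨ s = -1) ∧
      ∀ q ∈ Ω, toC₂ (Y₂ q) = -(s * Complex.I) • toC₂ (X₂ q) := by
  have hS := isOpen_toC₂_symm_preimage hΩ
  have hSc := isPreconnected_toC₂_symm_preimage hΩc
  by_contra! hcon
  -- If Y₂ + siX₂ is not identically zero, then ρ₁ − siρ₂ is the smooth quotient of the holomorphic
  -- maps Y₁ + siX₁ and Y₂ + siX₂. The half-sum over both signs is ρ₁.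
  have hol : ∀ s : ℝ, (s = 1 ∨ s = -1) →
      ContDiffOn ℂ ∞ (fun y => (ρ₁ (toC₂.symm y) : ℂ) - s * Complex.I * ρ₂ (toC₂.symm y))
        (toC₂.symm ⁻¹' Ω) := by
    intro s hs
    obtain ⟨q, hq, hne⟩ := hcon s hs
    have hss : (s : ℂ) * s = 1 := by rcases hs with rfl | rfl <;> simp
    refine contDiffOn_of_smul_eq hS hSc
      (P := fun y => conjugate toC₂ toC₂ Y₁ y + (s * Complex.I) • conjugate toC₂ toC₂ X₁ y)
      (Q := fun y => conjugate toC₂ toC₂ Y₂ y + (s * Complex.I) • conjugate toC₂ toC₂ X₂ y)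
      ((hY₁.contDiffOn_complex hΩ).add ((hX₁.contDiffOn_complex hΩ).const_smul _))
      ((hY₂.contDiffOn_complex hΩ).add ((hX₂.contDiffOn_complex hΩ).const_smul _)) ?_ ?_ ?_
    · have h1 : ContDiffOn ℝ ∞ (fun y => ρ₁ (toC₂.symm y)) (toC₂.symm ⁻¹' Ω) :=
        hρ₁.comp toC₂.symm.contDiff.contDiffOn (mapsTo_preimage _ _)
      have h2 : ContDiffOn ℝ ∞ (fun y => ρ₂ (toC₂.symm y)) (toC₂.symm ⁻¹' Ω) :=
        hρ₂.comp toC₂.symm.contDiff.contDiffOn (mapsTo_preimage _ _)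
      exact (Complex.ofRealCLM.contDiff.comp_contDiffOn h1).sub
        (contDiffOn_const.mul (Complex.ofRealCLM.contDiff.comp_contDiffOn h2))
    · intro y hy
      simp only [conjugate, hX _ hy, hY _ hy, map_sub, map_add, map_smul]
      have hc : ∀ (c : ℝ) (x : ℂ × ℂ), c • x = (c : ℂ) • x := fun c x => rfl
      simp only [hc]
      generalize toC₂ (X₂ (toC₂.symm y)) = a
      generalize toC₂ (Y₂ (toC₂.symm y)) = b
      ext <;> simp <;> linear_combination (norm := (ring_nf; simp [pow_two, hss]))
    · refine ⟨toC₂ q, by simpa using hq, fun h => hne ?_⟩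
      simp only [conjugate, ContinuousLinearEquiv.symm_apply_apply] at h
      rw [neg_smul]
      exact eq_neg_of_add_eq_zero_left h
  have hρC : ContDiffOn ℂ ∞ (fun y => (ρ₁ (toC₂.symm y) : ℂ)) (toC₂.symm ⁻¹' Ω) := by
    refine (((hol 1 (.inl rfl)).add (hol (-1) (.inr rfl))).const_smul (1 / 2 : ℂ)).congr
      fun y _ => ?_
    simp
    ring
  have hzero : EqOn (fderiv ℝ ρ₁) 0 Ω := fun q hq =>
    fderiv_eq_zero_of_ofReal ((hρ₁.contDiffAt (hΩ.mem_nhds hq)).differentiableAt (by simp))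
      ((hρC.contDiffAt (hS.mem_nhds (by simpa using hq))).differentiableAt (by simp))
  refine hρ₁c ?_
  rcases Ω.eq_empty_or_nonempty with rfl | ⟨c, hc⟩
  · exact ⟨0, by simp⟩
  · exact ⟨ρ₁ c, fun q hq => hΩ.is_const_of_fderiv_eq_zero hΩc (hρ₁.differentiableOn (by simp))
      hzero hq hc⟩

section Factor

variable {s : ℝ}

/-- The complex factor `ρ₁ + s i ρ₂`, as a function on `ℂ²`. -/
def factor (s : ℝ) (ρ₁ ρ₂ : PointSpace → ℝ) (y : ℂ × ℂ) : ℂ :=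
  toC (ρ₁ (toC₂.symm y), s * ρ₂ (toC₂.symm y))

theorem eq_factor_smul (hXY : ∀ q ∈ Ω, toC₂ (Y₂ q) = -(s * Complex.I) • toC₂ (X₂ q))
    (hX : ∀ q ∈ Ω, X₁ q = ρ₁ q • X₂ q - ρ₂ q • Y₂ q) :
    ∀ y ∈ toC₂.symm ⁻¹' Ω, conjugate toC₂ toC₂ X₁ y =
      factor s ρ₁ ρ₂ y • conjugate toC₂ toC₂ X₂ y := by
  intro y hy
  have hf : factor s ρ₁ ρ₂ y = ρ₁ (toC₂.symm y) + s * Complex.I * ρ₂ (toC₂.symm y) := by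
    apply Complex.ext <;> simp [factor]
  have hc : ∀ (c : ℝ) (x : ℂ × ℂ), c • x = (c : ℂ) • x := fun c x => rfl
  simp only [conjugate, hX _ hy, map_sub, map_smul, hXY _ hy, hf, hc]
  ext <;> simp <;> ring

/-- (X₁, Y₁) arises from (X₂, Y₂) by the rule of complex multiplication, so the relation Y = −siX is
inherited; this uses (si)² = −1. -/
theorem conjugate_eq_smul (hs : s = 1 ∨ s = -1)
    (hXY : ∀ q ∈ Ω, toC₂ (Y₂ q) = -(s * Complex.I) • toC₂ (X₂ q))
    (hX : ∀ q ∈ Ω, X₁ q = ρ₁ q • X₂ q - ρ₂ q • Y₂ q)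
    (hY : ∀ q ∈ Ω, Y₁ q = ρ₁ q • Y₂ q + ρ₂ q • X₂ q) :
    ∀ y ∈ toC₂.symm ⁻¹' Ω, conjugate toC₂ toC₂ Y₁ y =
      -(s * Complex.I) • conjugate toC₂ toC₂ X₁ y := by
  intro y hy
  have hc : ∀ (c : ℝ) (x : ℂ × ℂ), c • x = (c : ℂ) • x := fun c x => rfl
  simp only [conjugate, hX _ hy, hY _ hy, map_sub, map_add, map_smul, hXY _ hy, hc]
  have hI := Complex.I_sq
  rcases hs with rfl | rfl
  · ext
    · simp; linear_combination ((ρ₂ (toC₂.symm y) : ℂ) * toC (X₂ (toC₂.symm y)).1) * hI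
    · simp; linear_combination ((ρ₂ (toC₂.symm y) : ℂ) * toC (X₂ (toC₂.symm y)).2) * hI
  · ext
    · simp; linear_combination ((ρ₂ (toC₂.symm y) : ℂ) * toC (X₂ (toC₂.symm y)).1) * hI
    · simp; linear_combination ((ρ₂ (toC₂.symm y) : ℂ) * toC (X₂ (toC₂.symm y)).2) * hI

theorem contDiffOn_factor (hΩ : IsOpen Ω) (hΩc : IsPreconnected Ω)
    (hX₁ : IsSymmetry Ω w₁ w₂ X₁) (hX₂ : IsSymmetry Ω w₁ w₂ X₂) (hX₂0 : ∃ q ∈ Ω, X₂ q ≠ 0)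
    (hρ₁ : ContDiffOn ℝ ∞ ρ₁ Ω) (hρ₂ : ContDiffOn ℝ ∞ ρ₂ Ω)
    (hXY : ∀ q ∈ Ω, toC₂ (Y₂ q) = -(s * Complex.I) • toC₂ (X₂ q))
    (hX : ∀ q ∈ Ω, X₁ q = ρ₁ q • X₂ q - ρ₂ q • Y₂ q) :
    ContDiffOn ℂ ∞ (factor s ρ₁ ρ₂) (toC₂.symm ⁻¹' Ω) := by
  refine contDiffOn_of_smul_eq (isOpen_toC₂_symm_preimage hΩ)
    (isPreconnected_toC₂_symm_preimage hΩc) (hX₁.contDiffOn_complex hΩ)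
    (hX₂.contDiffOn_complex hΩ) ?_ (eq_factor_smul hXY hX) ?_
  · exact toC.contDiff.comp_contDiffOn
      ((hρ₁.prodMk (contDiffOn_const.mul hρ₂)).comp toC₂.symm.contDiff.contDiffOn
        (mapsTo_preimage _ _))
  · obtain ⟨q, hq, h⟩ := hX₂0
    exact ⟨toC₂ q, by simpa using hq, by simpa [conjugate] using h⟩

/-- The real and imaginary parts of σ are ρ₁ and sρ₂, so dσ vanishes exactly when both real
differentials do. -/
theorem fderiv_factor_ne_zero_iff (hs : s ≠ 0) {q : PointSpace} (hρ₁ : DifferentiableAt ℝ ρ₁ q)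
    (hρ₂ : DifferentiableAt ℝ ρ₂ q) (hσ : DifferentiableAt ℂ (factor s ρ₁ ρ₂) (toC₂ q)) :
    fderiv ℂ (factor s ρ₁ ρ₂) (toC₂ q) ≠ 0 ↔ fderiv ℝ ρ₁ q ≠ 0 ∨ fderiv ℝ ρ₂ q ≠ 0 := by
  have key : ∀ v, fderiv ℂ (factor s ρ₁ ρ₂) (toC₂ q) (toC₂ v) =
      toC (fderiv ℝ ρ₁ q v, s * fderiv ℝ ρ₂ q v) := by
    intro v
    rw [← fderiv_real_eq hσ]
    have h1 := fderiv_comp_toC₂_symm (fun q => toC (ρ₁ q, s * ρ₂ q)) q v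
    have h2 := (toC.hasFDerivAt.comp q
      (hρ₁.hasFDerivAt.prodMk (hρ₂.hasFDerivAt.const_mul s))).fderiv
    exact h1.trans (DFunLike.congr_fun h2 v)
  rw [← not_iff_not, not_or, not_not, not_not, not_not]
  constructor
  · intro h
    have h0 : ∀ v, (fderiv ℝ ρ₁ q v, s * fderiv ℝ ρ₂ q v) = (0 : Plane) := by
      intro v
      apply toC.injective
      rw [← key, h, map_zero]; rfl
    constructor
    · exact ContinuousLinearMap.ext fun v => congrArg Prod.fst (h0 v)
    · exact ContinuousLinearMap.ext fun v =>
        (mul_eq_zero.1 (congrArg Prod.snd (h0 v))).resolve_left hs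
  · rintro ⟨h1, h2⟩
    refine ContinuousLinearMap.ext fun y => ?_
    have := key (toC₂.symm y)
    rw [ContinuousLinearEquiv.apply_symm_apply, h1, h2] at this
    rw [this, zero_apply, zero_apply, mul_zero]
    exact map_zero toC

/-- The regular points are dense. -/
theorem subset_closure_regularSet (hΩ : IsOpen Ω) (hΩc : IsPreconnected Ω) (hs : s ≠ 0)
    (hX₁ : IsSymmetry Ω w₁ w₂ X₁) (hX₂ : IsSymmetry Ω w₁ w₂ X₂) (hX₂0 : ∃ q ∈ Ω, X₂ q ≠ 0)
    (hρ₁ : ContDiffOn ℝ ∞ ρ₁ Ω) (hρ₂ : ContDiffOn ℝ ∞ ρ₂ Ω) (hρ₁c : NonconstantOn ρ₁ Ω)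
    (hXY : ∀ q ∈ Ω, toC₂ (Y₂ q) = -(s * Complex.I) • toC₂ (X₂ q))
    (hX : ∀ q ∈ Ω, X₁ q = ρ₁ q • X₂ q - ρ₂ q • Y₂ q) :
    Ω ⊆ closure (regularSet Ω X₁ ρ₁ ρ₂) := by
  have hS := isOpen_toC₂_symm_preimage hΩ
  have hσ := contDiffOn_factor hΩ hΩc hX₁ hX₂ hX₂0 hρ₁ hρ₂ hXY hX
  intro q hq
  have hfreq := frequently_regular hS (isPreconnected_toC₂_symm_preimage hΩc)
    (hX₁.contDiffOn_complex hΩ) (hX₂.contDiffOn_complex hΩ)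
    (hX₂0.imp' toC₂ fun q h => ⟨by simpa using h.1, by simpa [conjugate] using h.2⟩) hσ
    (fun ⟨c, hc⟩ => hρ₁c ⟨c.re, fun q hq => by
      have := congrArg Complex.re (hc (toC₂ q) (by simpa using hq))
      simpa [factor] using this⟩)
    (eq_factor_smul hXY hX) (toC₂ q) (by simpa using hq)
  rw [mem_closure_iff_frequently]
  have hsymm : Tendsto toC₂.symm (𝓝 (toC₂ q)) (𝓝 q) := by
    simpa using toC₂.symm.continuous.tendsto (toC₂ q)
  refine hsymm.frequently ((hfreq.and_eventually
    (hS.mem_nhds (show toC₂ q ∈ toC₂.symm ⁻¹' Ω by simpa using hq))).mono ?_)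
  rintro y ⟨⟨h1, h2⟩, hy⟩
  have hd : ∀ {ρ : PointSpace → ℝ}, ContDiffOn ℝ ∞ ρ Ω → DifferentiableAt ℝ ρ (toC₂.symm y) :=
    fun h => (h.contDiffAt (hΩ.mem_nhds hy)).differentiableAt (by simp)
  refine ⟨hy, fun h => h1 (by simp [conjugate, h]),
    (fderiv_factor_ne_zero_iff hs (hd hρ₁) (hd hρ₂) ?_).1 (by simpa using h2)⟩
  simpa using (hσ.contDiffAt (hS.mem_nhds hy)).differentiableAt (by simp)

/-- The commutation relation in holomorphic form. -/
theorem fderiv_comm_of_lieBracket (hΩ : IsOpen Ω) (hs : s = 1 ∨ s = -1)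
    (hX₁ : IsSymmetry Ω w₁ w₂ X₁) (hX₂ : IsSymmetry Ω w₁ w₂ X₂)
    (hXY₁ : ∀ y ∈ toC₂.symm ⁻¹' Ω, conjugate toC₂ toC₂ Y₁ y =
      -(s * Complex.I) • conjugate toC₂ toC₂ X₁ y)
    (hXY₂ : ∀ y ∈ toC₂.symm ⁻¹' Ω, conjugate toC₂ toC₂ Y₂ y =
      -(s * Complex.I) • conjugate toC₂ toC₂ X₂ y)
    (hcomm : ∀ q ∈ Ω,
      VectorField.lieBracket ℝ X₁ X₂ q - VectorField.lieBracket ℝ Y₁ Y₂ q = 0) :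
    ∀ y ∈ toC₂.symm ⁻¹' Ω,
      fderiv ℂ (conjugate toC₂ toC₂ X₂) y (conjugate toC₂ toC₂ X₁ y) =
        fderiv ℂ (conjugate toC₂ toC₂ X₁) y (conjugate toC₂ toC₂ X₂ y) := by
  intro y hy
  have hS := isOpen_toC₂_symm_preimage hΩ
  have hd : ∀ {X : PointSpace → PointSpace}, IsSymmetry Ω w₁ w₂ X →
      DifferentiableAt ℂ (conjugate toC₂ toC₂ X) y := fun h =>
    ((h.contDiffOn_complex hΩ).contDiffAt (hS.mem_nhds hy)).differentiableAt (by simp)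
  have hbr : ∀ V W : PointSpace → PointSpace,
      toC₂ (VectorField.lieBracket ℝ V W (toC₂.symm y)) =
        fderiv ℝ (conjugate toC₂ toC₂ W) y (conjugate toC₂ toC₂ V y) -
          fderiv ℝ (conjugate toC₂ toC₂ V) y (conjugate toC₂ toC₂ W y) := by
    intro V W
    rw [VectorField.lieBracket, map_sub, toC₂_fderiv, toC₂_fderiv]
    simp [conjugate]
  have hfY : ∀ {X Y : PointSpace → PointSpace}, IsSymmetry Ω w₁ w₂ X →
      (∀ y ∈ toC₂.symm ⁻¹' Ω, conjugate toC₂ toC₂ Y y =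
        -(s * Complex.I) • conjugate toC₂ toC₂ X y) → ∀ v,
      fderiv ℝ (conjugate toC₂ toC₂ Y) y v =
        -(s * Complex.I) • fderiv ℂ (conjugate toC₂ toC₂ X) y v := by
    intro X Y hX h v
    have hev : conjugate toC₂ toC₂ Y =ᶠ[𝓝 y]
        fun y => -(s * Complex.I) • conjugate toC₂ toC₂ X y := by
      filter_upwards [hS.mem_nhds hy] with x hx using h x hx
    have hd' := (hd hX).hasFDerivAt.const_smul (-(s * Complex.I))
    rw [hev.fderiv_eq]
    exact (fderiv_real_eq hd'.differentiableAt v).trans (DFunLike.congr_fun hd'.fderiv v)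
  have h := congrArg toC₂ (hcomm _ hy)
  rw [map_sub, map_zero, hbr, hbr, hfY hX₁ hXY₁, hfY hX₂ hXY₂, hXY₁ y hy, hXY₂ y hy,
    fderiv_real_eq (hd hX₁), fderiv_real_eq (hd hX₂), map_smul, map_smul, smul_smul, smul_smul,
    ← smul_sub] at h
  -- Hence [Y₁, Y₂] = −[X₁, X₂], and the bracket relation says 2[X₁, X₂] = 0.
  have hε : -((s : ℂ) * Complex.I) * -(s * Complex.I) = -1 := by
    rcases hs with rfl | rfl <;> simp
  rw [hε, neg_one_smul, sub_neg_eq_add, ← two_smul ℂ, smul_eq_zero] at h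
  exact sub_eq_zero.1 (h.resolve_left two_ne_zero)

/-- Canonical coordinates, up to a reflection when `s = -1`. -/
theorem exists_canonical_coordinates_real (hΩ : IsOpen Ω) (hΩc : IsPreconnected Ω)
    (hw₁ : ContDiffOn ℝ ∞ w₁ (Ω ×ˢ univ)) (hw₂ : ContDiffOn ℝ ∞ w₂ (Ω ×ˢ univ))
    (hs : s = 1 ∨ s = -1)
    (hX₁ : IsSymmetry Ω w₁ w₂ X₁) (hY₁ : IsSymmetry Ω w₁ w₂ Y₁)
    (hX₂ : IsSymmetry Ω w₁ w₂ X₂) (hY₂ : IsSymmetry Ω w₁ w₂ Y₂) (hX₂0 : ∃ q ∈ Ω, X₂ q ≠ 0)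
    (hρ₁ : ContDiffOn ℝ ∞ ρ₁ Ω) (hρ₂ : ContDiffOn ℝ ∞ ρ₂ Ω)
    (hXY : ∀ q ∈ Ω, toC₂ (Y₂ q) = -(s * Complex.I) • toC₂ (X₂ q))
    (hX : ∀ q ∈ Ω, X₁ q = ρ₁ q • X₂ q - ρ₂ q • Y₂ q)
    (hY : ∀ q ∈ Ω, Y₁ q = ρ₁ q • Y₂ q + ρ₂ q • X₂ q)
    (hcomm : ∀ q ∈ Ω,
      VectorField.lieBracket ℝ X₁ X₂ q - VectorField.lieBracket ℝ Y₁ Y₂ q = 0)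
    {q₀ : PointSpace} (hq₀ : q₀ ∈ regularSet Ω X₁ ρ₁ ρ₂) :
    ∃ Φ : OpenPartialHomeomorph PointSpace PointSpace,
      q₀ ∈ Φ.source ∧ Φ.source ⊆ Ω ∧ IsPointTransformation Φ ∧
      Carries Φ X₁ (fun _ => ((0, 0), (1, 0))) ∧
      Carries Φ Y₁ (fun _ => ((0, 0), (0, -s))) ∧
      Carries Φ X₂ (fun Q => ((0, 0), (Q.1.1, Q.1.2))) ∧
      Carries Φ Y₂ (fun Q => ((0, 0), (s * Q.1.2, -(s * Q.1.1)))) ∧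
      ∃ W₁ W₂ : Plane → ℝ,
        ContDiffOn ℝ ∞ W₁ (Prod.fst '' Φ.target) ∧ ContDiffOn ℝ ∞ W₂ (Prod.fst '' Φ.target) ∧
        Reduces Φ w₁ w₂ (fun a => W₁ a.1.1) (fun a => W₂ a.1.1) := by
  obtain ⟨hq₀Ω, hX₁q, hdρ⟩ := hq₀
  have hs0 : s ≠ 0 := by rcases hs with rfl | rfl <;> simp
  have hS := isOpen_toC₂_symm_preimage hΩ
  have hσ := contDiffOn_factor hΩ hΩc hX₁ hX₂ hX₂0 hρ₁ hρ₂ hXY hX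
  have hq₀S : toC₂ q₀ ∈ toC₂.symm ⁻¹' Ω := by simpa using hq₀Ω
  have hd : ∀ {ρ : PointSpace → ℝ}, ContDiffOn ℝ ∞ ρ Ω → DifferentiableAt ℝ ρ q₀ :=
    fun h => (h.contDiffAt (hΩ.mem_nhds hq₀Ω)).differentiableAt (by simp)
  have hXY₁ := conjugate_eq_smul hs hXY hX hY
  have hXY₂ : ∀ y ∈ toC₂.symm ⁻¹' Ω, conjugate toC₂ toC₂ Y₂ y =
      -(s * Complex.I) • conjugate toC₂ toC₂ X₂ y := fun y hy => hXY _ hy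
  obtain ⟨Φ, h1, h2, h3, h4, h5, h6, W, hW, h7⟩ := exists_canonical_coordinates hS
    (contDiffOn_complexRhs hw₁ hw₂) (hX₁.isHolSymmetry hΩ hw₁ hw₂) (hY₁.isHolSymmetry hΩ hw₁ hw₂)
    (hX₂.isHolSymmetry hΩ hw₁ hw₂) (hY₂.isHolSymmetry hΩ hw₁ hw₂) (ε := -(s * Complex.I))
    (by simpa using hs0) hXY₁ hXY₂ hσ (eq_factor_smul hXY hX)
    (fderiv_comm_of_lieBracket hΩ hs hX₁ hX₂ hXY₁ hXY₂ hcomm) hq₀S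
    (by simpa [conjugate] using hX₁q)
    ((fderiv_factor_ne_zero_iff hs0 (hd hρ₁) (hd hρ₂)
      ((hσ.contDiffAt (hS.mem_nhds hq₀S)).differentiableAt (by simp))).2 hdρ)
  have hconj : ∀ (X : PointSpace → PointSpace) q,
      conjugate toC₂ toC₂ X (toC₂ q) = toC₂ (X q) := fun X q => by simp [conjugate]
  have hsub : (realify Φ).source ⊆ Ω := fun q hq => by simpa using h2 hq
  have c1 : ∀ q ∈ (realify Φ).source, fderiv ℂ Φ (toC₂ q) (toC₂ (X₁ q)) = (0, 1) :=
    fun q hq => by rw [← hconj, h5 (toC₂ q) hq]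
  have c2 : ∀ q ∈ (realify Φ).source,
      fderiv ℂ Φ (toC₂ q) (toC₂ (X₂ q)) = (0, (Φ (toC₂ q)).1) :=
    fun q hq => by rw [← hconj, h6 (toC₂ q) hq]
  have hY₁C : ∀ q ∈ Ω, toC₂ (Y₁ q) = -(s * Complex.I) • toC₂ (X₁ q) := fun q hq => by
    rw [← hconj, ← hconj, hXY₁ _ (by simpa using hq)]
  have hre : ∀ q, (Φ (toC₂ q)).1.re = (realify Φ q).1.1 := fun q => rfl
  have him : ∀ q, (Φ (toC₂ q)).1.im = (realify Φ q).1.2 := fun q => rfl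
  have hmaps : MapsTo toC (Prod.fst '' (realify Φ).target) (Prod.fst '' Φ.target) := by
    rintro _ ⟨Q, hQ, rfl⟩
    exact ⟨toC₂ Q, hQ, rfl⟩
  have hWs := hW.comp toC.contDiff.contDiffOn hmaps
  refine ⟨realify Φ, h1, hsub, isPointTransformation_realify h3 h4, fun q hq => ?_, fun q hq => ?_,
    fun q hq => ?_, fun q hq => ?_, fun p => (W (toC p)).re, fun p => (W (toC p)).im,
    Complex.reCLM.contDiff.comp_contDiffOn hWs, Complex.imCLM.contDiff.comp_contDiffOn hWs,
    reduces_realify h3 h4 h7⟩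
  · rw [toC₂_fderiv_realify h3 hq, c1 q hq]; rfl
  · rw [toC₂_fderiv_realify h3 hq, hY₁C q (hsub hq), map_smul, c1 q hq]
    ext <;> simp
  · rw [toC₂_fderiv_realify h3 hq, c2 q hq]; rfl
  · rw [toC₂_fderiv_realify h3 hq, hXY q (hsub hq), map_smul, c2 q hq]
    ext <;> simp [hre, him]

/-- Composition of a point transformation with the reflection `reflect₂`. -/
theorem Carries.transHomeomorph_reflect₂ {Φ : OpenPartialHomeomorph PointSpace PointSpace}
    {A B : PointSpace → PointSpace} (hΦ : ContDiffOn ℝ ∞ Φ Φ.source) (h : Carries Φ A B) :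
    Carries (Φ.transHomeomorph reflect₂.toHomeomorph) A fun Q => reflect₂ (B (reflect₂ Q)) := by
  intro q hq
  have hd : DifferentiableAt ℝ Φ q :=
    (hΦ.contDiffAt (Φ.open_source.mem_nhds hq)).differentiableAt (by simp)
  have h1 : fderiv ℝ (Φ.transHomeomorph reflect₂.toHomeomorph) q = _ :=
    (reflect₂.hasFDerivAt.comp q hd.hasFDerivAt).fderiv
  have h2 : reflect₂ (Φ.transHomeomorph reflect₂.toHomeomorph q) = Φ q :=
    reflect₂.symm_apply_apply (Φ q)
  change _ = reflect₂ (B (reflect₂ _))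
  rw [h1, h2, ← h q hq]
  rfl

theorem IsPointTransformation.transHomeomorph_reflect₂
    {Φ : OpenPartialHomeomorph PointSpace PointSpace} (hΦ : IsPointTransformation Φ) :
    IsPointTransformation (Φ.transHomeomorph reflect₂.toHomeomorph) :=
  ⟨reflect₂.contDiff.comp_contDiffOn hΦ.1,
    hΦ.2.comp reflect₂.symm.contDiff.contDiffOn (mapsTo_preimage _ _)⟩

end Factor

end ComplexLinearization

end

/-! ### The main theorem. -/

open ComplexLinearization in
theorem theorem2
    (Ω : Set PointSpace) (hΩ : IsOpen Ω) (hΩc : IsConnected Ω)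
    (w₁ w₂ : PointSpace × (ℝ × ℝ) → ℝ)
    (hw₁ : ContDiffOn ℝ ∞ w₁ (Ω ×ˢ Set.univ)) (hw₂ : ContDiffOn ℝ ∞ w₂ (Ω ×ˢ Set.univ))
    (X₁ Y₁ X₂ Y₂ : PointSpace → PointSpace)
    (hX₁ : IsSymmetry Ω w₁ w₂ X₁) (hY₁ : IsSymmetry Ω w₁ w₂ Y₁)
    (hX₂ : IsSymmetry Ω w₁ w₂ X₂) (hY₂ : IsSymmetry Ω w₁ w₂ Y₂)
    (hne : ∃ q ∈ Ω, X₂ q ≠ 0 ∨ Y₂ q ≠ 0)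
    (ρ₁ ρ₂ : PointSpace → ℝ)
    (hρ₁ : ContDiffOn ℝ ∞ ρ₁ Ω) (hρ₂ : ContDiffOn ℝ ∞ ρ₂ Ω)
    (hρ₁c : NonconstantOn ρ₁ Ω) (hρ₂c : NonconstantOn ρ₂ Ω)
    (hX : ∀ q ∈ Ω, X₁ q = ρ₁ q • X₂ q - ρ₂ q • Y₂ q)
    (hY : ∀ q ∈ Ω, Y₁ q = ρ₁ q • Y₂ q + ρ₂ q • X₂ q)
    (hcomm₁ : ∀ q ∈ Ω,
      VectorField.lieBracket ℝ X₁ X₂ q - VectorField.lieBracket ℝ Y₁ Y₂ q = 0)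
    (hcomm₂ : ∀ q ∈ Ω,
      VectorField.lieBracket ℝ X₁ Y₂ q + VectorField.lieBracket ℝ Y₁ X₂ q = 0) :
    Ω ⊆ closure (regularSet Ω X₁ ρ₁ ρ₂) ∧
    ∀ q₀ ∈ regularSet Ω X₁ ρ₁ ρ₂,
      ∃ Φ : OpenPartialHomeomorph PointSpace PointSpace,
        q₀ ∈ Φ.source ∧ Φ.source ⊆ Ω ∧ IsPointTransformation Φ ∧
        Carries Φ X₁ (fun _ => ((0, 0), (1, 0))) ∧
        Carries Φ Y₁ (fun _ => ((0, 0), (0, -1))) ∧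
        Carries Φ X₂ (fun Q => ((0, 0), (Q.1.1, Q.1.2))) ∧
        Carries Φ Y₂ (fun Q => ((0, 0), (Q.1.2, -Q.1.1))) ∧
        ∃ W₁ W₂ : ℝ × ℝ → ℝ,
          ContDiffOn ℝ ∞ W₁ (Prod.fst '' Φ.target) ∧
          ContDiffOn ℝ ∞ W₂ (Prod.fst '' Φ.target) ∧
          Reduces Φ w₁ w₂ (fun a => W₁ a.1.1) (fun a => W₂ a.1.1) := by
  obtain ⟨s, hs, hXY⟩ := exists_smul_I hΩ hΩc.isPreconnected hX₁ hY₁ hX₂ hY₂ hρ₁ hρ₂ hρ₁c hX hY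
  have hX₂0 : ∃ q ∈ Ω, X₂ q ≠ 0 := by
    obtain ⟨q, hq, h⟩ := hne
    refine ⟨q, hq, h.elim id fun h hX₂q => h ?_⟩
    have := hXY q hq
    rwa [hX₂q, map_zero, smul_zero, map_eq_zero_iff _ toC₂.injective] at this
  refine ⟨subset_closure_regularSet hΩ hΩc.isPreconnected (by rcases hs with rfl | rfl <;> simp)
    hX₁ hX₂ hX₂0 hρ₁ hρ₂ hρ₁c hXY hX, fun q₀ hq₀ => ?_⟩
  obtain ⟨Φ, h1, h2, h3, c1, c2, c3, c4, W₁, W₂, hW₁, hW₂, hr⟩ :=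
    exists_canonical_coordinates_real hΩ hΩc.isPreconnected hw₁ hw₂ hs hX₁ hY₁ hX₂ hY₂ hX₂0
      hρ₁ hρ₂ hXY hX hY hcomm₁ hq₀
  rcases hs with rfl | rfl
  · simp only [one_mul] at c4
    exact ⟨Φ, h1, h2, h3, c1, c2, c3, c4, W₁, W₂, hW₁, hW₂, hr⟩
  -- For s = −1 the coordinates bring Y₁ and Y₂ to the negatives of their canonical forms.
  -- Conjugating (X, Y) and (F, G) together flips these signs and preserves the forms of X₁ and X₂.
  · have hmaps : Set.MapsTo reflect
        (Prod.fst '' (Φ.transHomeomorph reflect₂.toHomeomorph).target) (Prod.fst '' Φ.target) := by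
      rintro _ ⟨Q, hQ, rfl⟩
      exact ⟨reflect₂ Q, hQ, rfl⟩
    refine ⟨Φ.transHomeomorph reflect₂.toHomeomorph, h1, h2, h3.transHomeomorph_reflect₂,
      ?_, ?_, ?_, ?_, fun p => W₁ (reflect p), fun p => -W₂ (reflect p),
      hW₁.comp reflect.contDiff.contDiffOn hmaps,
      (hW₂.comp reflect.contDiff.contDiffOn hmaps).neg, hr.transHomeomorph_reflect₂⟩
    · convert c1.transHomeomorph_reflect₂ h3.1 using 2
      simp [reflect₂_apply, reflect_apply]
    · convert c2.transHomeomorph_reflect₂ h3.1 using 2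
      simp [reflect₂_apply, reflect_apply]
    · convert c3.transHomeomorph_reflect₂ h3.1 using 2
      simp [reflect₂_apply, reflect_apply]
    · convert c4.transHomeomorph_reflect₂ h3.1 using 2
      simp [reflect₂_apply, reflect_apply]
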